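/- All algebras are complex and unital. A Hopf $*$-algebra is a Hopf algebra $H$ with a conjugate linear, involutive algebra anti-automorphism $*$ such that the comultiplication and the counit are $*$-homomorphisms. A matrix $u=(u_{ij})\in M_n(H)$ is the coefficient matrix of an $n$-dimensional comodule if $\Delta(u_{ij})=\sum_k u_{ik}\otimes u_{kj}$ and $\varepsilon(u_{ij})=\delta_{ij}$ (the coaction being $e_j\mapsto\sum_i e_i\otimes u_{ij}$), and the comodule is unitary, with orthonormal basis $(e_i)$, if $u$ is a unitary element of $M_n(H)$. A CQG algebra is a Hopf $*$-algebra that is the linear span of the coefficients of its unitary finite-dimensional comodules; $\mathrm{CQG}$ is the category of CQG algebras and Hopf $*$-algebra morphisms. For a positive invertible matrix $Q\in GL_n(\mathbb C)$, $A_u(Q)$ is the $*$-algebra freely generated by elements $u_{ij}$, $1\le i,j\le n$, subject to the relations making both $u=(u_{ij})$ and $Q^{1/2}\overline{u}Q^{-1/2}$ unitary, where $\overline{u}=(u_{ij}^*)$; it is a CQG algebra with $\Delta(u_{ij})=\sum_k u_{ik}\otimes u_{kj}$ and $\varepsilon(u_{ij})=\delta_{ij}$. An object $x$ of a category $\mathcal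 C$ is finitely presentable if $\mathcal C(x,-)$ preserves filtered colimits. A set $S$ of objects of a cocomplete category is a regular generator if any two distinct parallel arrows stay distinct after composition with some arrow out of an object in $S$, and every object is the coequalizer of two parallel arrows $f,g:y\to z$ with $y$ and $z$ coproducts of objects in $S$. A category is locally finitely presentable if it is cocomplete and there is a set of finitely presentable objects such that every object is a filtered colimit of objects in that set. **Theorem.** The category $\mathrm{CQG}$ is cocomplete; each $A_u(Q)$, for $Q\in GL_n(\mathbb C)$ positive, is a finitely presentable object of $\mathrm{CQG}$; the set of all $A_u(Q)$ (for all $n$ and $Q$) is a regular generator in $\mathrm{CQG}$; and $\mathrm{CQG}$ is locally finitely presentable. -/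

import Mathlib

open CategoryTheory CategoryTheory.Limits

universe u

/-! ### Hopf `*`-algebras and CQG algebras -/

namespace QuantumGroup

open scoped TensorProduct

/-- A complex Hopf algebra with a `*`-algebra structure (a conjugate linear involutive algebra
anti-automorphism) is a Hopf `*`-algebra if the comultiplication and the counit are morphisms of
`*`-algebras.  The involution of `H ⊗ H` is `(a ⊗ b)* = a* ⊗ b*`. -/
class IsHopfStarAlgebra (H : Type*) [Ring H] [HopfAlgebra ℂ H] [StarRing H] [StarModule ℂ H] :
    Prop where
  comul_star (a : H) : Coalgebra.comul (R := ℂ) (star a) = star (Coalgebra.comul (R := ℂ) a)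
  counit_star (a : H) : Coalgebra.counit (R := ℂ) (star a) = star (Coalgebra.counit (R := ℂ) a)

/-- `u = (u i j)` is the coefficient matrix of a finite-dimensional comodule: the map
`e j ↦ ∑ i, e i ⊗ u i j` is a (coassociative and counital) coaction of `H` on the vector space with
basis `e`. -/
structure IsCoefficientMatrix {H : Type*} [Ring H] [HopfAlgebra ℂ H] {ι : Type*} [Fintype ι]
    [DecidableEq ι] (u : Matrix ι ι H) : Prop where
  comul_apply (i j : ι) : Coalgebra.comul (R := ℂ) (u i j) = ∑ k, u i k ⊗ₜ[ℂ] u k j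
  counit_apply (i j : ι) : Coalgebra.counit (R := ℂ) (u i j) = (1 : Matrix ι ι ℂ) i j

/-- The set of all coefficients of unitary finite-dimensional comodules of a Hopf `*`-algebra: the
entries of the coefficient matrices (with respect to an orthonormal basis) that are unitary, i.e.
satisfy `u * u* = 1 = u* * u`, where `(u*) i j = (u j i)*`. -/
def unitaryCoefficients (H : Type*) [Ring H] [HopfAlgebra ℂ H] [StarRing H] : Set H :=
  {a | ∃ (n : ℕ) (u : Matrix (Fin n) (Fin n) H),
    IsCoefficientMatrix u ∧ u ∈ unitary (Matrix (Fin n) (Fin n) H) ∧ ∃ i j, u i j = a}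

end QuantumGroup

open QuantumGroup in
/-- A CQG algebra: a Hopf `*`-algebra that is the linear span of the coefficients of its unitary
finite-dimensional comodules. -/
structure CQG : Type (u + 1) where
  carrier : Type u
  [ring : Ring carrier]
  [hopfAlgebra : HopfAlgebra ℂ carrier]
  [starRing : StarRing carrier]
  [starModule : StarModule ℂ carrier]
  [isHopfStarAlgebra : IsHopfStarAlgebra carrier]
  span_unitaryCoefficients : Submodule.span ℂ (unitaryCoefficients carrier) = ⊤

namespace CQG

instance : CoeSort CQG.{u} (Type u) := ⟨CQG.carrier⟩

attribute [instance] CQG.ring CQG.hopfAlgebra CQG.starRing CQG.starModule CQG.isHopfStarAlgebra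

/-- Morphisms of Hopf `*`-algebras: unital algebra homomorphisms compatible with comultiplication,
counit and involution (such a map automatically commutes with the antipodes). -/
@[ext]
structure Hom (A B : CQG.{u}) : Type u where
  toBialgHom : A →ₐc[ℂ] B
  map_star (a : A) : toBialgHom (star a) = star (toBialgHom a)

/-- The category of CQG algebras. -/
instance : Category.{u} CQG.{u} where
  Hom := Hom
  id A := ⟨BialgHom.id ℂ A, fun _ => rfl⟩
  comp f g := ⟨g.toBialgHom.comp f.toBialgHom, fun a =>
    (congrArg g.toBialgHom (f.map_star a)).trans (g.map_star _)⟩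

end CQG

/-! ### The universal CQG algebras `A_u(Q)` -/

namespace QuantumGroup

open scoped TensorProduct ComplexOrder MatrixOrder
open Matrix

/-- Positive invertible operators on `ℂⁿ`. -/
def PosMatrix (n : ℕ) : Type := {Q : Matrix (Fin n) (Fin n) ℂ // Q.PosDef}

namespace PosMatrix

variable {n : ℕ} (Q : PosMatrix n)

/-- The positive square root `Q^{1/2}`. -/
noncomputable def root : Matrix (Fin n) (Fin n) ℂ := CFC.sqrt Q.1

theorem root_mul_root : Q.root * Q.root = Q.1 :=
  CFC.sqrt_mul_sqrt_self Q.1 Q.2.posSemidef.nonneg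

theorem root_conjTranspose : Q.rootᴴ = Q.root :=
  (CFC.sqrt_nonneg Q.1).posSemidef.1

theorem isUnit_det_root : IsUnit Q.root.det := by
  have h : IsUnit (Q.root * Q.root).det := by
    rw [root_mul_root]
    exact (Matrix.isUnit_iff_isUnit_det _).1 Q.2.isUnit
  rw [det_mul] at h
  exact isUnit_of_mul_isUnit_left h

theorem root_mul_inv : Q.root * Q.root⁻¹ = 1 := mul_nonsing_inv _ Q.isUnit_det_root

theorem inv_mul_root : Q.root⁻¹ * Q.root = 1 := nonsing_inv_mul _ Q.isUnit_det_root

theorem inv_conjTranspose : (Q.root⁻¹)ᴴ = Q.root⁻¹ := by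
  rw [conjTranspose_nonsing_inv, root_conjTranspose]

end PosMatrix

/-- A complex matrix, viewed as a matrix over a complex algebra. -/
def scalarMat (B : Type*) [Ring B] [Algebra ℂ B] {n : ℕ} (M : Matrix (Fin n) (Fin n) ℂ) :
    Matrix (Fin n) (Fin n) B := M.map (algebraMap ℂ B)

section scalarMat

variable (B : Type*) [Ring B] [Algebra ℂ B] {n : ℕ} (M N : Matrix (Fin n) (Fin n) ℂ)

@[simp] theorem scalarMat_apply (i j : Fin n) : scalarMat B M i j = algebraMap ℂ B (M i j) := rfl

theorem scalarMat_mul : scalarMat B (M * N) = scalarMat B M * scalarMat B N :=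
  Matrix.map_mul

@[simp] theorem scalarMat_one : scalarMat B (1 : Matrix (Fin n) (Fin n) ℂ) = 1 := by
  simp [scalarMat]

variable {B}

theorem scalarMat_map {C : Type*} [Ring C] [Algebra ℂ C] (f : B →ₐ[ℂ] C) :
    (scalarMat B M).map f = scalarMat C M := by
  ext i j; simp

theorem transpose_scalarMat_mul (X : Matrix (Fin n) (Fin n) B) :
    (scalarMat B M * X)ᵀ = Xᵀ * scalarMat B Mᵀ := by
  ext i j; simp [Matrix.mul_apply, Algebra.commutes]

theorem transpose_mul_scalarMat (X : Matrix (Fin n) (Fin n) B) :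
    (X * scalarMat B M)ᵀ = scalarMat B Mᵀ * Xᵀ := by
  ext i j; simp [Matrix.mul_apply, Algebra.commutes]

end scalarMat

section twist

variable {n : ℕ} (Q : PosMatrix n) {B : Type*} [Ring B] [Algebra ℂ B]
  (v w : Matrix (Fin n) (Fin n) B)

/-- The matrix `Q^{1/2} w Q^{-1/2}`. -/
noncomputable def twist : Matrix (Fin n) (Fin n) B :=
  scalarMat B Q.root * w * scalarMat B Q.root⁻¹

/-- The matrix `Q^{-1/2} vᵀ Q^{1/2}`.  As `Q^{1/2}` is self-adjoint, this is the adjoint of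
`Q^{1/2} v̄ Q^{-1/2}`, where `v̄ = ((v i j)*)`. -/
noncomputable def twistAdj : Matrix (Fin n) (Fin n) B :=
  scalarMat B Q.root⁻¹ * vᵀ * scalarMat B Q.root

variable {C : Type*} [Ring C] [Algebra ℂ C] (f : B →ₐ[ℂ] C)

theorem twist_map : (twist Q w).map f = twist Q (w.map f) := by
  simp [twist, Matrix.map_mul, scalarMat_map]

theorem twistAdj_map : (twistAdj Q v).map f = twistAdj Q (v.map f) := by
  simp [twistAdj, Matrix.map_mul, scalarMat_map, Matrix.transpose_map]

end twist

/-- The defining relations of `A_u(Q)`, for a matrix `v = (v i j)` and a matrix `w = (w i j)` that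
plays the role of `v̄ = ((v i j)*)`, so that `wᵀ` plays the role of the adjoint of `v`: both `v` and
`Q^{1/2} w Q^{-1/2}` are unitary. -/
structure AuRelations {n : ℕ} (Q : PosMatrix n) {B : Type*} [Ring B] [Algebra ℂ B]
    (v w : Matrix (Fin n) (Fin n) B) : Prop where
  mul_adjoint : v * wᵀ = 1
  adjoint_mul : wᵀ * v = 1
  twist_mul_adjoint : twist Q w * twistAdj Q v = 1
  adjoint_mul_twist : twistAdj Q v * twist Q w = 1

/-- The generators of `A_u(Q)` as a complex algebra: `u i j` and its adjoint `(u i j)*`. -/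
inductive AuGenerator (n : ℕ) : Type u
  | gen (i j : Fin n)
  | genStar (i j : Fin n)

/-- The generic matrix `u`. -/
noncomputable def freeMat (n : ℕ) : Matrix (Fin n) (Fin n) (FreeAlgebra ℂ (AuGenerator.{u} n)) :=
  fun i j => FreeAlgebra.ι ℂ (.gen i j)

/-- The generic matrix `ū`. -/
noncomputable def freeMatStar (n : ℕ) :
    Matrix (Fin n) (Fin n) (FreeAlgebra ℂ (AuGenerator.{u} n)) :=
  fun i j => FreeAlgebra.ι ℂ (.genStar i j)

/-- The relations `AuRelations Q u ū`, imposed entrywise on the free algebra. -/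
inductive AuRel {n : ℕ} (Q : PosMatrix n) :
    FreeAlgebra ℂ (AuGenerator.{u} n) → FreeAlgebra ℂ (AuGenerator.{u} n) → Prop
  | mul_adjoint (i j : Fin n) :
      AuRel Q ((freeMat n * (freeMatStar n)ᵀ) i j) (if i = j then 1 else 0)
  | adjoint_mul (i j : Fin n) :
      AuRel Q (((freeMatStar n)ᵀ * freeMat n) i j) (if i = j then 1 else 0)
  | twist_mul_adjoint (i j : Fin n) :
      AuRel Q ((twist Q (freeMatStar n) * twistAdj Q (freeMat n)) i j) (if i = j then 1 else 0)
  | adjoint_mul_twist (i j : Fin n) :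
      AuRel Q ((twistAdj Q (freeMat n) * twist Q (freeMatStar n)) i j) (if i = j then 1 else 0)

/-- The complex algebra `A_u(Q)`: the `*`-algebra generated by the entries of `u`, subject to the
relations making `u` and `Q^{1/2} ū Q^{-1/2}` unitary. -/
def AuAlgebra {n : ℕ} (Q : PosMatrix n) : Type u := RingQuot (AuRel.{u} Q)

namespace AuAlgebra

variable {n : ℕ} (Q : PosMatrix n)

noncomputable instance : Ring (AuAlgebra.{u} Q) := inferInstanceAs (Ring (RingQuot (AuRel.{u} Q)))

noncomputable instance : Algebra ℂ (AuAlgebra.{u} Q) :=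
  inferInstanceAs (Algebra ℂ (RingQuot (AuRel.{u} Q)))

/-- The quotient map. -/
noncomputable def mk : FreeAlgebra ℂ (AuGenerator.{u} n) →ₐ[ℂ] AuAlgebra.{u} Q :=
  RingQuot.mkAlgHom ℂ (AuRel.{u} Q)

/-- The matrix `u` of standard generators. -/
noncomputable def std : Matrix (Fin n) (Fin n) (AuAlgebra.{u} Q) := (freeMat n).map (mk Q)

/-- The matrix `ū` of adjoints of the standard generators. -/
noncomputable def stdStar : Matrix (Fin n) (Fin n) (AuAlgebra.{u} Q) := (freeMatStar n).map (mk Q)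

end AuAlgebra

section relations

variable {n : ℕ} {Q : PosMatrix n} {B : Type*} [Ring B] [Algebra ℂ B]

theorem AuRelations.map {C : Type*} [Ring C] [Algebra ℂ C] {v w : Matrix (Fin n) (Fin n) B}
    (h : AuRelations Q v w) (f : B →ₐ[ℂ] C) : AuRelations Q (v.map f) (w.map f) where
  mul_adjoint := by
    simpa [Matrix.map_mul, Matrix.transpose_map, twist_map, twistAdj_map] using
      congrArg (fun X => X.map f) h.mul_adjoint
  adjoint_mul := by
    simpa [Matrix.map_mul, Matrix.transpose_map, twist_map, twistAdj_map] using
      congrArg (fun X => X.map f) h.adjoint_mul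
  twist_mul_adjoint := by
    simpa [Matrix.map_mul, Matrix.transpose_map, twist_map, twistAdj_map] using
      congrArg (fun X => X.map f) h.twist_mul_adjoint
  adjoint_mul_twist := by
    simpa [Matrix.map_mul, Matrix.transpose_map, twist_map, twistAdj_map] using
      congrArg (fun X => X.map f) h.adjoint_mul_twist

theorem scalar_root_inv : scalarMat B Q.root * scalarMat B Q.root⁻¹ = 1 := by
  rw [← scalarMat_mul, Q.root_mul_inv, scalarMat_one]

theorem scalar_inv_root : scalarMat B Q.root⁻¹ * scalarMat B Q.root = 1 := by
  rw [← scalarMat_mul, Q.inv_mul_root, scalarMat_one]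

theorem AuRelations.rel₃ {v w : Matrix (Fin n) (Fin n) B} (h : AuRelations Q v w) :
    w * (scalarMat B Q.root⁻¹ * scalarMat B Q.root⁻¹) * vᵀ =
      scalarMat B Q.root⁻¹ * scalarMat B Q.root⁻¹ := by
  have h3 := h.twist_mul_adjoint
  rw [twist, twistAdj] at h3
  have e1 := scalar_root_inv (Q := Q) (B := B)
  have e2 := scalar_inv_root (Q := Q) (B := B)
  set s := scalarMat B Q.root
  set t := scalarMat B Q.root⁻¹
  calc w * (t * t) * vᵀ = (t * s) * (w * (t * t) * vᵀ) * (s * t) := by rw [e1, e2]; simp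
    _ = t * ((s * w * t) * (t * vᵀ * s)) * t := by simp only [mul_assoc]
    _ = t * t := by rw [h3]; simp

theorem AuRelations.rel₄ {v w : Matrix (Fin n) (Fin n) B} (h : AuRelations Q v w) :
    vᵀ * (scalarMat B Q.root * scalarMat B Q.root) * w =
      scalarMat B Q.root * scalarMat B Q.root := by
  have h3 := h.adjoint_mul_twist
  rw [twist, twistAdj] at h3
  have e1 := scalar_root_inv (Q := Q) (B := B)
  have e2 := scalar_inv_root (Q := Q) (B := B)
  set s := scalarMat B Q.root
  set t := scalarMat B Q.root⁻¹
  calc vᵀ * (s * s) * w = (s * t) * (vᵀ * (s * s) * w) * (t * s) := by rw [e1, e2]; simp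
    _ = s * ((t * vᵀ * s) * (s * w * t)) * s := by simp only [mul_assoc]
    _ = s * s := by rw [h3]; simp

theorem AuRelations.of_rel {v w : Matrix (Fin n) (Fin n) B} (h1 : v * wᵀ = 1) (h2 : wᵀ * v = 1)
    (h3 : w * (scalarMat B Q.root⁻¹ * scalarMat B Q.root⁻¹) * vᵀ =
      scalarMat B Q.root⁻¹ * scalarMat B Q.root⁻¹)
    (h4 : vᵀ * (scalarMat B Q.root * scalarMat B Q.root) * w =
      scalarMat B Q.root * scalarMat B Q.root) : AuRelations Q v w := by
  have e1 := scalar_root_inv (Q := Q) (B := B)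
  have e2 := scalar_inv_root (Q := Q) (B := B)
  refine ⟨h1, h2, ?_, ?_⟩ <;> rw [twist, twistAdj]
  · set s := scalarMat B Q.root
    set t := scalarMat B Q.root⁻¹
    calc (s * w * t) * (t * vᵀ * s) = s * (w * (t * t) * vᵀ) * s := by simp only [mul_assoc]
      _ = (s * t) * (t * s) := by rw [h3]; simp only [mul_assoc]
      _ = 1 := by rw [e1, e2, one_mul]
  · set s := scalarMat B Q.root
    set t := scalarMat B Q.root⁻¹
    calc (t * vᵀ * s) * (s * w * t) = t * (vᵀ * (s * s) * w) * t := by simp only [mul_assoc]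
      _ = (t * s) * (s * t) := by rw [h4]; simp only [mul_assoc]
      _ = 1 := by rw [e1, e2, one_mul]

end relations

namespace AuAlgebra

variable {n : ℕ} (Q : PosMatrix n)

theorem std_relations : AuRelations Q (std.{u} Q) (stdStar Q) := by
  have key {M : Matrix (Fin n) (Fin n) (FreeAlgebra ℂ (AuGenerator.{u} n))}
      (h : ∀ i j, AuRel Q (M i j) (if i = j then 1 else 0)) : M.map (mk Q) = 1 := by
    ext i j
    have := RingQuot.mkAlgHom_rel ℂ (h i j)
    change mk Q _ = mk Q _ at this
    rw [Matrix.map_apply, this, Matrix.one_apply]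
    split_ifs <;> simp
  constructor
  · simpa [Matrix.map_mul, Matrix.transpose_map, twist_map, twistAdj_map, std, stdStar] using
      key AuRel.mul_adjoint
  · simpa [Matrix.map_mul, Matrix.transpose_map, twist_map, twistAdj_map, std, stdStar] using
      key AuRel.adjoint_mul
  · simpa [Matrix.map_mul, Matrix.transpose_map, twist_map, twistAdj_map, std, stdStar] using
      key AuRel.twist_mul_adjoint
  · simpa [Matrix.map_mul, Matrix.transpose_map, twist_map, twistAdj_map, std, stdStar] using
      key AuRel.adjoint_mul_twist

section lift

variable {Q} {B : Type*} [Ring B] [Algebra ℂ B] {v w : Matrix (Fin n) (Fin n) B}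

/-- The map out of the free algebra given by the images of the generators. -/
noncomputable def freeLift (v w : Matrix (Fin n) (Fin n) B) :
    FreeAlgebra ℂ (AuGenerator.{u} n) →ₐ[ℂ] B :=
  FreeAlgebra.lift ℂ (fun x => match x with
    | .gen i j => v i j
    | .genStar i j => w i j)

theorem freeMat_map : (freeMat.{u} n).map (freeLift v w) = v := by
  ext i j; simp [freeMat, freeLift]

theorem freeMatStar_map : (freeMatStar.{u} n).map (freeLift v w) = w := by
  ext i j; simp [freeMatStar, freeLift]

theorem freeLift_eq {M : Matrix (Fin n) (Fin n) (FreeAlgebra ℂ (AuGenerator.{u} n))}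
    (h : M.map (freeLift v w) = 1) (i j : Fin n) :
    freeLift v w (M i j) = freeLift v w (if i = j then 1 else 0) := by
  rw [← Matrix.map_apply (f := freeLift v w), h, Matrix.one_apply]
  split_ifs <;> simp

/-- The algebra homomorphism out of `A_u(Q)` given by matrices satisfying the relations. -/
noncomputable def lift (h : AuRelations Q v w) : AuAlgebra.{u} Q →ₐ[ℂ] B :=
  RingQuot.liftAlgHom ℂ ⟨freeLift v w, by
    intro x y hxy
    cases hxy <;> apply freeLift_eq <;>
      simp [Matrix.map_mul, Matrix.transpose_map, twist_map, twistAdj_map, freeMat_map,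
        freeMatStar_map, h.mul_adjoint, h.adjoint_mul, h.twist_mul_adjoint, h.adjoint_mul_twist]⟩

theorem lift_mk (h : AuRelations Q v w) (x : FreeAlgebra ℂ (AuGenerator.{u} n)) :
    lift h (mk Q x) = freeLift v w x :=
  RingQuot.liftAlgHom_mkAlgHom_apply ℂ _ _ _

@[simp] theorem lift_std (h : AuRelations Q v w) (i j : Fin n) :
    lift h (std.{u} Q i j) = v i j := by
  simp [std, lift_mk, freeMat, freeLift]

@[simp] theorem lift_stdStar (h : AuRelations Q v w) (i j : Fin n) :
    lift h (stdStar.{u} Q i j) = w i j := by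
  simp [stdStar, lift_mk, freeMatStar, freeLift]

theorem algHom_ext {B : Type*} [Semiring B] [Algebra ℂ B] {f g : AuAlgebra.{u} Q →ₐ[ℂ] B}
    (h1 : ∀ i j, f (std Q i j) = g (std Q i j))
    (h2 : ∀ i j, f (stdStar Q i j) = g (stdStar Q i j)) : f = g := by
  refine RingQuot.ringQuot_ext' ℂ f g ?_
  ext x
  cases x with
  | gen i j => exact h1 i j
  | genStar i j => exact h2 i j

@[elab_as_elim]
theorem induction {p : AuAlgebra.{u} Q → Prop} (std : ∀ i j, p (std Q i j))
    (stdStar : ∀ i j, p (stdStar Q i j)) (alg : ∀ c, p (algebraMap ℂ _ c))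
    (add : ∀ a b, p a → p b → p (a + b)) (mul : ∀ a b, p a → p b → p (a * b)) (a) : p a := by
  obtain ⟨x, rfl⟩ := RingQuot.mkAlgHom_surjective ℂ (AuRel.{u} Q) a
  change p (mk Q x)
  induction x using FreeAlgebra.induction with
  | grade0 r => simpa using alg r
  | grade1 x =>
    cases x with
    | gen i j => exact std i j
    | genStar i j => exact stdStar i j
  | mul a b ha hb => rw [map_mul]; exact mul _ _ ha hb
  | add a b ha hb => rw [map_add]; exact add _ _ ha hb

end lift

/-! The involution of `A_u(Q)` -/

section op

open MulOpposite

variable (B : Type*) [Ring B] [Algebra ℂ B]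

/-- The opposite algebra with the complex conjugate scalar multiplication: algebra homomorphisms to
it are conjugate linear algebra anti-homomorphisms. -/
def ConjOp : Type _ := Bᵐᵒᵖ

instance : Ring (ConjOp B) := inferInstanceAs (Ring Bᵐᵒᵖ)

noncomputable instance : Algebra ℂ (ConjOp B) :=
  RingHom.toAlgebra' ((algebraMap ℂ Bᵐᵒᵖ).comp (starRingEnd ℂ))
    (fun c x => Algebra.commutes (A := Bᵐᵒᵖ) (starRingEnd ℂ c) x)

variable {B}

theorem algebraMap_conjOp (c : ℂ) :
    algebraMap ℂ (ConjOp B) c = op (algebraMap ℂ B (star c)) := rfl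

/-- The identity map to the conjugate opposite algebra, which reverses products. -/
def toConj (a : B) : ConjOp B := op a

/-- The inverse of `toConj`. -/
def ofConj (a : ConjOp B) : B := unop a

/-- Entrywise passage to the conjugate opposite algebra, combined with the transpose. -/
def conjMat (M : Matrix (Fin n) (Fin n) B) : Matrix (Fin n) (Fin n) (ConjOp B) := Mᵀ.map toConj

theorem conjMat_transpose {B : Type*} (M : Matrix (Fin n) (Fin n) B) : (conjMat M)ᵀ = conjMat Mᵀ := rfl

theorem conjMat_mul {B : Type*} [Ring B] (M N : Matrix (Fin n) (Fin n) B) : conjMat M * conjMat N = conjMat (N * M) := by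
  ext i j
  change ∑ k, toConj (M k i) * toConj (N j k) = toConj (∑ k, N j k * M k i)
  exact (Finset.op_sum _ _).symm

theorem conjMat_one {B : Type*} [Ring B] : conjMat (1 : Matrix (Fin n) (Fin n) B) = 1 := by
  ext i j
  rw [conjMat, Matrix.transpose_one, Matrix.map_apply, Matrix.one_apply, Matrix.one_apply]
  split_ifs <;> rfl

theorem conjMat_scalar (M : Matrix (Fin n) (Fin n) ℂ) :
    scalarMat (ConjOp B) M = conjMat (scalarMat B Mᴴ) := by
  ext i j
  rw [scalarMat_apply, algebraMap_conjOp]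
  rfl

theorem conjOp_relations {Q : PosMatrix n} {v w : Matrix (Fin n) (Fin n) B}
    (h : AuRelations Q v w) : AuRelations Q (conjMat wᵀ) (conjMat vᵀ) where
  mul_adjoint := by
    rw [conjMat_transpose, conjMat_mul, transpose_transpose, h.mul_adjoint, conjMat_one]
  adjoint_mul := by
    rw [conjMat_transpose, conjMat_mul, transpose_transpose, h.adjoint_mul, conjMat_one]
  twist_mul_adjoint := by
    rw [← conjMat_one, ← h.twist_mul_adjoint]
    simp only [twist, twistAdj, conjMat_scalar, Q.root_conjTranspose, Q.inv_conjTranspose,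
      conjMat_transpose, conjMat_mul, transpose_transpose, mul_assoc]
  adjoint_mul_twist := by
    rw [← conjMat_one, ← h.adjoint_mul_twist]
    simp only [twist, twistAdj, conjMat_scalar, Q.root_conjTranspose, Q.inv_conjTranspose,
      conjMat_transpose, conjMat_mul, transpose_transpose, mul_assoc]

end op

/-- The involution, as an algebra homomorphism to the conjugate opposite algebra. -/
noncomputable def starHom : AuAlgebra.{u} Q →ₐ[ℂ] ConjOp (AuAlgebra.{u} Q) :=
  lift (conjOp_relations (std_relations Q))

/-- The involution of `A_u(Q)` exchanges `u i j` and `(u i j)*`. -/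
noncomputable instance : Star (AuAlgebra.{u} Q) := ⟨fun a => ofConj (starHom Q a)⟩

theorem star_def (a : AuAlgebra.{u} Q) : star a = ofConj (starHom Q a) := rfl

@[simp] theorem star_std (i j : Fin n) : star (std.{u} Q i j) = stdStar Q i j := by
  rw [star_def, starHom, lift_std]; rfl

@[simp] theorem star_stdStar (i j : Fin n) : star (stdStar.{u} Q i j) = std Q i j := by
  rw [star_def, starHom, lift_stdStar]; rfl

theorem star_algebraMap' (c : ℂ) :
    star (algebraMap ℂ (AuAlgebra.{u} Q) c) = algebraMap ℂ _ (star c) := by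
  rw [star_def, AlgHom.commutes]; rfl

theorem star_mul' (a b : AuAlgebra.{u} Q) : star (a * b) = star b * star a := by
  rw [star_def, map_mul]; rfl

theorem star_add' (a b : AuAlgebra.{u} Q) : star (a + b) = star a + star b := by
  rw [star_def, map_add]; rfl

noncomputable instance : StarRing (AuAlgebra.{u} Q) where
  star_involutive a := by
    induction a using AuAlgebra.induction with
    | std i j => simp
    | stdStar i j => simp
    | alg c => simp [star_algebraMap']
    | add a b ha hb => rw [star_add', star_add', ha, hb]
    | mul a b ha hb => rw [star_mul', star_mul', ha, hb]
  star_mul := star_mul' Q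
  star_add := star_add' Q

instance : StarModule ℂ (AuAlgebra.{u} Q) where
  star_smul c a := by
    rw [Algebra.smul_def, star_mul', star_algebraMap', Algebra.smul_def, Algebra.commutes]

/-! The bialgebra structure of `A_u(Q)` -/

section comul

variable {Q} {B : Type*} [Ring B] [Algebra ℂ B]

theorem mul_relations {v w v' w' : Matrix (Fin n) (Fin n) B} (h : AuRelations Q v w)
    (h' : AuRelations Q v' w') (hv : ∀ i j k l, Commute (v i j) (v' k l))
    (hw : ∀ i j k l, Commute (w i j) (w' k l)) : AuRelations Q (v * v') (w * w') := by
  have tv : (v * v')ᵀ = v'ᵀ * vᵀ := by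
    ext i j
    simp only [Matrix.transpose_apply, Matrix.mul_apply, (hv _ _ _ _).eq]
  have tw : (w * w')ᵀ = w'ᵀ * wᵀ := by
    ext i j
    simp only [Matrix.transpose_apply, Matrix.mul_apply, (hw _ _ _ _).eq]
  apply AuRelations.of_rel
  · rw [tw, mul_assoc, ← mul_assoc v', h'.mul_adjoint, one_mul, h.mul_adjoint]
  · rw [tw, mul_assoc, ← mul_assoc wᵀ, h.adjoint_mul, one_mul, h'.adjoint_mul]
  · rw [tv]
    calc _ = w * (w' * (scalarMat B Q.root⁻¹ * scalarMat B Q.root⁻¹) * v'ᵀ) * vᵀ := by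
          simp only [mul_assoc]
      _ = _ := by rw [h'.rel₃, h.rel₃]
  · rw [tv]
    calc _ = v'ᵀ * (vᵀ * (scalarMat B Q.root * scalarMat B Q.root) * w) * w' := by
          simp only [mul_assoc]
      _ = _ := by rw [h.rel₄, h'.rel₄]

end comul

theorem one_relations : AuRelations Q (1 : Matrix (Fin n) (Fin n) ℂ) 1 := by
  apply AuRelations.of_rel <;> simp

/-- The comultiplication `u i j ↦ ∑ k, u i k ⊗ u k j`. -/
noncomputable def comulHom : AuAlgebra.{u} Q →ₐ[ℂ] AuAlgebra.{u} Q ⊗[ℂ] AuAlgebra.{u} Q :=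
  lift (mul_relations ((std_relations Q).map Algebra.TensorProduct.includeLeft)
    ((std_relations Q).map Algebra.TensorProduct.includeRight)
    (fun i j k l => by simp [Commute, SemiconjBy])
    (fun i j k l => by simp [Commute, SemiconjBy]))

/-- The counit `u i j ↦ δ i j`. -/
noncomputable def counitHom : AuAlgebra.{u} Q →ₐ[ℂ] ℂ := lift (one_relations Q)

theorem comulHom_std (i j : Fin n) :
    comulHom Q (std.{u} Q i j) = ∑ k, std Q i k ⊗ₜ[ℂ] std Q k j := by
  simp [comulHom, Matrix.mul_apply]

theorem comulHom_stdStar (i j : Fin n) :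
    comulHom Q (stdStar.{u} Q i j) = ∑ k, stdStar Q i k ⊗ₜ[ℂ] stdStar Q k j := by
  simp [comulHom, Matrix.mul_apply]

theorem counitHom_std (i j : Fin n) :
    counitHom Q (std.{u} Q i j) = (1 : Matrix (Fin n) (Fin n) ℂ) i j := by
  simp [counitHom]

theorem counitHom_stdStar (i j : Fin n) :
    counitHom Q (stdStar.{u} Q i j) = (1 : Matrix (Fin n) (Fin n) ℂ) i j := by
  simp [counitHom]

noncomputable instance : Bialgebra ℂ (AuAlgebra.{u} Q) :=
  Bialgebra.ofAlgHom (comulHom Q) (counitHom Q)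
    (by
      apply algHom_ext <;> intro i j
      · simp only [AlgHom.comp_apply, comulHom_std, map_sum, Algebra.TensorProduct.map_tmul,
          TensorProduct.sum_tmul, TensorProduct.tmul_sum, AlgHom.coe_id, id]
        rw [Finset.sum_comm]
        rfl
      · simp only [AlgHom.comp_apply, comulHom_stdStar, map_sum, Algebra.TensorProduct.map_tmul,
          TensorProduct.sum_tmul, TensorProduct.tmul_sum, AlgHom.coe_id, id]
        rw [Finset.sum_comm]
        rfl)
    (by
      apply algHom_ext <;> intro i j
      · simp [comulHom_std, counitHom_std, Matrix.one_apply, TensorProduct.ite_tmul]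
      · simp [comulHom_stdStar, counitHom_stdStar, Matrix.one_apply, TensorProduct.ite_tmul])
    (by
      apply algHom_ext <;> intro i j
      · simp [comulHom_std, counitHom_std, Matrix.one_apply, TensorProduct.tmul_ite]
      · simp [comulHom_stdStar, counitHom_stdStar, Matrix.one_apply, TensorProduct.tmul_ite])

theorem comul_std (i j : Fin n) :
    Coalgebra.comul (R := ℂ) (std.{u} Q i j) = ∑ k, std Q i k ⊗ₜ[ℂ] std Q k j :=
  comulHom_std Q i j

theorem comul_stdStar (i j : Fin n) :
    Coalgebra.comul (R := ℂ) (stdStar.{u} Q i j) = ∑ k, stdStar Q i k ⊗ₜ[ℂ] stdStar Q k j :=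
  comulHom_stdStar Q i j

theorem counit_std (i j : Fin n) :
    Coalgebra.counit (R := ℂ) (std.{u} Q i j) = (1 : Matrix (Fin n) (Fin n) ℂ) i j :=
  counitHom_std Q i j

theorem counit_stdStar (i j : Fin n) :
    Coalgebra.counit (R := ℂ) (stdStar.{u} Q i j) = (1 : Matrix (Fin n) (Fin n) ℂ) i j :=
  counitHom_stdStar Q i j

/-! The antipode of `A_u(Q)` -/

section antipode

open MulOpposite

/-- Entrywise passage to the opposite algebra, combined with the transpose. -/
def opMat {B : Type*} (M : Matrix (Fin n) (Fin n) B) : Matrix (Fin n) (Fin n) Bᵐᵒᵖ := Mᵀ.map op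

theorem opMat_transpose {B : Type*} (M : Matrix (Fin n) (Fin n) B) : (opMat M)ᵀ = opMat Mᵀ := rfl

theorem opMat_mul {B : Type*} [Ring B] (M N : Matrix (Fin n) (Fin n) B) :
    opMat M * opMat N = opMat (N * M) := by
  ext i j
  simp [opMat, Matrix.mul_apply]

theorem opMat_one {B : Type*} [Ring B] : opMat (1 : Matrix (Fin n) (Fin n) B) = 1 := by
  simp [opMat]

theorem opMat_scalar {B : Type*} [Ring B] [Algebra ℂ B] (M : Matrix (Fin n) (Fin n) ℂ) :
    scalarMat Bᵐᵒᵖ M = opMat (scalarMat B Mᵀ) := by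
  ext i j; simp [opMat, MulOpposite.algebraMap_apply]

/-- The matrix `Q⁻¹ uᵀ Q`, whose entries are the images of the `(u i j)*` under the antipode. -/
noncomputable def antiStar : Matrix (Fin n) (Fin n) (AuAlgebra.{u} Q) :=
  scalarMat _ (Q.root⁻¹ * Q.root⁻¹) * (std Q)ᵀ * scalarMat _ (Q.root * Q.root)

theorem scalar_inv_mul (B : Type*) [Ring B] [Algebra ℂ B] :
    scalarMat B (Q.root⁻¹ * Q.root⁻¹) * scalarMat B (Q.root * Q.root) = 1 := by
  rw [← scalarMat_mul, mul_assoc, ← mul_assoc _ Q.root, Q.inv_mul_root, one_mul, Q.inv_mul_root,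
    scalarMat_one]

theorem scalar_inv_mul_transpose (B : Type*) [Ring B] [Algebra ℂ B] :
    scalarMat B (Q.root⁻¹ * Q.root⁻¹)ᵀ * scalarMat B (Q.root * Q.root)ᵀ = 1 := by
  rw [← scalarMat_mul, ← transpose_mul, mul_assoc, ← mul_assoc _ Q.root⁻¹, Q.root_mul_inv, one_mul,
    Q.root_mul_inv, transpose_one, scalarMat_one]

theorem antiStar_mul : antiStar.{u} Q * stdStar Q = 1 := by
  have h := (std_relations.{u} Q).rel₄
  rw [← scalarMat_mul] at h
  rw [antiStar, mul_assoc, mul_assoc, ← mul_assoc (std Q)ᵀ, h, scalar_inv_mul]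

theorem stdStar_mul_antiStar : stdStar.{u} Q * antiStar Q = 1 := by
  have h := (std_relations.{u} Q).rel₃
  rw [← scalarMat_mul] at h
  rw [antiStar, ← mul_assoc, ← mul_assoc, h, scalar_inv_mul]

theorem antiStar_transpose : (antiStar.{u} Q)ᵀ =
    scalarMat _ (Q.root * Q.root)ᵀ * std Q * scalarMat _ (Q.root⁻¹ * Q.root⁻¹)ᵀ := by
  rw [antiStar, transpose_mul_scalarMat, transpose_scalarMat_mul, transpose_transpose, mul_assoc]

theorem antipode_relations :
    AuRelations Q (opMat (stdStar.{u} Q)) (opMat (antiStar.{u} Q)ᵀ) := by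
  apply AuRelations.of_rel
  · rw [opMat_transpose, transpose_transpose, opMat_mul, antiStar_mul, opMat_one]
  · rw [opMat_transpose, transpose_transpose, opMat_mul, stdStar_mul_antiStar, opMat_one]
  · rw [← scalarMat_mul, opMat_scalar, opMat_transpose, opMat_mul, opMat_mul, antiStar_transpose]
    congr 1
    rw [mul_assoc (scalarMat _ _) (std Q), ← mul_assoc (scalarMat _ (Q.root⁻¹ * Q.root⁻¹)ᵀ),
      scalar_inv_mul_transpose, one_mul, ← mul_assoc, (std_relations Q).adjoint_mul, one_mul]
  · rw [← scalarMat_mul, opMat_scalar, opMat_transpose, opMat_mul, opMat_mul, antiStar_transpose]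
    congr 1
    rw [mul_assoc, ← mul_assoc (scalarMat _ (Q.root⁻¹ * Q.root⁻¹)ᵀ), scalar_inv_mul_transpose,
      one_mul, mul_assoc, (std_relations Q).mul_adjoint, mul_one]

/-- The antipode, as an algebra homomorphism to the opposite algebra. -/
noncomputable def antipodeHom : AuAlgebra.{u} Q →ₐ[ℂ] (AuAlgebra.{u} Q)ᵐᵒᵖ :=
  lift (antipode_relations Q)

/-- The antipode `u i j ↦ (u j i)*`. -/
noncomputable def antipodeLin : AuAlgebra.{u} Q →ₗ[ℂ] AuAlgebra.{u} Q :=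
  (opLinearEquiv ℂ).symm.toLinearMap ∘ₗ (antipodeHom Q).toLinearMap

theorem antipodeLin_std (i j : Fin n) : antipodeLin Q (std.{u} Q i j) = stdStar Q j i := by
  simp [antipodeLin, antipodeHom, opMat]

theorem antipodeLin_stdStar (i j : Fin n) :
    antipodeLin Q (stdStar.{u} Q i j) = antiStar Q i j := by
  simp [antipodeLin, antipodeHom, opMat]

theorem antipodeLin_mul (a b : AuAlgebra.{u} Q) :
    antipodeLin Q (a * b) = antipodeLin Q b * antipodeLin Q a := by
  simp [antipodeLin]

theorem antipodeLin_algebraMap (c : ℂ) :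
    antipodeLin Q (algebraMap ℂ (AuAlgebra.{u} Q) c) = algebraMap ℂ _ c := by
  simp [antipodeLin, MulOpposite.algebraMap_apply]

theorem antipodeLin_one : antipodeLin Q (1 : AuAlgebra.{u} Q) = 1 := by
  simpa using antipodeLin_algebraMap Q 1

end antipode

open Coalgebra in
theorem antipode_left_mul {H : Type*} [Ring H] [Bialgebra ℂ H] (S : H →ₗ[ℂ] H)
    (hS : ∀ a b, S (a * b) = S b * S a) {a b : H}
    (ha : LinearMap.mul' ℂ H (S.rTensor H (comul a)) = algebraMap ℂ H (counit a))
    (hb : LinearMap.mul' ℂ H (S.rTensor H (comul b)) = algebraMap ℂ H (counit b)) :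
    LinearMap.mul' ℂ H (S.rTensor H (comul (a * b))) = algebraMap ℂ H (counit (a * b)) := by
  have key (x y : H ⊗[ℂ] H) (c : ℂ) (hx : LinearMap.mul' ℂ H (S.rTensor H x) = algebraMap ℂ H c) :
      LinearMap.mul' ℂ H (S.rTensor H (x * y)) = c • LinearMap.mul' ℂ H (S.rTensor H y) := by
    induction y with
    | zero => simp
    | add y z hy hz => rw [mul_add, map_add, map_add, hy, hz, map_add, map_add, smul_add]
    | tmul p q =>
      have h2 : LinearMap.mul' ℂ H (S.rTensor H (x * p ⊗ₜ[ℂ] q)) =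
          S p * LinearMap.mul' ℂ H (S.rTensor H x) * q := by
        clear hx
        induction x with
        | zero => simp
        | add x z hy hz => simp only [add_mul, map_add, hy, hz, mul_add]
        | tmul r t => simp [hS, mul_assoc]
      rw [h2, hx, ← Algebra.commutes, mul_assoc, ← Algebra.smul_def]
      simp
  rw [Bialgebra.comul_mul, key _ _ _ ha, hb, Bialgebra.counit_mul, map_mul, Algebra.smul_def]

open Coalgebra in
theorem antipode_right_mul {H : Type*} [Ring H] [Bialgebra ℂ H] (S : H →ₗ[ℂ] H)
    (hS : ∀ a b, S (a * b) = S b * S a) {a b : H}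
    (ha : LinearMap.mul' ℂ H (S.lTensor H (comul a)) = algebraMap ℂ H (counit a))
    (hb : LinearMap.mul' ℂ H (S.lTensor H (comul b)) = algebraMap ℂ H (counit b)) :
    LinearMap.mul' ℂ H (S.lTensor H (comul (a * b))) = algebraMap ℂ H (counit (a * b)) := by
  have key (x y : H ⊗[ℂ] H) (c : ℂ) (hy : LinearMap.mul' ℂ H (S.lTensor H y) = algebraMap ℂ H c) :
      LinearMap.mul' ℂ H (S.lTensor H (x * y)) = c • LinearMap.mul' ℂ H (S.lTensor H x) := by
    induction x with
    | zero => simp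
    | add x z hx hz => rw [add_mul, map_add, map_add, hx, hz, map_add, map_add, smul_add]
    | tmul p q =>
      have h2 : LinearMap.mul' ℂ H (S.lTensor H (p ⊗ₜ[ℂ] q * y)) =
          p * LinearMap.mul' ℂ H (S.lTensor H y) * S q := by
        clear hy
        induction y with
        | zero => simp
        | add x z hy hz => simp only [add_mul, map_add, hy, hz, mul_add]
        | tmul r t => simp [hS, mul_assoc]
      rw [h2, hy, ← Algebra.commutes, mul_assoc, ← Algebra.smul_def]
      simp
  rw [Bialgebra.comul_mul, key _ _ _ hb, ha, Bialgebra.counit_mul, map_mul, Algebra.smul_def,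
    Algebra.commutes]

noncomputable instance : HopfAlgebra ℂ (AuAlgebra.{u} Q) where
  antipode := antipodeLin Q
  mul_antipode_rTensor_comul := by
    ext a
    change LinearMap.mul' ℂ _ ((antipodeLin Q).rTensor _ (Coalgebra.comul a)) =
      algebraMap ℂ _ (Coalgebra.counit a)
    induction a using AuAlgebra.induction with
    | std i j =>
      have h := congrFun (congrFun (std_relations Q).adjoint_mul i) j
      simpa [comul_std, counit_std, antipodeLin_std, Matrix.mul_apply, Matrix.one_apply,
        apply_ite (algebraMap ℂ (AuAlgebra.{u} Q))] using h
    | stdStar i j =>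
      have h := congrFun (congrFun (antiStar_mul Q) i) j
      simpa [comul_stdStar, counit_stdStar, antipodeLin_stdStar, Matrix.mul_apply, Matrix.one_apply,
        apply_ite (algebraMap ℂ (AuAlgebra.{u} Q))] using h
    | alg c => simp [antipodeLin_algebraMap, Algebra.TensorProduct.algebraMap_apply]
    | add a b ha hb => simp only [map_add, ha, hb]
    | mul a b ha hb => exact antipode_left_mul _ (antipodeLin_mul Q) ha hb
  mul_antipode_lTensor_comul := by
    ext a
    change LinearMap.mul' ℂ _ ((antipodeLin Q).lTensor _ (Coalgebra.comul a)) =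
      algebraMap ℂ _ (Coalgebra.counit a)
    induction a using AuAlgebra.induction with
    | std i j =>
      have h := congrFun (congrFun (std_relations Q).mul_adjoint i) j
      simpa [comul_std, counit_std, antipodeLin_std, Matrix.mul_apply, Matrix.one_apply,
        apply_ite (algebraMap ℂ (AuAlgebra.{u} Q))] using h
    | stdStar i j =>
      have h := congrFun (congrFun (stdStar_mul_antiStar Q) i) j
      simpa [comul_stdStar, counit_stdStar, antipodeLin_stdStar, Matrix.mul_apply, Matrix.one_apply,
        apply_ite (algebraMap ℂ (AuAlgebra.{u} Q))] using h
    | alg c => simp [antipodeLin_one, Algebra.TensorProduct.algebraMap_apply]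
    | add a b ha hb => simp only [map_add, ha, hb]
    | mul a b ha hb => exact antipode_right_mul _ (antipodeLin_mul Q) ha hb

instance : IsHopfStarAlgebra (AuAlgebra.{u} Q) where
  comul_star a := by
    induction a using AuAlgebra.induction with
    | std i j => simp [comul_std, comul_stdStar, star_sum]
    | stdStar i j => simp [comul_std, comul_stdStar, star_sum]
    | alg c => simp [star_algebraMap', Algebra.TensorProduct.algebraMap_apply]
    | add a b ha hb => simp only [map_add, star_add, ha, hb]
    | mul a b ha hb => simp only [star_mul, Bialgebra.comul_mul, ha, hb]
  counit_star a := by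
    induction a using AuAlgebra.induction with
    | std i j => simp [counit_std, counit_stdStar, Matrix.one_apply]
    | stdStar i j => simp [counit_std, counit_stdStar, Matrix.one_apply]
    | alg c => simp [star_algebraMap']
    | add a b ha hb => simp only [map_add, star_add, ha, hb]
    | mul a b ha hb => simp only [star_mul, Bialgebra.counit_mul, ha, hb]

end AuAlgebra

/-! `A_u(Q)` is a CQG algebra -/

section coefficients

variable {H : Type*} [Ring H] [HopfAlgebra ℂ H] [StarRing H]

theorem mem_unitaryCoefficients {ι : Type*} [Fintype ι] [DecidableEq ι] {x : Matrix ι ι H}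
    (hx : IsCoefficientMatrix x) (hx' : x ∈ unitary (Matrix ι ι H)) (i j : ι) :
    x i j ∈ unitaryCoefficients H := by
  let e := (Fintype.equivFin ι).symm
  refine ⟨Fintype.card ι, x.submatrix e e, ⟨fun i j => ?_, fun i j => ?_⟩, ?_,
    e.symm i, e.symm j, by simp⟩
  · rw [submatrix_apply, hx.comul_apply, ← e.sum_comp]
    rfl
  · rw [submatrix_apply, hx.counit_apply]
    simp [Matrix.one_apply]
  · rw [Unitary.mem_iff] at hx' ⊢
    simp only [star_eq_conjTranspose, conjTranspose_submatrix, submatrix_mul_equiv] at hx' ⊢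
    simp [hx'.1, hx'.2]

theorem mul_mem_unitaryCoefficients {a b : H} (ha : a ∈ unitaryCoefficients H)
    (hb : b ∈ unitaryCoefficients H) : a * b ∈ unitaryCoefficients H := by
  obtain ⟨m, x, hx, hx', i, j, rfl⟩ := ha
  obtain ⟨n, y, hy, hy', k, l, rfl⟩ := hb
  obtain ⟨z, hz⟩ : ∃ z : Matrix (Fin m × Fin n) (Fin m × Fin n) H,
      ∀ p q, z p q = x p.1 q.1 * y p.2 q.2 := ⟨fun p q => x p.1 q.1 * y p.2 q.2, fun _ _ => rfl⟩
  rw [← hz (i, k) (j, l)]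
  refine mem_unitaryCoefficients (x := z) ⟨fun p q => ?_, fun p q => ?_⟩ ?_ (i, k) (j, l)
  · simp only [hz, Bialgebra.comul_mul, hx.comul_apply, hy.comul_apply, Finset.sum_mul_sum,
      Algebra.TensorProduct.tmul_mul_tmul, Fintype.sum_prod_type]
  · simp [hz, Bialgebra.counit_mul, hx.counit_apply, hy.counit_apply, Matrix.one_apply, Prod.ext_iff,
      ← ite_and, and_comm]
  · rw [Unitary.mem_iff] at hx' hy' ⊢
    have x1 (i j) := congrFun (congrFun hx'.1 i) j
    have x2 (i j) := congrFun (congrFun hx'.2 i) j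
    have y1 (i j) := congrFun (congrFun hy'.1 i) j
    have y2 (i j) := congrFun (congrFun hy'.2 i) j
    simp only [Matrix.mul_apply, star_apply] at x1 x2 y1 y2
    constructor
    · ext p q
      simp only [Matrix.mul_apply, star_apply, hz, Fintype.sum_prod_type, star_mul]
      rw [Finset.sum_comm]
      have h (b : Fin n) : ∑ a, star (y b p.2) * star (x a p.1) * (x a q.1 * y b q.2) =
          star (y b p.2) * (1 : Matrix (Fin m) (Fin m) H) p.1 q.1 * y b q.2 := by
        rw [← x1, Finset.mul_sum, Finset.sum_mul]
        simp only [mul_assoc]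
      simp only [h]
      by_cases h1 : p.1 = q.1
      · simp [h1, y1, Matrix.one_apply, Prod.ext_iff]
      · simp [h1, Prod.ext_iff]
    · ext p q
      simp only [Matrix.mul_apply, star_apply, hz, Fintype.sum_prod_type, star_mul]
      have h (a : Fin m) : ∑ b, x p.1 a * y p.2 b * (star (y q.2 b) * star (x q.1 a)) =
          x p.1 a * (1 : Matrix (Fin n) (Fin n) H) p.2 q.2 * star (x q.1 a) := by
        rw [← y2, Finset.mul_sum, Finset.sum_mul]
        simp only [mul_assoc]
      simp only [h]
      by_cases h1 : p.2 = q.2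
      · simp [h1, x2, Matrix.one_apply, Prod.ext_iff]
      · simp [h1, Prod.ext_iff]

theorem one_mem_unitaryCoefficients : (1 : H) ∈ unitaryCoefficients H := by
  refine mem_unitaryCoefficients (x := (1 : Matrix (Fin 1) (Fin 1) H)) ⟨fun i j => ?_, fun i j => ?_⟩
    (one_mem _) 0 0
  · obtain rfl := Subsingleton.elim i j
    simp [Matrix.one_apply, Subsingleton.elim i 0, Algebra.TensorProduct.one_def]
  · simp [Matrix.one_apply, Subsingleton.elim i j]

end coefficients

/-- A scalar conjugate of a coefficient matrix is a coefficient matrix. -/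
theorem IsCoefficientMatrix.conj {H : Type*} [Ring H] [HopfAlgebra ℂ H] {n : ℕ} {x : Matrix (Fin n) (Fin n) H}
    (hx : IsCoefficientMatrix x) {M N : Matrix (Fin n) (Fin n) ℂ} (h : M * N = 1) :
    IsCoefficientMatrix (scalarMat H M * x * scalarMat H N) := by
  have h' : N * M = 1 := mul_eq_one_comm.1 h
  have h1 : x.map (Bialgebra.comulAlgHom ℂ H) = x.map (Algebra.TensorProduct.includeLeft (S := ℂ)) *
      x.map (Algebra.TensorProduct.includeRight (R := ℂ)) := by
    ext i j
    simp [hx.comul_apply, Matrix.mul_apply]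
  have h2 : x.map (Bialgebra.counitAlgHom ℂ H) = 1 := by
    ext i j
    simp [hx.counit_apply]
  obtain ⟨y, hy⟩ : ∃ y, y = scalarMat H M * x * scalarMat H N := ⟨_, rfl⟩
  rw [← hy]
  refine ⟨fun i j => ?_, fun i j => ?_⟩
  · have e : y.map (Bialgebra.comulAlgHom ℂ H) = y.map (Algebra.TensorProduct.includeLeft (S := ℂ)) *
        y.map (Algebra.TensorProduct.includeRight (R := ℂ)) := by
      simp only [hy, Matrix.map_mul, scalarMat_map, h1]
      rw [mul_assoc (scalarMat _ M * _), ← mul_assoc (scalarMat _ N), ← mul_assoc (scalarMat _ N),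
        ← scalarMat_mul, h', scalarMat_one, one_mul]
      simp only [mul_assoc]
    have := congrFun (congrFun e i) j
    simpa [Matrix.mul_apply] using this
  · have e : y.map (Bialgebra.counitAlgHom ℂ H) = 1 := by
      simp only [hy, Matrix.map_mul, scalarMat_map, h2, mul_one]
      rw [← scalarMat_mul, h, scalarMat_one]
    exact congrFun (congrFun e i) j

namespace AuAlgebra

variable {n : ℕ} (Q : PosMatrix n)

theorem std_isCoefficientMatrix : IsCoefficientMatrix (std.{u} Q) :=
  ⟨comul_std Q, counit_std Q⟩

theorem stdStar_isCoefficientMatrix : IsCoefficientMatrix (stdStar.{u} Q) :=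
  ⟨comul_stdStar Q, counit_stdStar Q⟩

theorem star_std_matrix : star (std.{u} Q) = (stdStar Q)ᵀ := by
  ext i j; simp

theorem star_twist : star (twist Q (stdStar.{u} Q)) = twistAdj Q (std Q) := by
  have hs (M : Matrix (Fin n) (Fin n) ℂ) :
      star (scalarMat (AuAlgebra.{u} Q) M) = scalarMat _ Mᴴ := by
    ext i j; simp [star_algebraMap']
  have hu : star (stdStar.{u} Q) = (std Q)ᵀ := by
    ext i j; simp
  simp only [twist, twistAdj, star_mul, hs, hu, Q.root_conjTranspose, Q.inv_conjTranspose, mul_assoc]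

/-- The standard matrix `u` is unitary. -/
theorem std_mem_unitary : std.{u} Q ∈ unitary (Matrix (Fin n) (Fin n) (AuAlgebra.{u} Q)) := by
  rw [Unitary.mem_iff, star_std_matrix]
  exact ⟨(std_relations Q).adjoint_mul, (std_relations Q).mul_adjoint⟩

/-- The matrix `Q^{1/2} ū Q^{-1/2}` is unitary. -/
theorem twist_mem_unitary :
    twist Q (stdStar.{u} Q) ∈ unitary (Matrix (Fin n) (Fin n) (AuAlgebra.{u} Q)) := by
  rw [Unitary.mem_iff, star_twist]
  exact ⟨(std_relations Q).adjoint_mul_twist, (std_relations Q).twist_mul_adjoint⟩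

theorem span_unitaryCoefficients :
    Submodule.span ℂ (unitaryCoefficients (AuAlgebra.{u} Q)) = ⊤ := by
  rw [eq_top_iff]
  rintro a -
  induction a using AuAlgebra.induction with
  | std i j =>
    exact Submodule.subset_span
      (mem_unitaryCoefficients (std_isCoefficientMatrix Q) (std_mem_unitary Q) i j)
  | stdStar i j =>
    have h : stdStar.{u} Q = scalarMat _ Q.root⁻¹ * twist Q (stdStar Q) * scalarMat _ Q.root := by
      simp only [twist]
      rw [mul_assoc, mul_assoc, scalar_inv_root, mul_one, ← mul_assoc, scalar_inv_root, one_mul]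
    rw [h]
    simp only [Matrix.mul_apply (M := _ * _), Matrix.mul_apply (M := scalarMat _ Q.root⁻¹),
      scalarMat_apply, ← Algebra.commutes, ← Algebra.smul_def]
    refine Submodule.sum_mem _ fun p _ => Submodule.smul_mem _ _ (Submodule.sum_mem _ fun q _ =>
      Submodule.smul_mem _ _ (Submodule.subset_span ?_))
    exact mem_unitaryCoefficients ((stdStar_isCoefficientMatrix Q).conj Q.root_mul_inv)
      (twist_mem_unitary Q) q p
  | alg c =>
    rw [Algebra.algebraMap_eq_smul_one]
    exact Submodule.smul_mem _ _ (Submodule.subset_span one_mem_unitaryCoefficients)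
  | add a b ha hb => exact Submodule.add_mem _ ha hb
  | mul a b ha hb =>
    have h := Submodule.mul_mem_mul ha hb
    rw [Submodule.span_mul_span] at h
    refine Submodule.span_mono ?_ h
    rintro _ ⟨x, hx, y, hy, rfl⟩
    exact mul_mem_unitaryCoefficients hx hy

end AuAlgebra

/-- The universal CQG algebra `A_u(Q)`. -/
noncomputable def Au {n : ℕ} (Q : PosMatrix n) : CQG.{u} where
  carrier := AuAlgebra.{u} Q
  span_unitaryCoefficients := AuAlgebra.span_unitaryCoefficients Q

end QuantumGroup

/-! ### Regular generators -/

/-- A class `P` of objects of a category is a generator if any two distinct parallel arrows stay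
distinct upon composition with some arrow from an object in `P`.  It is a regular generator if
moreover every object is the coequalizer of two parallel arrows `f, g : Y ⟶ Z` such that `Y` and `Z`
are (small) coproducts of objects in `P`. -/
def IsRegularGenerator {C : Type (u + 1)} [Category.{u} C] (P : ObjectProperty C) : Prop :=
  P.IsSeparating ∧
    ∀ X : C, ∃ (I J : Type u) (s : I → C) (t : J → C) (Y : Cofan s) (Z : Cofan t) (f g : Y.pt ⟶ Z.pt)
      (π : Z.pt ⟶ X) (w : f ≫ π = g ≫ π), (∀ i, P (s i)) ∧ (∀ j, P (t j)) ∧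
        Nonempty (IsColimit Y) ∧ Nonempty (IsColimit Z) ∧ Nonempty (IsColimit (Cofork.ofπ π w))

/-! Colimits in `CQG` are computed on underlying algebras. The colimit algebra is given by
generators and relations. Its involution, comultiplication, counit and antipode are induced by the
universal property, with the opposite algebra or its complex conjugate as target for the
anti-multiplicative maps. The unitary coefficients of the stages generate it, and products of
unitary coefficients are again unitary coefficients, so they span.

A morphism `Au Q ⟶ A` is the same as a matrix over `A` subject to finitely many equations: the
unitarity relations in `A` and the comultiplication rule in `A ⊗ A`. In a filtered colimit an
equation between elements already holds at some stage, and the same is true in the tensor square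
because vector spaces are flat (`exists_map_tensor_eq_zero`). Hence `Au Q` is finitely presentable.

The `Au Q` reach every element because the conjugate of a unitary comodule is unitarizable. Its
coefficients lie in the coefficient space of one unitary comodule `w`, and averaging over an
orthonormal basis of the matrix `*`-algebra of evaluations of `w` produces an invariant inner
product (`exists_posDef_of_mem_span`). This inner product supplies the matrix `Q`, so every unitary
comodule is the image of the standard one under some `Au Q ⟶ A`, and the coefficients of such
comodules span `A`.

For the regular generator, take the canonical map `π` from the coproduct of all `Au Q ⟶ X`; it is
surjective. The crux is that a morphism `s` which coequalizes every pair of maps from some `Au Q`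
coequalized by `π` must kill the kernel of `π`. Let `b` be compatible with `Q`. If a unitary `U`
commutes with `Q` and with the image of `b` under `π`, then `b` and its conjugate by `U` are two
maps from the same `Au Q` identified by `π`, hence by `s`, so `U` commutes with the image of `b`
under `s`. The Cayley transform extends this to Hermitian matrices, a two-by-two block trick to
eigenvectors of conjugation by `Q`, and diagonalizability to the whole commutant
(`CoequalizesAu.commutant_le`). The double commutant theorem turns the inclusion of commutants into
an inclusion of evaluation algebras, which says that every linear relation between the coefficients
under `π` also holds under `s`.

Local finite presentability follows, since a cocomplete category with a strong generator of finitely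
presentable objects is locally finitely presentable. -/

namespace QuantumGroup

open scoped TensorProduct
open Matrix

/-! ### The antipode on unitary comodules -/

section antipode

variable {H : Type*} [Ring H] [HopfAlgebra ℂ H] {ι : Type*} [Fintype ι] [DecidableEq ι]
  {x : Matrix ι ι H}

theorem IsCoefficientMatrix.antipode_mul (hx : IsCoefficientMatrix x) :
    x.map (HopfAlgebraStruct.antipode ℂ) * x = 1 := by
  ext i j
  have h := HopfAlgebra.mul_antipode_rTensor_comul_apply (R := ℂ) (x i j)
  rw [hx.comul_apply, hx.counit_apply] at h
  simpa [Matrix.mul_apply, Matrix.one_apply, apply_ite (algebraMap ℂ H)] using h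

theorem IsCoefficientMatrix.mul_antipode (hx : IsCoefficientMatrix x) :
    x * x.map (HopfAlgebraStruct.antipode ℂ) = 1 := by
  ext i j
  have h := HopfAlgebra.mul_antipode_lTensor_comul_apply (R := ℂ) (x i j)
  rw [hx.comul_apply, hx.counit_apply] at h
  simpa [Matrix.mul_apply, Matrix.one_apply, apply_ite (algebraMap ℂ H)] using h

/-- Both `S(x)` and `x*` are inverse to `x`. Since unitary coefficients span a CQG algebra, the
involution and the comodules determine its antipode. -/
theorem IsCoefficientMatrix.antipode_apply [StarRing H] (hx : IsCoefficientMatrix x)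
    (hx' : x ∈ unitary (Matrix ι ι H)) (i j : ι) :
    HopfAlgebraStruct.antipode ℂ (x i j) = star (x j i) := by
  have h : x.map (HopfAlgebraStruct.antipode ℂ) = star x :=
    left_inv_eq_right_inv hx.antipode_mul (Unitary.mem_iff.1 hx').2
  exact congrFun (congrFun h i) j

end antipode

end QuantumGroup

open QuantumGroup

namespace CQG

open scoped TensorProduct

/-- The underlying algebra homomorphism of a morphism of CQG algebras. -/
def alg {A B : CQG.{u}} (f : A ⟶ B) : A →ₐ[ℂ] B := AlgHomClass.toAlgHom (Hom.toBialgHom f)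

/-! ### Morphisms of CQG algebras as algebra homomorphisms -/

section alg

variable {A B C : CQG.{u}}

theorem alg_star (f : A ⟶ B) (a : A) : alg f (star a) = star (alg f a) := Hom.map_star f a

theorem comul_alg (f : A ⟶ B) (a : A) :
    Coalgebra.comul (R := ℂ) (alg f a) =
      Algebra.TensorProduct.map (alg f) (alg f) (Coalgebra.comul (R := ℂ) a) :=
  (CoalgHomClass.map_comp_comul_apply (Hom.toBialgHom f) a).symm

theorem counit_alg (f : A ⟶ B) (a : A) :
    Coalgebra.counit (R := ℂ) (alg f a) = Coalgebra.counit (R := ℂ) a :=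
  CoalgHomClass.counit_comp_apply (Hom.toBialgHom f) a

theorem hom_ext {f g : A ⟶ B} (h : ∀ a, alg f a = alg g a) : f = g :=
  Hom.ext (BialgHom.ext h)

@[simp] theorem alg_id (a : A) : alg (𝟙 A) a = a := rfl

@[simp] theorem alg_comp (f : A ⟶ B) (g : B ⟶ C) (a : A) : alg (f ≫ g) a = alg g (alg f a) := rfl

/-- Morphisms of CQG algebras from algebra homomorphisms. -/
def homMk (f : A →ₐ[ℂ] B) (hstar : ∀ a, f (star a) = star (f a))
    (hcomul : ∀ a, Coalgebra.comul (R := ℂ) (f a) =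
      Algebra.TensorProduct.map f f (Coalgebra.comul (R := ℂ) a))
    (hcounit : ∀ a, Coalgebra.counit (R := ℂ) (f a) = Coalgebra.counit (R := ℂ) a) : A ⟶ B :=
  Hom.mk (BialgHom.ofAlgHom f (AlgHom.ext hcounit) (AlgHom.ext fun a => (hcomul a).symm)) hstar

theorem isCoefficientMatrix_map (f : A ⟶ B) {ι : Type*} [Fintype ι] [DecidableEq ι]
    {x : Matrix ι ι A} (hx : IsCoefficientMatrix x) : IsCoefficientMatrix (x.map (alg f)) where
  comul_apply i j := by
    simp [comul_alg, hx.comul_apply]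
  counit_apply i j := by
    simp [counit_alg, hx.counit_apply]

theorem star_map (f : A ⟶ B) {ι : Type*} (x : Matrix ι ι A) :
    star (x.map (alg f)) = (star x).map (alg f) := by
  ext i j
  simp [Matrix.star_apply, alg_star]

theorem map_mem_unitary (f : A ⟶ B) {ι : Type*} [Fintype ι] [DecidableEq ι]
    {x : Matrix ι ι A} (hx : x ∈ unitary (Matrix ι ι A)) :
    x.map (alg f) ∈ unitary (Matrix ι ι B) := by
  rw [Unitary.mem_iff] at hx ⊢
  rw [star_map, ← Matrix.map_mul, ← Matrix.map_mul, hx.1, hx.2]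
  simp

/-- On unitary coefficients the antipode is the adjoint matrix, which morphisms preserve, and these
coefficients span. The antipodes of a diagram therefore form a compatible family and induce one on
the colimit. -/
theorem alg_antipode (f : A ⟶ B) (a : A) :
    alg f (HopfAlgebraStruct.antipode ℂ a) = HopfAlgebraStruct.antipode ℂ (alg f a) := by
  have ha : a ∈ Submodule.span ℂ (unitaryCoefficients A) := by
    rw [A.span_unitaryCoefficients]; trivial
  induction ha using Submodule.span_induction with
  | mem a ha =>
    obtain ⟨n, x, hx, hx', i, j, rfl⟩ := ha
    have h := (isCoefficientMatrix_map f hx).antipode_apply (map_mem_unitary f hx') i j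
    rw [Matrix.map_apply, Matrix.map_apply] at h
    rw [h, hx.antipode_apply hx', alg_star]
  | zero => simp
  | add a b _ _ ha hb => simp [ha, hb]
  | smul c a _ ha => simp [ha]

end alg

/-! ### Colimits of CQG algebras -/

section conj

open QuantumGroup.AuAlgebra MulOpposite

/-- The involution of a complex `*`-algebra as an algebra homomorphism to the conjugate opposite. -/
noncomputable def starConj (A : Type*) [Ring A] [Algebra ℂ A] [StarRing A] [StarModule ℂ A] :
    A →ₐ[ℂ] ConjOp A where
  toFun a := toConj (star a)
  map_one' := by rw [star_one]; rfl
  map_mul' a b := by rw [star_mul]; rfl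
  map_zero' := by rw [star_zero]; rfl
  map_add' a b := by rw [star_add]; rfl
  commutes' c := by rw [algebraMap_star_comm c |>.symm]; rfl

/-- An algebra homomorphism, between the conjugate opposite algebras. -/
noncomputable def mapConj {A B : Type*} [Ring A] [Algebra ℂ A] [Ring B] [Algebra ℂ B]
    (f : A →ₐ[ℂ] B) : ConjOp A →ₐ[ℂ] ConjOp B where
  toFun a := toConj (f (ofConj a))
  map_one' := congrArg op (map_one f)
  map_mul' a b := congrArg op (map_mul f (ofConj b) (ofConj a))
  map_zero' := congrArg op (map_zero f)
  map_add' a b := congrArg op (map_add f (ofConj a) (ofConj b))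
  commutes' c := congrArg op (f.commutes (star c))

end conj

variable {J : Type u} [SmallCategory J] (F : J ⥤ CQG.{u})

/-- The relations that make the maps from the algebras of a diagram to the free algebra on all their
elements compatible algebra homomorphisms. -/
inductive ColimRel : FreeAlgebra ℂ (Σ j, F.obj j) → FreeAlgebra ℂ (Σ j, F.obj j) → Prop
  | alg (j : J) (c : ℂ) :
      ColimRel (FreeAlgebra.ι ℂ ⟨j, algebraMap ℂ (F.obj j) c⟩) (algebraMap ℂ _ c)
  | add (j : J) (a b : F.obj j) :
      ColimRel (FreeAlgebra.ι ℂ ⟨j, a + b⟩) (FreeAlgebra.ι ℂ ⟨j, a⟩ + FreeAlgebra.ι ℂ ⟨j, b⟩)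
  | mul (j : J) (a b : F.obj j) :
      ColimRel (FreeAlgebra.ι ℂ ⟨j, a * b⟩) (FreeAlgebra.ι ℂ ⟨j, a⟩ * FreeAlgebra.ι ℂ ⟨j, b⟩)
  | map {i j : J} (f : i ⟶ j) (a : F.obj i) :
      ColimRel (FreeAlgebra.ι ℂ ⟨j, CQG.alg (F.map f) a⟩) (FreeAlgebra.ι ℂ ⟨i, a⟩)

/-- The colimit of the underlying algebras of a diagram of CQG algebras. -/
def ColimAlg : Type u := RingQuot (ColimRel F)

namespace ColimAlg

noncomputable instance : Ring (ColimAlg F) := inferInstanceAs (Ring (RingQuot (ColimRel F)))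

noncomputable instance : Algebra ℂ (ColimAlg F) :=
  inferInstanceAs (Algebra ℂ (RingQuot (ColimRel F)))

/-- The quotient map. -/
noncomputable def mk : FreeAlgebra ℂ (Σ j, F.obj j) →ₐ[ℂ] ColimAlg F :=
  RingQuot.mkAlgHom ℂ (ColimRel F)

variable {F} in
theorem mk_rel {x y : FreeAlgebra ℂ (Σ j, F.obj j)} (h : ColimRel F x y) : mk F x = mk F y :=
  RingQuot.mkAlgHom_rel ℂ h

/-- The maps to the colimit. -/
noncomputable def incl (j : J) : F.obj j →ₐ[ℂ] ColimAlg F :=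
  AlgHom.ofLinearMap
    { toFun := fun a => mk F (FreeAlgebra.ι ℂ ⟨j, a⟩)
      map_add' := fun a b => by rw [mk_rel (.add j a b), map_add]
      map_smul' := fun c a => by
        rw [Algebra.smul_def, mk_rel (.mul j _ _), map_mul, mk_rel (.alg j c), AlgHom.commutes,
          RingHom.id_apply, Algebra.smul_def] }
    (by simpa using mk_rel (.alg (F := F) j 1))
    (fun a b => (mk_rel (.mul j a b)).trans (map_mul _ _ _))

theorem incl_map {i j : J} (f : i ⟶ j) (a : F.obj i) : incl F j (CQG.alg (F.map f) a) = incl F i a :=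
  mk_rel (.map f a)

variable {F}

section lift

variable {B : Type*} [Ring B] [Algebra ℂ B]

/-- The universal property of the colimit. -/
noncomputable def lift (g : ∀ j, F.obj j →ₐ[ℂ] B)
    (hg : ∀ (i j : J) (f : i ⟶ j) (a : F.obj i), g j (CQG.alg (F.map f) a) = g i a) :
    ColimAlg F →ₐ[ℂ] B :=
  RingQuot.liftAlgHom ℂ ⟨FreeAlgebra.lift ℂ (fun x => g x.1 x.2), by
    intro x y h
    cases h <;> simp [hg]⟩

@[simp] theorem lift_incl (g : ∀ j, F.obj j →ₐ[ℂ] B)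
    (hg : ∀ (i j : J) (f : i ⟶ j) (a : F.obj i), g j (CQG.alg (F.map f) a) = g i a) (j : J)
    (a : F.obj j) : lift g hg (incl F j a) = g j a := by
  refine (RingQuot.liftAlgHom_mkAlgHom_apply ℂ _ _ _).trans ?_
  simp

end lift

@[elab_as_elim]
theorem induction {p : ColimAlg F → Prop} (incl : ∀ j a, p (incl F j a))
    (alg : ∀ c, p (algebraMap ℂ _ c)) (add : ∀ a b, p a → p b → p (a + b))
    (mul : ∀ a b, p a → p b → p (a * b)) (a) : p a := by
  obtain ⟨x, rfl⟩ := RingQuot.mkAlgHom_surjective ℂ (ColimRel F) a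
  change p (mk F x)
  induction x using FreeAlgebra.induction with
  | grade0 r => simpa using alg r
  | grade1 x => exact incl x.1 x.2
  | mul a b ha hb => rw [map_mul]; exact mul _ _ ha hb
  | add a b ha hb => rw [map_add]; exact add _ _ ha hb

theorem algHom_ext {B : Type*} [Semiring B] [Algebra ℂ B] {f g : ColimAlg F →ₐ[ℂ] B}
    (h : ∀ j a, f (incl F j a) = g (incl F j a)) : f = g := by
  ext a
  induction a using ColimAlg.induction with
  | incl j a => exact h j a
  | alg c => simp
  | add a b ha hb => simp [ha, hb]
  | mul a b ha hb => simp [ha, hb]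

/-! The involution -/

section star

open QuantumGroup.AuAlgebra MulOpposite

variable (F)

/-- The involution of the colimit. -/
noncomputable def starHom : ColimAlg F →ₐ[ℂ] ConjOp (ColimAlg F) :=
  lift (fun j => (mapConj (incl F j)).comp (starConj (F.obj j))) fun i j f a => by
    change toConj (incl F j (star (CQG.alg (F.map f) a))) = toConj (incl F i (star a))
    rw [← alg_star, incl_map]

noncomputable instance : Star (ColimAlg F) := ⟨fun a => ofConj (starHom F a)⟩

theorem star_def (a : ColimAlg F) : star a = ofConj (starHom F a) := rfl

@[simp] theorem star_incl (j : J) (a : F.obj j) : star (incl F j a) = incl F j (star a) := by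
  rw [star_def, starHom, lift_incl]; rfl

theorem star_algebraMap' (c : ℂ) : star (algebraMap ℂ (ColimAlg F) c) = algebraMap ℂ _ (star c) := by
  rw [star_def, AlgHom.commutes]; rfl

theorem star_mul' (a b : ColimAlg F) : star (a * b) = star b * star a := by
  rw [star_def, map_mul]; rfl

theorem star_add' (a b : ColimAlg F) : star (a + b) = star a + star b := by
  rw [star_def, map_add]; rfl

noncomputable instance : StarRing (ColimAlg F) where
  star_involutive a := by
    induction a using ColimAlg.induction with
    | incl j a => simp
    | alg c => simp [star_algebraMap']
    | add a b ha hb => rw [star_add', star_add', ha, hb]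
    | mul a b ha hb => rw [star_mul', star_mul', ha, hb]
  star_mul := star_mul' F
  star_add := star_add' F

instance : StarModule ℂ (ColimAlg F) where
  star_smul c a := by
    rw [Algebra.smul_def, star_mul', star_algebraMap', Algebra.smul_def, Algebra.commutes]

end star

/-! The Hopf algebra structure -/

variable (F)

/-- The comultiplication of the colimit. -/
noncomputable def comulHom : ColimAlg F →ₐ[ℂ] ColimAlg F ⊗[ℂ] ColimAlg F :=
  lift (fun j => (Algebra.TensorProduct.map (incl F j) (incl F j)).comp
    (Bialgebra.comulAlgHom ℂ (F.obj j))) fun i j f a => by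
    have h : (incl F j).comp (CQG.alg (F.map f)) = incl F i := AlgHom.ext (incl_map F f)
    rw [AlgHom.comp_apply, AlgHom.comp_apply, Bialgebra.comulAlgHom_apply, comul_alg, ← h,
      Algebra.TensorProduct.map_comp]
    rfl

/-- The counit of the colimit. -/
noncomputable def counitHom : ColimAlg F →ₐ[ℂ] ℂ :=
  lift (fun j => Bialgebra.counitAlgHom ℂ (F.obj j)) fun _ _ f a => counit_alg (F.map f) a

theorem comulHom_incl (j : J) (a : F.obj j) : comulHom F (incl F j a) =
    Algebra.TensorProduct.map (incl F j) (incl F j) (Coalgebra.comul (R := ℂ) a) :=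
  lift_incl ..

theorem counitHom_incl (j : J) (a : F.obj j) :
    counitHom F (incl F j a) = Coalgebra.counit (R := ℂ) a :=
  lift_incl ..

theorem assoc_map_tmul {A B : Type*} [Ring A] [Algebra ℂ A] [Ring B] [Algebra ℂ B] (g : A →ₐ[ℂ] B)
    (x : A ⊗[ℂ] A) (b : A) :
    TensorProduct.assoc ℂ B B B (Algebra.TensorProduct.map g g x ⊗ₜ g b) =
      Algebra.TensorProduct.map g (Algebra.TensorProduct.map g g)
        (TensorProduct.assoc ℂ A A A (x ⊗ₜ b)) := by
  induction x with
  | zero => simp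
  | add x y hx hy => simp only [map_add, TensorProduct.add_tmul, hx, hy]
  | tmul p q => simp

/-- Both iterated coproducts of `g a` are images under `g ⊗ g ⊗ g` of the corresponding ones in `A`,
where coassociativity is known. This transfers coassociativity to the colimit before it carries a
coalgebra structure. -/
theorem assoc_map_comul {A B : Type*} [Ring A] [Bialgebra ℂ A] [Ring B] [Algebra ℂ B]
    (g : A →ₐ[ℂ] B) (D : B →ₐ[ℂ] B ⊗[ℂ] B)
    (hD : ∀ a, D (g a) = Algebra.TensorProduct.map g g (Coalgebra.comul (R := ℂ) a)) (a : A) :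
    TensorProduct.assoc ℂ B B B (Algebra.TensorProduct.map D (AlgHom.id ℂ B) (D (g a))) =
      Algebra.TensorProduct.map (AlgHom.id ℂ B) D (D (g a)) := by
  have h1 (t : A ⊗[ℂ] A) : TensorProduct.assoc ℂ B B B
      (Algebra.TensorProduct.map D (AlgHom.id ℂ B) (Algebra.TensorProduct.map g g t)) =
      Algebra.TensorProduct.map g (Algebra.TensorProduct.map g g) (TensorProduct.assoc ℂ A A A
        ((Coalgebra.comul (R := ℂ) (A := A)).rTensor A t)) := by
    induction t with
    | zero => simp
    | add x y hx hy => simp only [map_add, hx, hy]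
    | tmul p q => simp [hD, assoc_map_tmul]
  have h2 (t : A ⊗[ℂ] A) :
      Algebra.TensorProduct.map (AlgHom.id ℂ B) D (Algebra.TensorProduct.map g g t) =
      Algebra.TensorProduct.map g (Algebra.TensorProduct.map g g)
        ((Coalgebra.comul (R := ℂ) (A := A)).lTensor A t) := by
    induction t with
    | zero => simp
    | add x y hx hy => simp only [map_add, hx, hy]
    | tmul p q => simp [hD]
  rw [hD, h1, h2, Coalgebra.coassoc_apply]

/-- Each coalgebra axiom equates two algebra homomorphisms out of the colimit, so it is enough to
check it on the images of the stages. -/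
noncomputable instance : Bialgebra ℂ (ColimAlg F) :=
  Bialgebra.ofAlgHom (comulHom F) (counitHom F)
    (algHom_ext fun j a => assoc_map_comul (incl F j) (comulHom F) (comulHom_incl F j) a)
    (by
      have h (j : J) (t : F.obj j ⊗[ℂ] F.obj j) :
          Algebra.TensorProduct.map (counitHom F) (AlgHom.id ℂ _)
            (Algebra.TensorProduct.map (incl F j) (incl F j) t) =
          Algebra.TensorProduct.map (AlgHom.id ℂ ℂ) (incl F j)
            ((Coalgebra.counit (R := ℂ) (A := F.obj j)).rTensor _ t) := by
        induction t with
        | zero => simp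
        | add x y hx hy => simp only [map_add, hx, hy]
        | tmul p q => simp [counitHom_incl]
      apply algHom_ext
      intro j a
      rw [AlgHom.comp_apply, comulHom_incl, h, Coalgebra.rTensor_counit_comul]
      simp)
    (by
      have h (j : J) (t : F.obj j ⊗[ℂ] F.obj j) :
          Algebra.TensorProduct.map (AlgHom.id ℂ _) (counitHom F)
            (Algebra.TensorProduct.map (incl F j) (incl F j) t) =
          Algebra.TensorProduct.map (incl F j) (AlgHom.id ℂ ℂ)
            ((Coalgebra.counit (R := ℂ) (A := F.obj j)).lTensor _ t) := by
        induction t with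
        | zero => simp
        | add x y hx hy => simp only [map_add, hx, hy]
        | tmul p q => simp [counitHom_incl]
      apply algHom_ext
      intro j a
      rw [AlgHom.comp_apply, comulHom_incl, h, Coalgebra.lTensor_counit_comul]
      simp)

theorem comul_incl (j : J) (a : F.obj j) : Coalgebra.comul (R := ℂ) (incl F j a) =
    Algebra.TensorProduct.map (incl F j) (incl F j) (Coalgebra.comul (R := ℂ) a) :=
  comulHom_incl F j a

theorem counit_incl (j : J) (a : F.obj j) :
    Coalgebra.counit (R := ℂ) (incl F j a) = Coalgebra.counit (R := ℂ) a :=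
  counitHom_incl F j a

section antipode

open MulOpposite

/-- The antipode of the colimit, as an algebra homomorphism to the opposite algebra. -/
noncomputable def antipodeHom : ColimAlg F →ₐ[ℂ] (ColimAlg F)ᵐᵒᵖ :=
  lift (fun j => (AlgHom.op (incl F j)).comp (HopfAlgebra.antipodeAlgHomOp ℂ (F.obj j)))
    fun i j f a => by
      apply unop_injective
      simp [← alg_antipode, incl_map]

/-- The antipode of the colimit. -/
noncomputable def antipodeLin : ColimAlg F →ₗ[ℂ] ColimAlg F :=
  (opLinearEquiv ℂ).symm.toLinearMap ∘ₗ (antipodeHom F).toLinearMap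

theorem antipodeLin_incl (j : J) (a : F.obj j) :
    antipodeLin F (incl F j a) = incl F j (HopfAlgebraStruct.antipode ℂ a) := by
  simp [antipodeLin, antipodeHom]

theorem antipodeLin_mul (a b : ColimAlg F) :
    antipodeLin F (a * b) = antipodeLin F b * antipodeLin F a := by
  simp [antipodeLin]

theorem antipodeLin_algebraMap (c : ℂ) :
    antipodeLin F (algebraMap ℂ (ColimAlg F) c) = algebraMap ℂ _ c := by
  simp [antipodeLin, MulOpposite.algebraMap_apply]

theorem antipodeLin_one : antipodeLin F (1 : ColimAlg F) = 1 := by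
  simpa using antipodeLin_algebraMap F 1

end antipode

/-- The antipode identities do not equate algebra homomorphisms. They are proved by induction on
elements, and products are handled by the anti-multiplicativity of the antipode. -/
noncomputable instance : HopfAlgebra ℂ (ColimAlg F) where
  antipode := antipodeLin F
  mul_antipode_rTensor_comul := by
    ext a
    change LinearMap.mul' ℂ _ ((antipodeLin F).rTensor _ (Coalgebra.comul a)) =
      algebraMap ℂ _ (Coalgebra.counit a)
    induction a using ColimAlg.induction with
    | incl j a =>
      have h (t : F.obj j ⊗[ℂ] F.obj j) : LinearMap.mul' ℂ _ ((antipodeLin F).rTensor _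
          (Algebra.TensorProduct.map (incl F j) (incl F j) t)) = incl F j (LinearMap.mul' ℂ _
            ((HopfAlgebraStruct.antipode ℂ).rTensor _ t)) := by
        induction t with
        | zero => simp
        | add x y hx hy => simp only [map_add, hx, hy]
        | tmul p q => simp [antipodeLin_incl]
      rw [comul_incl, h, counit_incl, HopfAlgebra.mul_antipode_rTensor_comul_apply,
        AlgHom.commutes]
    | alg c => simp [antipodeLin_algebraMap, Algebra.TensorProduct.algebraMap_apply]
    | add a b ha hb => simp only [map_add, ha, hb]
    | mul a b ha hb => exact AuAlgebra.antipode_left_mul _ (antipodeLin_mul F) ha hb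
  mul_antipode_lTensor_comul := by
    ext a
    change LinearMap.mul' ℂ _ ((antipodeLin F).lTensor _ (Coalgebra.comul a)) =
      algebraMap ℂ _ (Coalgebra.counit a)
    induction a using ColimAlg.induction with
    | incl j a =>
      have h (t : F.obj j ⊗[ℂ] F.obj j) : LinearMap.mul' ℂ _ ((antipodeLin F).lTensor _
          (Algebra.TensorProduct.map (incl F j) (incl F j) t)) = incl F j (LinearMap.mul' ℂ _
            ((HopfAlgebraStruct.antipode ℂ).lTensor _ t)) := by
        induction t with
        | zero => simp
        | add x y hx hy => simp only [map_add, hx, hy]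
        | tmul p q => simp [antipodeLin_incl]
      rw [comul_incl, h, counit_incl, HopfAlgebra.mul_antipode_lTensor_comul_apply,
        AlgHom.commutes]
    | alg c => simp [antipodeLin_one, Algebra.TensorProduct.algebraMap_apply]
    | add a b ha hb => simp only [map_add, ha, hb]
    | mul a b ha hb => exact AuAlgebra.antipode_right_mul _ (antipodeLin_mul F) ha hb

instance : IsHopfStarAlgebra (ColimAlg F) where
  comul_star a := by
    induction a using ColimAlg.induction with
    | incl j a =>
      have h (t : F.obj j ⊗[ℂ] F.obj j) : Algebra.TensorProduct.map (incl F j) (incl F j) (star t) =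
          star (Algebra.TensorProduct.map (incl F j) (incl F j) t) := by
        induction t with
        | zero => simp
        | add x y hx hy => simp only [map_add, star_add, hx, hy]
        | tmul p q => simp
      rw [star_incl, comul_incl, comul_incl, IsHopfStarAlgebra.comul_star, h]
    | alg c => simp [star_algebraMap', Algebra.TensorProduct.algebraMap_apply]
    | add a b ha hb => simp only [map_add, star_add, ha, hb]
    | mul a b ha hb => simp only [star_mul, Bialgebra.comul_mul, ha, hb]
  counit_star a := by
    induction a using ColimAlg.induction with
    | incl j a => rw [star_incl, counit_incl, counit_incl, IsHopfStarAlgebra.counit_star]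
    | alg c => simp [star_algebraMap']
    | add a b ha hb => simp only [map_add, star_add, ha, hb]
    | mul a b ha hb => simp only [star_mul, Bialgebra.counit_mul, ha, hb]

theorem incl_mem_unitaryCoefficients (j : J) {a : F.obj j} (ha : a ∈ unitaryCoefficients (F.obj j)) :
    incl F j a ∈ unitaryCoefficients (ColimAlg F) := by
  obtain ⟨n, x, hx, hx', i, k, rfl⟩ := ha
  refine ⟨n, x.map (incl F j), ⟨fun i k => ?_, fun i k => ?_⟩, ?_, i, k, rfl⟩
  · simp [comul_incl, hx.comul_apply]
  · simp [counit_incl, hx.counit_apply]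
  · have h : star (x.map (incl F j)) = (star x).map (incl F j) := by
      ext i k
      simp [Matrix.star_apply]
    rw [Unitary.mem_iff] at hx' ⊢
    rw [h, ← Matrix.map_mul, ← Matrix.map_mul, hx'.1, hx'.2]
    simp

/-- The span contains the image of every stage, and it is a subalgebra because tensor products of
unitary comodules are unitary. -/
theorem span_unitaryCoefficients : Submodule.span ℂ (unitaryCoefficients (ColimAlg F)) = ⊤ := by
  rw [eq_top_iff]
  rintro a -
  induction a using ColimAlg.induction with
  | incl j a =>
    have ha : a ∈ Submodule.span ℂ (unitaryCoefficients (F.obj j)) := by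
      rw [(F.obj j).span_unitaryCoefficients]; trivial
    have h := Submodule.mem_map_of_mem (f := (incl F j).toLinearMap) ha
    rw [Submodule.map_span] at h
    refine Submodule.span_mono ?_ h
    rintro _ ⟨x, hx, rfl⟩
    exact incl_mem_unitaryCoefficients F j hx
  | alg c =>
    rw [Algebra.algebraMap_eq_smul_one]
    exact Submodule.smul_mem _ _ (Submodule.subset_span one_mem_unitaryCoefficients)
  | add a b ha hb => exact Submodule.add_mem _ ha hb
  | mul a b ha hb =>
    have h := Submodule.mul_mem_mul ha hb
    rw [Submodule.span_mul_span] at h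
    refine Submodule.span_mono ?_ h
    rintro _ ⟨x, hx, y, hy, rfl⟩
    exact mul_mem_unitaryCoefficients hx hy

end ColimAlg

/-- The colimit of a diagram of CQG algebras. -/
noncomputable def colimObj : CQG.{u} where
  carrier := ColimAlg F
  span_unitaryCoefficients := ColimAlg.span_unitaryCoefficients F

/-- The colimit cocone of a diagram of CQG algebras. -/
noncomputable def colimCocone : Cocone F where
  pt := colimObj F
  ι :=
    { app := fun j => homMk (B := colimObj F) (ColimAlg.incl F j)
        (fun a => (ColimAlg.star_incl F j a).symm) (ColimAlg.comul_incl F j)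
        (ColimAlg.counit_incl F j)
      naturality := fun _ _ f => hom_ext fun a => ColimAlg.incl_map F f a }

variable {F} in
/-- The algebra homomorphism underlying the morphism from the colimit to a cocone. -/
noncomputable def colimDescAlg (s : Cocone F) : ColimAlg F →ₐ[ℂ] s.pt :=
  ColimAlg.lift (fun j => alg (s.ι.app j)) fun _ _ f a => by rw [← s.w f]; rfl

variable {F} in
@[simp] theorem colimDescAlg_incl (s : Cocone F) (j : J) (a : F.obj j) :
    colimDescAlg s (ColimAlg.incl F j a) = alg (s.ι.app j) a :=
  ColimAlg.lift_incl _ _ _ _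

variable {F} in
theorem colimDescAlg_star (s : Cocone F) (a : ColimAlg F) :
    colimDescAlg s (star a) = star (colimDescAlg s a) := by
  induction a using ColimAlg.induction with
  | incl j a => rw [ColimAlg.star_incl, colimDescAlg_incl, colimDescAlg_incl, alg_star]
  | alg c => rw [ColimAlg.star_algebraMap', AlgHom.commutes, AlgHom.commutes, algebraMap_star_comm]
  | add a b ha hb => simp only [map_add, star_add, ha, hb]
  | mul a b ha hb => simp only [map_mul, star_mul, ha, hb]

variable {F} in
/-- The morphism from the colimit to a cocone. -/
noncomputable def colimDesc (s : Cocone F) : colimObj F ⟶ s.pt :=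
  homMk (A := colimObj F) (colimDescAlg s)
    (colimDescAlg_star s)
    (fun a => by
      refine AlgHom.congr_fun (ColimAlg.algHom_ext
        (f := (Bialgebra.comulAlgHom ℂ s.pt).comp (colimDescAlg s))
        (g := (Algebra.TensorProduct.map (colimDescAlg s) (colimDescAlg s)).comp
          (ColimAlg.comulHom F)) fun j a => ?_) a
      have h : (colimDescAlg s).comp (ColimAlg.incl F j) = alg (s.ι.app j) :=
        AlgHom.ext (colimDescAlg_incl s j)
      rw [AlgHom.comp_apply, AlgHom.comp_apply, ColimAlg.comulHom_incl, colimDescAlg_incl,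
        Bialgebra.comulAlgHom_apply, comul_alg, ← h, Algebra.TensorProduct.map_comp]
      rfl)
    (fun a => AlgHom.congr_fun (ColimAlg.algHom_ext
        (f := (Bialgebra.counitAlgHom ℂ s.pt).comp (colimDescAlg s))
        (g := ColimAlg.counitHom F) fun j a => by
      rw [AlgHom.comp_apply, ColimAlg.counitHom_incl, colimDescAlg_incl]
      exact counit_alg _ _) a)

/-- `colimCocone` is a colimit. -/
noncomputable def isColimitColimCocone : IsColimit (colimCocone F) where
  desc := colimDesc
  fac s j := hom_ext fun a => colimDescAlg_incl s j a
  uniq s m hm := hom_ext fun a => AlgHom.congr_fun (ColimAlg.algHom_ext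
    (f := alg m) (g := colimDescAlg s) fun j a => by
      rw [colimDescAlg_incl, ← hm j]; rfl) a

theorem hasColimits : HasColimits CQG.{u} :=
  ⟨fun _ _ => ⟨fun F => ⟨⟨⟨colimCocone F, isColimitColimCocone F⟩⟩⟩⟩⟩

end CQG

namespace CQG

open scoped TensorProduct

/-! ### Filtered colimits of CQG algebras -/

/-- In a filtered category, finitely many conditions that hold eventually hold simultaneously. -/
theorem exists_hom_forall_of_finite {J : Type*} [Category* J] [IsFiltered J] {ι : Type*} [Finite ι]
    {j : J} {P : ι → ∀ k : J, (j ⟶ k) → Prop}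
    (hP : ∀ i k l (f : j ⟶ k) (g : k ⟶ l), P i k f → P i l (f ≫ g))
    (h : ∀ i, ∃ k f, P i k f) : ∃ k f, ∀ i, P i k f := by
  classical
  have := Fintype.ofFinite ι
  suffices ∀ s : Finset ι, ∃ k f, ∀ i ∈ s, P i k f by
    obtain ⟨k, f, hf⟩ := this Finset.univ
    exact ⟨k, f, fun i => hf i (Finset.mem_univ i)⟩
  intro s
  induction s using Finset.induction_on with
  | empty => exact ⟨j, 𝟙 j, by simp⟩
  | insert a s _ ih =>
    obtain ⟨k, f, hf⟩ := ih
    obtain ⟨l, g, hg⟩ := h a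
    -- The two routes from `j` to the upper bound may differ, so they are coequalized; both families
    -- of conditions then persist along one arrow.
    refine ⟨_, (f ≫ IsFiltered.leftToMax k l) ≫ IsFiltered.coeqHom (f ≫ IsFiltered.leftToMax k l)
      (g ≫ IsFiltered.rightToMax k l), fun i hi => ?_⟩
    rcases Finset.mem_insert.1 hi with rfl | hi
    · rw [IsFiltered.coeq_condition]
      exact hP _ _ _ _ _ (hP _ _ _ _ _ hg)
    · exact hP _ _ _ _ _ (hP _ _ _ _ _ (hf i hi))

section filtered

variable {J : Type u} [SmallCategory J] [IsFiltered J] (F : J ⥤ CQG.{u})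

/-- The diagram of underlying algebras. -/
def algDiagram : J ⥤ AlgCat.{u} ℂ where
  obj j := AlgCat.of ℂ (F.obj j)
  map f := AlgCat.ofHom (alg (F.map f))
  map_id j := by ext a; change alg (F.map (𝟙 j)) a = a; simp
  map_comp f g := by ext a; change alg (F.map (f ≫ g)) a = alg (F.map g) (alg (F.map f) a); simp

variable {F}

/-- Any two elements from the stages can be moved to a common stage, so the union of the images is
closed under sums and products. -/
theorem ColimAlg.exists_incl_eq (a : ColimAlg F) : ∃ j x, incl F j x = a := by
  have key {i j : J} (x : F.obj i) (y : F.obj j) : ∃ k x' y', incl F k x' = incl F i x ∧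
      incl F k y' = incl F j y :=
    ⟨IsFiltered.max i j, alg (F.map (IsFiltered.leftToMax i j)) x,
      alg (F.map (IsFiltered.rightToMax i j)) y, incl_map _ _ _, incl_map _ _ _⟩
  induction a using ColimAlg.induction with
  | incl j a => exact ⟨j, a, rfl⟩
  | alg c => exact ⟨IsFiltered.nonempty.some, algebraMap ℂ _ c, AlgHom.commutes _ _⟩
  | add a b ha hb =>
    obtain ⟨i, x, rfl⟩ := ha
    obtain ⟨j, y, rfl⟩ := hb
    obtain ⟨k, x', y', hx, hy⟩ := key x y
    exact ⟨k, x' + y', by rw [map_add, hx, hy]⟩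
  | mul a b ha hb =>
    obtain ⟨i, x, rfl⟩ := ha
    obtain ⟨j, y, rfl⟩ := hb
    obtain ⟨k, x', y', hx, hy⟩ := key x y
    exact ⟨k, x' * y', by rw [map_mul, hx, hy]⟩

theorem ColimAlg.exists_map_eq {j : J} {x y : F.obj j} (h : incl F j x = incl F j y) :
    ∃ (k : J) (f : j ⟶ k), alg (F.map f) x = alg (F.map f) y := by
  -- The presented algebra maps to the colimit in `AlgCat ℂ`. Filtered colimits there are computed
  -- on underlying sets, so an equality in `L` is witnessed at a later stage.
  let L := colimit (algDiagram F)
  have hg {i j : J} (f : i ⟶ j) (a : F.obj i) : (colimit.ι (algDiagram F) j).hom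
      (alg (F.map f) a) = (colimit.ι (algDiagram F) i).hom a :=
    ConcreteCategory.congr_hom (colimit.w (algDiagram F) f) a
  let g : ColimAlg F →ₐ[ℂ] L :=
    ColimAlg.lift (fun j => (colimit.ι (algDiagram F) j).hom) fun _ _ f => hg f
  have h' := ((lift_incl _ (fun _ _ f => hg f) j x).symm.trans (congrArg g h)).trans
    (lift_incl _ _ j y)
  obtain ⟨k, f, f', e⟩ := Concrete.colimit_exists_of_rep_eq (algDiagram F) (i := j) (j := j) x y h'
  refine ⟨IsFiltered.coeq f f', f ≫ IsFiltered.coeqHom f f', ?_⟩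
  have e' : alg (F.map f) x = alg (F.map f') y := e
  rw [F.map_comp, alg_comp, e', ← alg_comp, ← F.map_comp, ← IsFiltered.coeq_condition, F.map_comp]

omit [IsFiltered J] in
theorem map_tensor_comp {i j k : J} (f : i ⟶ j) (g : j ⟶ k) (t : F.obj i ⊗[ℂ] F.obj i) :
    Algebra.TensorProduct.map (alg (F.map (f ≫ g))) (alg (F.map (f ≫ g))) t =
      Algebra.TensorProduct.map (alg (F.map g)) (alg (F.map g))
        (Algebra.TensorProduct.map (alg (F.map f)) (alg (F.map f)) t) := by
  have e : alg (F.map (f ≫ g)) = (alg (F.map g)).comp (alg (F.map f)) :=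
    AlgHom.ext fun a => by rw [F.map_comp, alg_comp]; rfl
  rw [e, Algebra.TensorProduct.map_comp, AlgHom.comp_apply]

variable {c : Cocone F} (hc : IsColimit c)
include hc

theorem exists_app_eq (a : c.pt) : ∃ j x, alg (c.ι.app j) x = a := by
  obtain ⟨j, x, hx⟩ := ColimAlg.exists_incl_eq (alg (hc.desc (colimCocone F)) a)
  refine ⟨j, x, ?_⟩
  -- An arbitrary colimit cocone is compared with the explicit one, where the claim is known.
  have e : hc.desc (colimCocone F) ≫ (isColimitColimCocone F).desc c = 𝟙 _ :=
    hc.hom_ext fun j => by simp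
  have h2 := congrArg (fun f => alg f a) e
  simp only [alg_comp, alg_id] at h2
  rw [← h2, ← (isColimitColimCocone F).fac c j, alg_comp]
  exact congrArg (alg ((isColimitColimCocone F).desc c)) hx

theorem exists_map_eq {j : J} {x y : F.obj j} (h : alg (c.ι.app j) x = alg (c.ι.app j) y) :
    ∃ (k : J) (f : j ⟶ k), alg (F.map f) x = alg (F.map f) y := by
  apply ColimAlg.exists_map_eq
  have h' := congrArg (alg (hc.desc (colimCocone F))) h
  rwa [← alg_comp, ← alg_comp, hc.fac] at h'

theorem exists_map_eq_zero {j : J} {x : F.obj j} (h : alg (c.ι.app j) x = 0) :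
    ∃ (k : J) (f : j ⟶ k), alg (F.map f) x = 0 := by
  obtain ⟨k, f, e⟩ := exists_map_eq hc (x := x) (y := 0) (by rw [h, map_zero])
  exact ⟨k, f, by rw [e, map_zero]⟩

/-- The tensor square of the filtered colimit is the colimit of the tensor squares. -/
theorem exists_map_tensor_eq_zero {j : J} {t : F.obj j ⊗[ℂ] F.obj j}
    (h : Algebra.TensorProduct.map (alg (c.ι.app j)) (alg (c.ι.app j)) t = 0) :
    ∃ (k : J) (f : j ⟶ k), Algebra.TensorProduct.map (alg (F.map f)) (alg (F.map f)) t = 0 := by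
  let p : F.obj j →ₗ[ℂ] c.pt := (alg (c.ι.app j)).toLinearMap
  have hp : TensorProduct.map p p t = 0 := h
  -- Over a field the tensor square of the range embeds in that of `c.pt`. This reduces to a
  -- surjective map, whose tensor square has an explicit kernel.
  have hr : TensorProduct.map p.rangeRestrict p.rangeRestrict t = 0 := by
    apply TensorProduct.map_injective_of_flat_flat p.range.subtype p.range.subtype
      Subtype.val_injective Subtype.val_injective
    rw [map_zero, ← LinearMap.comp_apply, ← TensorProduct.map_comp]
    exact hp
  have hex : Function.Exact p.ker.subtype p.rangeRestrict := by
    have := p.rangeRestrict.exact_subtype_ker_map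
    intro x
    simp [Subtype.ext_iff]
  -- The kernel of the tensor square of a surjection is generated by elementary tensors with one
  -- factor in the kernel, and such a factor vanishes at a later stage.
  have hk : t ∈ LinearMap.range (LinearMap.lTensor (F.obj j) p.ker.subtype) ⊔
      LinearMap.range (LinearMap.rTensor (F.obj j) p.ker.subtype) := by
    rw [← TensorProduct.map_ker hex p.surjective_rangeRestrict hex p.surjective_rangeRestrict]
    exact hr
  -- The tensors that die at some stage are closed under addition by filteredness, so elementary
  -- tensors suffice.
  let S : Set (F.obj j ⊗[ℂ] F.obj j) := {t | ∃ (k : J) (f : j ⟶ k),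
    Algebra.TensorProduct.map (alg (F.map f)) (alg (F.map f)) t = 0}
  have hadd {s t : F.obj j ⊗[ℂ] F.obj j} (hs : s ∈ S) (ht : t ∈ S) : s + t ∈ S := by
    obtain ⟨k, f, hf⟩ := exists_hom_forall_of_finite (ι := Bool)
      (P := fun i k f => Algebra.TensorProduct.map (alg (F.map f)) (alg (F.map f)) (cond i s t) = 0)
      (fun i k l f g h => by rw [map_tensor_comp, h, map_zero])
      (fun i => by cases i; exacts [ht, hs])
    exact ⟨k, f, by rw [map_add, show Algebra.TensorProduct.map _ _ s = 0 from hf true,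
      show Algebra.TensorProduct.map _ _ t = 0 from hf false, add_zero]⟩
  have h1 (s : F.obj j ⊗[ℂ] p.ker) : LinearMap.lTensor (F.obj j) p.ker.subtype s ∈ S := by
    induction s with
    | zero => exact ⟨j, 𝟙 j, by simp⟩
    | add x y hx hy => rw [map_add]; exact hadd hx hy
    | tmul x y =>
      obtain ⟨k, f, hf⟩ := exists_map_eq_zero hc (x := y.1) y.2
      exact ⟨k, f, by simp [hf]⟩
  have h2 (s : p.ker ⊗[ℂ] F.obj j) : LinearMap.rTensor (F.obj j) p.ker.subtype s ∈ S := by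
    induction s with
    | zero => exact ⟨j, 𝟙 j, by simp⟩
    | add x y hx hy => rw [map_add]; exact hadd hx hy
    | tmul x y =>
      obtain ⟨k, f, hf⟩ := exists_map_eq_zero hc (x := x.1) x.2
      exact ⟨k, f, by simp [hf]⟩
  obtain ⟨_, ⟨a, rfl⟩, _, ⟨b, rfl⟩, rfl⟩ := Submodule.mem_sup.1 hk
  exact hadd (h1 a) (h2 b)

theorem exists_map_tensor_eq {j : J} {s t : F.obj j ⊗[ℂ] F.obj j}
    (h : Algebra.TensorProduct.map (alg (c.ι.app j)) (alg (c.ι.app j)) s =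
      Algebra.TensorProduct.map (alg (c.ι.app j)) (alg (c.ι.app j)) t) :
    ∃ (k : J) (f : j ⟶ k), Algebra.TensorProduct.map (alg (F.map f)) (alg (F.map f)) s =
      Algebra.TensorProduct.map (alg (F.map f)) (alg (F.map f)) t := by
  obtain ⟨k, f, hf⟩ := exists_map_tensor_eq_zero hc (t := s - t) (by rw [map_sub, h, sub_self])
  exact ⟨k, f, by rwa [map_sub, sub_eq_zero] at hf⟩

end filtered

/-! ### Morphisms out of `A_u(Q)` -/

section Au

open AuAlgebra

variable {n : ℕ} {Q : PosMatrix n} {A B : CQG.{u}}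

theorem lift_star {v : Matrix (Fin n) (Fin n) A} (h : AuRelations Q v (v.map star))
    (a : AuAlgebra.{u} Q) : lift h (star a) = star (lift h a) := by
  induction a using AuAlgebra.induction with
  | std i j => simp
  | stdStar i j => simp
  | alg c => rw [star_algebraMap', AlgHom.commutes, AlgHom.commutes, algebraMap_star_comm]
  | add a b ha hb => simp only [map_add, star_add, ha, hb]
  | mul a b ha hb => simp only [map_mul, star_mul, ha, hb]

theorem lift_comul {v : Matrix (Fin n) (Fin n) A} (h : AuRelations Q v (v.map star))
    (hv : IsCoefficientMatrix v) (a : AuAlgebra.{u} Q) :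
    Coalgebra.comul (R := ℂ) (lift h a) =
      Algebra.TensorProduct.map (lift h) (lift h) (Coalgebra.comul (R := ℂ) a) := by
  refine AlgHom.congr_fun (AuAlgebra.algHom_ext
    (f := (Bialgebra.comulAlgHom ℂ A).comp (lift h))
    (g := (Algebra.TensorProduct.map (lift h) (lift h)).comp (Bialgebra.comulAlgHom ℂ _))
    (fun i j => ?_) (fun i j => ?_)) a
  · simp [comul_std, hv.comul_apply]
  · simp [comul_stdStar, IsHopfStarAlgebra.comul_star, hv.comul_apply, star_sum]

theorem lift_counit {v : Matrix (Fin n) (Fin n) A} (h : AuRelations Q v (v.map star))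
    (hv : IsCoefficientMatrix v) (a : AuAlgebra.{u} Q) :
    Coalgebra.counit (R := ℂ) (lift h a) = Coalgebra.counit (R := ℂ) a := by
  refine AlgHom.congr_fun (AuAlgebra.algHom_ext
    (f := (Bialgebra.counitAlgHom ℂ A).comp (lift h)) (g := Bialgebra.counitAlgHom ℂ _)
    (fun i j => ?_) (fun i j => ?_)) a
  · simp [counit_std, hv.counit_apply]
  · simp [counit_stdStar, IsHopfStarAlgebra.counit_star, hv.counit_apply, Matrix.one_apply]

/-- The morphism out of `A_u(Q)` given by a coefficient matrix satisfying the relations. -/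
noncomputable def auDesc (v : Matrix (Fin n) (Fin n) A) (h : AuRelations Q v (v.map star))
    (hv : IsCoefficientMatrix v) : Au.{u} Q ⟶ A :=
  homMk (A := Au Q) (lift h) (lift_star h) (lift_comul h hv) (lift_counit h hv)

/-- The image of the standard matrix under a morphism. -/
noncomputable def auMat (f : Au.{u} Q ⟶ A) : Matrix (Fin n) (Fin n) A :=
  Matrix.map (std Q) fun a => alg f a

theorem auMat_auDesc (v : Matrix (Fin n) (Fin n) A) (h : AuRelations Q v (v.map star))
    (hv : IsCoefficientMatrix v) : auMat (auDesc v h hv) = v := by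
  ext i j
  exact lift_std h i j

theorem auMat_comp (f : Au.{u} Q ⟶ A) (g : A ⟶ B) : auMat (f ≫ g) = (auMat f).map (alg g) := rfl

theorem auMat_star (f : Au.{u} Q ⟶ A) :
    (auMat f).map star = Matrix.map (stdStar Q) fun a => alg f a := by
  ext i j
  exact (alg_star f (std Q i j)).symm.trans (congrArg (alg f) (star_std Q i j))

theorem auMat_relations (f : Au.{u} Q ⟶ A) : AuRelations Q (auMat f) ((auMat f).map star) := by
  rw [auMat_star]
  exact (std_relations Q).map (alg f)

theorem auMat_isCoefficientMatrix (f : Au.{u} Q ⟶ A) : IsCoefficientMatrix (auMat f) :=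
  isCoefficientMatrix_map f (std_isCoefficientMatrix Q)

theorem auMat_mem_unitary (f : Au.{u} Q ⟶ A) : auMat f ∈ unitary (Matrix (Fin n) (Fin n) A) :=
  map_mem_unitary f (std_mem_unitary Q)

/-- Morphisms preserve the involution, so the images of the entries of `u` determine those of their
adjoints, and together these generate. -/
theorem au_hom_ext {f g : Au.{u} Q ⟶ A} (h : auMat f = auMat g) : f = g := by
  have h' : (auMat f).map star = (auMat g).map star := by rw [h]
  rw [auMat_star, auMat_star] at h'
  exact hom_ext fun a => AlgHom.congr_fun (AuAlgebra.algHom_ext (f := alg f) (g := alg g)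
    (fun i j => congrFun (congrFun h i) j) (fun i j => congrFun (congrFun h' i) j)) a

/-- The relations are four matrix identities, hence finitely many equations between elements. Each
holds at some later stage, and filteredness makes them hold together. -/
theorem AuRelations.exists_map {J : Type u} [SmallCategory J] [IsFiltered J] {F : J ⥤ CQG.{u}}
    {c : Cocone F} (hc : IsColimit c) {j : J} {v w : Matrix (Fin n) (Fin n) (F.obj j)}
    (h : AuRelations Q (v.map (alg (c.ι.app j))) (w.map (alg (c.ι.app j)))) :
    ∃ (k : J) (f : j ⟶ k), AuRelations Q (v.map (alg (F.map f))) (w.map (alg (F.map f))) := by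
  have key (x : Matrix (Fin n) (Fin n) (F.obj j)) (hx : x.map (alg (c.ι.app j)) = 1) :
      ∃ (k : J) (f : j ⟶ k), x.map (alg (F.map f)) = 1 := by
    obtain ⟨k, f, hf⟩ := exists_hom_forall_of_finite (ι := Fin n × Fin n)
      (P := fun i k f => alg (F.map f) (x i.1 i.2) =
        alg (F.map f) ((1 : Matrix (Fin n) (Fin n) (F.obj j)) i.1 i.2))
      (fun i k l f g h => by rw [F.map_comp, alg_comp, alg_comp, h])
      (fun i => exists_map_eq hc (by
        have := congrFun (congrFun hx i.1) i.2
        rw [Matrix.map_apply] at this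
        rw [this, Matrix.one_apply, Matrix.one_apply]
        split_ifs <;> simp))
    refine ⟨k, f, ?_⟩
    ext a b
    rw [Matrix.map_apply, hf (a, b), Matrix.one_apply, Matrix.one_apply]
    split_ifs <;> simp
  let x : Fin 4 → Matrix (Fin n) (Fin n) (F.obj j) :=
    ![v * w.transpose, w.transpose * v, twist Q w * twistAdj Q v, twistAdj Q v * twist Q w]
  obtain ⟨k, f, hf⟩ := exists_hom_forall_of_finite (ι := Fin 4)
    (P := fun i k f => (x i).map (alg (F.map f)) = 1)
    (fun i k l f g h => by
      have e : (x i).map (alg (F.map (f ≫ g))) = ((x i).map (alg (F.map f))).map (alg (F.map g)) := by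
        ext a b; simp
      rw [e, h]
      simp)
    (fun i => key _ (by
      fin_cases i
      · simpa [x, Matrix.map_mul, Matrix.transpose_map] using h.mul_adjoint
      · simpa [x, Matrix.map_mul, Matrix.transpose_map] using h.adjoint_mul
      · simpa [x, Matrix.map_mul, twist_map, twistAdj_map] using h.twist_mul_adjoint
      · simpa [x, Matrix.map_mul, twist_map, twistAdj_map] using h.adjoint_mul_twist))
  refine ⟨k, f, ?_, ?_, ?_, ?_⟩
  · simpa [x, Matrix.map_mul, Matrix.transpose_map] using hf 0
  · simpa [x, Matrix.map_mul, Matrix.transpose_map] using hf 1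
  · simpa [x, Matrix.map_mul, twist_map, twistAdj_map] using hf 2
  · simpa [x, Matrix.map_mul, twist_map, twistAdj_map] using hf 3

/-- The comultiplication rule is a finite set of equations in a tensor square, which is where
`exists_map_tensor_eq` enters. The counit rule already holds at the initial stage, since morphisms
preserve the counit. -/
theorem isCoefficientMatrix_exists_map {J : Type u} [SmallCategory J] [IsFiltered J]
    {F : J ⥤ CQG.{u}} {c : Cocone F} (hc : IsColimit c) {j : J}
    {v : Matrix (Fin n) (Fin n) (F.obj j)} (h : IsCoefficientMatrix (v.map (alg (c.ι.app j)))) :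
    ∃ (k : J) (f : j ⟶ k), IsCoefficientMatrix (v.map (alg (F.map f))) := by
  obtain ⟨k, f, hf⟩ := exists_hom_forall_of_finite (ι := Fin n × Fin n)
    (P := fun i k f => Algebra.TensorProduct.map (alg (F.map f)) (alg (F.map f))
        (Coalgebra.comul (R := ℂ) (v i.1 i.2)) =
      Algebra.TensorProduct.map (alg (F.map f)) (alg (F.map f))
        (∑ k, v i.1 k ⊗ₜ[ℂ] v k i.2))
    (fun i k l f g h => by rw [map_tensor_comp, map_tensor_comp, h])
    (fun i => exists_map_tensor_eq hc (by
      rw [← comul_alg]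
      simpa using h.comul_apply i.1 i.2))
  refine ⟨k, f, fun a b => ?_, fun a b => ?_⟩
  · rw [Matrix.map_apply, comul_alg, hf (a, b)]
    simp
  · rw [Matrix.map_apply, counit_alg, ← counit_alg (c.ι.app j)]
    exact h.counit_apply a b

theorem auMat_lift {J : Type u} [SmallCategory J] [IsFiltered J] {F : J ⥤ CQG.{u}}
    {c : Cocone F} (hc : IsColimit c) (v : Matrix (Fin n) (Fin n) c.pt) :
    ∃ (j : J) (x : Matrix (Fin n) (Fin n) (F.obj j)), x.map (alg (c.ι.app j)) = v := by
  choose j x hx using fun i : Fin n × Fin n => exists_app_eq hc (v i.1 i.2)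
  classical
  let s := Finset.univ.image j
  obtain ⟨k, hk⟩ := IsFiltered.sup_objs_exists s
  have f (i) : Nonempty (j i ⟶ k) := hk (Finset.mem_image_of_mem j (Finset.mem_univ i))
  refine ⟨k, Matrix.of fun a b => alg (F.map (f (a, b)).some) (x (a, b)), ?_⟩
  ext a b
  rw [Matrix.map_apply, Matrix.of_apply, ← alg_comp, c.w]
  exact hx (a, b)

/-- Every morphism from `A_u(Q)` to a filtered colimit factors through some stage. -/
theorem au_exists_hom {J : Type u} [SmallCategory J] [IsFiltered J] {F : J ⥤ CQG.{u}}
    {c : Cocone F} (hc : IsColimit c) (f : Au.{u} Q ⟶ c.pt) :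
    ∃ (j : J) (g : Au.{u} Q ⟶ F.obj j), g ≫ c.ι.app j = f := by
  have mapcomp {i j : J} {X : CQG.{u}} (f : F.obj i ⟶ F.obj j) (g : F.obj j ⟶ X)
      (v : Matrix (Fin n) (Fin n) (F.obj i)) :
      (v.map (alg f)).map (alg g) = v.map (alg (f ≫ g)) := rfl
  have mapstar {A B : CQG.{u}} (f : A ⟶ B) (v : Matrix (Fin n) (Fin n) A) :
      (v.map (alg f)).map star = (v.map star).map (alg f) := by
    ext a b; simp [alg_star]
  obtain ⟨j, x, hx⟩ := auMat_lift hc (auMat f)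
  have h1 := auMat_relations f
  rw [← hx, mapstar] at h1
  obtain ⟨k, p, hp⟩ := AuRelations.exists_map hc h1
  have h2 := auMat_isCoefficientMatrix f
  rw [← hx, ← c.w p, ← mapcomp] at h2
  obtain ⟨l, q, hq⟩ := isCoefficientMatrix_exists_map hc h2
  have h3 := hp.map (alg (F.map q))
  rw [← mapstar, ← mapstar] at h3
  refine ⟨l, auDesc _ h3 hq, au_hom_ext ?_⟩
  rw [auMat_comp, auMat_auDesc, ← hx, mapcomp, mapcomp, c.w, c.w]

/-- Morphisms from `A_u(Q)` that agree in a filtered colimit agree at some stage. -/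
theorem au_exists_eq {J : Type u} [SmallCategory J] [IsFiltered J] {F : J ⥤ CQG.{u}}
    {c : Cocone F} (hc : IsColimit c) {j : J} {f g : Au.{u} Q ⟶ F.obj j}
    (h : f ≫ c.ι.app j = g ≫ c.ι.app j) : ∃ (k : J) (p : j ⟶ k), f ≫ F.map p = g ≫ F.map p := by
  obtain ⟨k, p, hp⟩ := exists_hom_forall_of_finite (ι := Fin n × Fin n)
    (P := fun i k p => alg (F.map p) (auMat f i.1 i.2) = alg (F.map p) (auMat g i.1 i.2))
    (fun i k l f g h => by rw [F.map_comp, alg_comp, alg_comp, h])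
    (fun i => exists_map_eq hc (congrFun (congrFun (congrArg auMat h) i.1) i.2))
  exact ⟨k, p, au_hom_ext (by ext a b; exact hp (a, b))⟩

variable (Q) in
-- For a filtered diagram, bijectivity of the comparison map means that morphisms into the colimit
-- lift to a stage (`au_exists_hom`) and that morphisms equal in the colimit become equal at a stage
-- (`au_exists_eq`).
theorem isFinitelyPresentable_au : IsFinitelyPresentable.{u} (Au.{u} Q) := by
  rw [isFinitelyPresentable_iff_preservesFilteredColimits]
  refine ⟨fun J _ _ => ⟨fun {F} => ⟨fun {c} hc => ⟨?_⟩⟩⟩⟩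
  refine Types.FilteredColimit.isColimitOf' _ _ (fun f => ?_) (fun j f g h => ?_)
  · obtain ⟨j, g, hg⟩ := au_exists_hom hc f
    exact ⟨j, g, hg.symm⟩
  · exact au_exists_eq hc h

end Au

end CQG

namespace QuantumGroup

open scoped TensorProduct ComplexOrder MatrixOrder
open Matrix

/-! ### Unitarizability of comodules -/

section frame

variable {κ : Type*} [Fintype κ] [DecidableEq κ]

/-- A space of matrices has an orthonormal basis for the trace inner product. -/
theorem exists_frame (B : Submodule ℂ (Matrix κ κ ℂ)) :
    ∃ (m : ℕ) (W : Fin m → Matrix κ κ ℂ), (∀ α, W α ∈ B) ∧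
      ∀ X ∈ B, X = ∑ α, ((W α)ᴴ * X).trace • W α := by
  -- With the identity as weight, this is the norm of the trace inner product.
  let _ : NormedAddCommGroup (Matrix κ κ ℂ) := toMatrixNormedAddCommGroup 1 PosDef.one
  let _ : InnerProductSpace ℂ (Matrix κ κ ℂ) := toMatrixInnerProductSpace 1 PosSemidef.one
  let b := stdOrthonormalBasis ℂ B
  refine ⟨_, fun α => b α, fun α => (b α).2, fun X hX => ?_⟩
  have h := congrArg Subtype.val (b.sum_repr' ⟨X, hX⟩)
  rw [AddSubmonoidClass.coe_finsetSum] at h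
  refine h.symm.trans (Finset.sum_congr rfl fun α _ => ?_)
  rw [trace_mul_comm]
  change (X * 1 * (b α : Matrix κ κ ℂ)ᴴ).trace • (b α : Matrix κ κ ℂ) = _
  rw [mul_one]

end frame

section unitarize

variable {H : Type*} [Ring H] [HopfAlgebra ℂ H] {ι κ : Type*} [Fintype ι] [DecidableEq ι]
  [Fintype κ] [DecidableEq κ]

/-- The convolution product of linear functionals. -/
noncomputable def conv (ψ φ : H →ₗ[ℂ] ℂ) : H →ₗ[ℂ] ℂ :=
  LinearMap.mul' ℂ ℂ ∘ₗ TensorProduct.map ψ φ ∘ₗ Coalgebra.comul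

/-- The comultiplication of a coefficient matrix is matrix multiplication, so its evaluations at
functionals are closed under products. -/
theorem IsCoefficientMatrix.map_conv {x : Matrix ι ι H} (hx : IsCoefficientMatrix x)
    (ψ φ : H →ₗ[ℂ] ℂ) : x.map (conv ψ φ) = x.map ψ * x.map φ := by
  ext i j
  simp [conv, hx.comul_apply, Matrix.mul_apply]

/-- The space of all matrices `φ(x)`, for linear functionals `φ`. -/
noncomputable def functionalRange (x : Matrix ι ι H) : Submodule ℂ (Matrix ι ι ℂ) :=
  LinearMap.range
    ({ toFun := fun φ => x.map φ
       map_add' := fun _ _ => rfl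
       map_smul' := fun _ _ => rfl } : (H →ₗ[ℂ] ℂ) →ₗ[ℂ] Matrix ι ι ℂ)

omit [Fintype ι] [DecidableEq ι] in
theorem mem_functionalRange {x : Matrix ι ι H} {X : Matrix ι ι ℂ} :
    X ∈ functionalRange x ↔ ∃ φ : H →ₗ[ℂ] ℂ, x.map φ = X := Iff.rfl

variable [StarRing H] [StarModule ℂ H]

/-- The adjoint functional `a ↦ conj (φ (S(a)*))`. -/
noncomputable def functionalStar (φ : H →ₗ[ℂ] ℂ) : H →ₗ[ℂ] ℂ where
  toFun a := star (φ (star (HopfAlgebraStruct.antipode ℂ a)))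
  map_add' a b := by simp
  map_smul' c a := by simp

omit [Fintype ι] [DecidableEq ι] in
theorem conjTranspose_map_functionalStar (x : Matrix ι ι H) (φ : H →ₗ[ℂ] ℂ) :
    (x.map (functionalStar φ))ᴴ = (star (x.map (HopfAlgebraStruct.antipode ℂ))).map φ := by
  ext i j
  simp [functionalStar, Matrix.star_apply]

/-- For unitary `x` the antipode is the adjoint, so the evaluations are closed under adjoints.
Together with `IsCoefficientMatrix.map_conv` this makes `functionalRange x` a matrix `*`-algebra. -/
theorem map_functionalStar {x : Matrix ι ι H} (hx : IsCoefficientMatrix x)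
    (hx' : x ∈ unitary (Matrix ι ι H)) (φ : H →ₗ[ℂ] ℂ) :
    x.map (functionalStar φ) = (x.map φ)ᴴ := by
  ext i j
  simp [functionalStar, hx.antipode_apply hx']

omit [HopfAlgebra ℂ H] [StarRing H] [StarModule ℂ H] [Fintype ι] [DecidableEq ι] in
theorem matrix_ext_functional [Module ℂ H] {x y : Matrix ι ι H}
    (h : ∀ φ : H →ₗ[ℂ] ℂ, x.map φ = y.map φ) : x = y := by
  ext i j
  rw [← sub_eq_zero, ← Module.forall_dual_apply_eq_zero_iff ℂ]
  intro φ
  rw [map_sub, sub_eq_zero]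
  exact congrFun (congrFun (h φ) i) j

omit [HopfAlgebra ℂ H] [StarRing H] [StarModule ℂ H] [DecidableEq ι] in
theorem map_mul_scalar [Algebra ℂ H] (x : Matrix ι ι H) (M : Matrix ι ι ℂ) (φ : H →ₗ[ℂ] ℂ) :
    (x * M.map (algebraMap ℂ H)).map φ = x.map φ * M := by
  ext i j
  simp [Matrix.mul_apply, ← Algebra.commutes, ← Algebra.smul_def, mul_comm]

omit [HopfAlgebra ℂ H] [StarRing H] [StarModule ℂ H] [DecidableEq ι] in
theorem map_scalar_mul [Algebra ℂ H] (x : Matrix ι ι H) (M : Matrix ι ι ℂ) (φ : H →ₗ[ℂ] ℂ) :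
    (M.map (algebraMap ℂ H) * x).map φ = M * x.map φ := by
  ext i j
  simp [Matrix.mul_apply, ← Algebra.smul_def]

/-- A comodule whose coefficients are linear combinations of those of a unitary comodule is
unitarizable. -/
theorem exists_posDef_of_mem_span {v : Matrix ι ι H} {w : Matrix κ κ H}
    (hv : IsCoefficientMatrix v) (hw : IsCoefficientMatrix w) (hw' : w ∈ unitary (Matrix κ κ H))
    (h : ∀ i j, v i j ∈ Submodule.span ℂ (Set.range fun p : κ × κ => w p.1 p.2)) :
    ∃ R : Matrix ι ι ℂ, R.PosDef ∧
      v * R.map (algebraMap ℂ H) * star v = R.map (algebraMap ℂ H) ∧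
      star v * R⁻¹.map (algebraMap ℂ H) * v = R⁻¹.map (algebraMap ℂ H) := by
  obtain ⟨m, W, hW, hW'⟩ := exists_frame (functionalRange w)
  choose φ hφ using fun α => mem_functionalRange.1 (hW α)
  -- Expanding `χ(w)` in the orthonormal basis shows that `χ` agrees with a combination of the `φ β`
  -- on the coefficients of `w`, hence on those of `v`.
  have key (χ : H →ₗ[ℂ] ℂ) : v.map χ = ∑ β, ((W β)ᴴ * w.map χ).trace • v.map (φ β) := by
    have e := hW' _ (mem_functionalRange.2 ⟨χ, rfl⟩)
    have e' : Set.EqOn χ (∑ β, ((W β)ᴴ * w.map χ).trace • φ β : H →ₗ[ℂ] ℂ)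
        (Submodule.span ℂ (Set.range fun p : κ × κ => w p.1 p.2)) := by
      apply LinearMap.eqOn_span
      rintro _ ⟨p, rfl⟩
      have := congrFun (congrFun e p.1) p.2
      simp only [← hφ, Matrix.sum_apply, Matrix.smul_apply, Matrix.map_apply] at this
      simpa [← hφ, LinearMap.sum_apply] using this
    ext i j
    simpa [LinearMap.sum_apply, Matrix.sum_apply] using e' (h i j)
  -- The invariant form is an average of the standard one over an orthonormal basis of the
  -- evaluations of `w`; no Haar state is needed.
  obtain ⟨R, hR⟩ : ∃ R, R = ∑ α, v.map (φ α) * (v.map (φ α))ᴴ := ⟨_, rfl⟩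
  -- The counit evaluates `v` to the identity. A vector killed by every adjoint of `φ α (v)` is
  -- therefore zero, which makes `R` definite.
  have hone : (1 : Matrix ι ι ℂ) ∈ Submodule.span ℂ (Set.range fun α => v.map (φ α)) := by
    have e : v.map (Coalgebra.counit (R := ℂ) (A := H)) = 1 := by
      ext i j
      exact hv.counit_apply i j
    rw [← e, key]
    exact Submodule.sum_mem _ fun β _ => Submodule.smul_mem _ _ (Submodule.subset_span ⟨β, rfl⟩)
  have hpos : R.PosDef := by
    have hsemi : R.PosSemidef := by
      rw [hR]
      exact posSemidef_sum _ fun α _ => posSemidef_self_mul_conjTranspose _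
    refine posDef_iff_dotProduct_mulVec.2 ⟨hsemi.1, fun x hx => ?_⟩
    have hsum : star x ⬝ᵥ (R *ᵥ x) =
        ∑ α, star ((v.map (φ α))ᴴ *ᵥ x) ⬝ᵥ ((v.map (φ α))ᴴ *ᵥ x) := by
      rw [hR, sum_mulVec, dotProduct_sum]
      refine Finset.sum_congr rfl fun α _ => ?_
      rw [star_mulVec, conjTranspose_conjTranspose, ← mulVec_mulVec, dotProduct_mulVec]
    rw [hsum]
    refine lt_of_le_of_ne (Finset.sum_nonneg fun α _ => dotProduct_star_self_nonneg _) fun h0 => hx ?_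
    rw [eq_comm, Finset.sum_eq_zero_iff_of_nonneg fun α _ => dotProduct_star_self_nonneg _] at h0
    have h1 (α) : (v.map (φ α))ᴴ *ᵥ x = 0 := dotProduct_star_self_eq_zero.1 (h0 α (Finset.mem_univ α))
    have h2 : ∀ M ∈ Submodule.span ℂ (Set.range fun α => v.map (φ α)), Mᴴ *ᵥ x = 0 := by
      intro M hM
      induction hM using Submodule.span_induction with
      | mem M hM => obtain ⟨α, rfl⟩ := hM; exact h1 α
      | zero => simp
      | add M N _ _ hM hN => rw [conjTranspose_add, add_mulVec, hM, hN, add_zero]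
      | smul c M _ hM => rw [conjTranspose_smul, smul_mulVec, hM, smul_zero]
    simpa using h2 1 hone
  -- Left multiplication by `ψ(w)` and by its adjoint have mutually adjoint matrices in the
  -- orthonormal basis. Both sides therefore become the same double sum with its indices exchanged.
  have hcomm (ψ : H →ₗ[ℂ] ℂ) : v.map ψ * R = R * (v.map (functionalStar ψ))ᴴ := by
    have h1 (α) : v.map ψ * v.map (φ α) =
        ∑ β, ((W β)ᴴ * (w.map ψ * W α)).trace • v.map (φ β) := by
      rw [← hv.map_conv, key, hw.map_conv, hφ]
    have h2 (β) : v.map (functionalStar ψ) * v.map (φ β) =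
        ∑ α, ((W α)ᴴ * ((w.map ψ)ᴴ * W β)).trace • v.map (φ α) := by
      rw [← hv.map_conv, key, hw.map_conv, hφ, map_functionalStar hw hw']
    have h3 (β) : (v.map (φ β))ᴴ * (v.map (functionalStar ψ))ᴴ =
        ∑ α, ((W β)ᴴ * (w.map ψ * W α)).trace • (v.map (φ α))ᴴ := by
      rw [← conjTranspose_mul, h2, conjTranspose_sum]
      refine Finset.sum_congr rfl fun α _ => ?_
      rw [conjTranspose_smul, ← trace_conjTranspose]
      simp only [conjTranspose_mul, conjTranspose_conjTranspose, mul_assoc]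
    rw [hR, Finset.mul_sum, Finset.sum_mul]
    simp only [mul_assoc, h3]
    simp only [← mul_assoc, h1, Finset.sum_mul, Finset.mul_sum, smul_mul_assoc, mul_smul_comm]
    exact Finset.sum_comm
  -- Functionals separate points, so the identities `hcomm` assemble into one over `H`. The matrix
  -- `S(v)*` is inverse to `v*`, which turns it into invariance of `R`.
  have hmat : v * R.map (algebraMap ℂ H) = R.map (algebraMap ℂ H) *
      star (v.map (HopfAlgebraStruct.antipode ℂ)) := by
    apply matrix_ext_functional
    intro ψ
    rw [map_mul_scalar, map_scalar_mul, hcomm, conjTranspose_map_functionalStar]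
  have hu : IsUnit R.det := (Matrix.isUnit_iff_isUnit_det _).1 hpos.isUnit
  have e1 : star (v.map (HopfAlgebraStruct.antipode ℂ)) * star v = 1 := by
    rw [← star_mul, hv.mul_antipode, star_one]
  have e2 : star v * star (v.map (HopfAlgebraStruct.antipode ℂ)) = 1 := by
    rw [← star_mul, hv.antipode_mul, star_one]
  have e3 : R.map (algebraMap ℂ H) * R⁻¹.map (algebraMap ℂ H) = 1 := by
    rw [← Matrix.map_mul, mul_nonsing_inv _ hu]; simp
  have e4 : R⁻¹.map (algebraMap ℂ H) * R.map (algebraMap ℂ H) = 1 := by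
    rw [← Matrix.map_mul, nonsing_inv_mul _ hu]; simp
  refine ⟨R, hpos, ?_, ?_⟩
  · rw [hmat, mul_assoc, e1, mul_one]
  · calc _ = star v * R⁻¹.map (algebraMap ℂ H) * (v * R.map (algebraMap ℂ H)) *
          R⁻¹.map (algebraMap ℂ H) := by rw [mul_assoc _ (v * _), mul_assoc v, e3, mul_one]
      _ = star v * ((R⁻¹.map (algebraMap ℂ H) * R.map (algebraMap ℂ H)) *
          star (v.map (HopfAlgebraStruct.antipode ℂ))) * R⁻¹.map (algebraMap ℂ H) := by
        rw [hmat]; simp only [mul_assoc]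
      _ = _ := by rw [e4, one_mul, e2, one_mul]

end unitarize

end QuantumGroup

namespace QuantumGroup

open scoped TensorProduct ComplexOrder MatrixOrder
open Matrix

/-! ### Direct sums and relabelling of comodules -/

section directSum

variable {H : Type*} [Ring H] [HopfAlgebra ℂ H] {ι κ : Type*} [Fintype ι] [DecidableEq ι]
  [Fintype κ] [DecidableEq κ]

theorem IsCoefficientMatrix.fromBlocks {x : Matrix ι ι H} {y : Matrix κ κ H}
    (hx : IsCoefficientMatrix x) (hy : IsCoefficientMatrix y) :
    IsCoefficientMatrix (Matrix.fromBlocks x 0 0 y) where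
  comul_apply i j := by
    rcases i with i | i <;> rcases j with j | j <;> simp [hx.comul_apply, hy.comul_apply]
  counit_apply i j := by
    rcases i with i | i <;> rcases j with j | j <;>
      simp [hx.counit_apply, hy.counit_apply, Matrix.one_apply]

theorem IsCoefficientMatrix.submatrix {x : Matrix ι ι H} (hx : IsCoefficientMatrix x) (e : κ ≃ ι) :
    IsCoefficientMatrix (x.submatrix e e) where
  comul_apply i j := by
    rw [submatrix_apply, hx.comul_apply, ← e.sum_comp]
    rfl
  counit_apply i j := by
    rw [submatrix_apply, hx.counit_apply]
    simp [Matrix.one_apply]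

theorem fromBlocks_mem_unitary {R : Type*} [Ring R] [StarRing R] {x : Matrix ι ι R}
    {y : Matrix κ κ R} (hx : x ∈ unitary (Matrix ι ι R)) (hy : y ∈ unitary (Matrix κ κ R)) :
    fromBlocks x 0 0 y ∈ unitary (Matrix (ι ⊕ κ) (ι ⊕ κ) R) := by
  rw [Unitary.mem_iff] at hx hy ⊢
  simp only [star_eq_conjTranspose] at hx hy ⊢
  simp [fromBlocks_conjTranspose, fromBlocks_multiply, hx, hy]

theorem submatrix_mem_unitary {R : Type*} [Ring R] [StarRing R] {x : Matrix ι ι R}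
    (hx : x ∈ unitary (Matrix ι ι R)) (e : κ ≃ ι) :
    x.submatrix e e ∈ unitary (Matrix κ κ R) := by
  rw [Unitary.mem_iff] at hx ⊢
  simp only [star_eq_conjTranspose, conjTranspose_submatrix, submatrix_mul_equiv] at hx ⊢
  simp [hx.1, hx.2]

end directSum

section span

variable {H : Type*} [Ring H] [HopfAlgebra ℂ H] [StarRing H]

/-- The span of the entries of a matrix. -/
def entrySpan {m : ℕ} (w : Matrix (Fin m) (Fin m) H) : Submodule ℂ H :=
  Submodule.span ℂ (Set.range fun p : Fin m × Fin m => w p.1 p.2)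

omit [StarRing H] in
theorem entry_mem_entrySpan {m : ℕ} (w : Matrix (Fin m) (Fin m) H) (i j : Fin m) :
    w i j ∈ entrySpan w := Submodule.subset_span ⟨(i, j), rfl⟩

/-- Direct sums of unitary comodules. -/
theorem exists_entrySpan_ge {m n : ℕ} {x : Matrix (Fin m) (Fin m) H} {y : Matrix (Fin n) (Fin n) H}
    (hx : IsCoefficientMatrix x) (hx' : x ∈ unitary (Matrix (Fin m) (Fin m) H))
    (hy : IsCoefficientMatrix y) (hy' : y ∈ unitary (Matrix (Fin n) (Fin n) H)) :
    ∃ (k : ℕ) (w : Matrix (Fin k) (Fin k) H), IsCoefficientMatrix w ∧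
      w ∈ unitary (Matrix (Fin k) (Fin k) H) ∧ entrySpan x ≤ entrySpan w ∧
      entrySpan y ≤ entrySpan w := by
  refine ⟨m + n, (fromBlocks x 0 0 y).submatrix finSumFinEquiv.symm finSumFinEquiv.symm,
    (hx.fromBlocks hy).submatrix _, submatrix_mem_unitary (fromBlocks_mem_unitary hx' hy') _,
    ?_, ?_⟩
  · refine Submodule.span_le.2 ?_
    rintro _ ⟨p, rfl⟩
    refine Submodule.subset_span ⟨(finSumFinEquiv (.inl p.1), finSumFinEquiv (.inl p.2)), ?_⟩
    simp
  · refine Submodule.span_le.2 ?_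
    rintro _ ⟨p, rfl⟩
    refine Submodule.subset_span ⟨(finSumFinEquiv (.inr p.1), finSumFinEquiv (.inr p.2)), ?_⟩
    simp

/-- Finitely many elements of the span of the unitary coefficients are linear combinations of the
coefficients of a single unitary comodule. -/
theorem exists_mem_entrySpan (hH : Submodule.span ℂ (unitaryCoefficients H) = ⊤) (s : Finset H) :
    ∃ (k : ℕ) (w : Matrix (Fin k) (Fin k) H), IsCoefficientMatrix w ∧
      w ∈ unitary (Matrix (Fin k) (Fin k) H) ∧ ∀ a ∈ s, a ∈ entrySpan w := by
  classical
  have single (a : H) : ∃ (k : ℕ) (w : Matrix (Fin k) (Fin k) H), IsCoefficientMatrix w ∧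
      w ∈ unitary (Matrix (Fin k) (Fin k) H) ∧ a ∈ entrySpan w := by
    have ha : a ∈ Submodule.span ℂ (unitaryCoefficients H) := by rw [hH]; trivial
    induction ha using Submodule.span_induction with
    | mem a ha =>
      obtain ⟨n, x, hx, hx', i, j, rfl⟩ := ha
      exact ⟨n, x, hx, hx', entry_mem_entrySpan x i j⟩
    | zero => exact ⟨0, 1, ⟨fun i => i.elim0, fun i => i.elim0⟩, one_mem _, Submodule.zero_mem _⟩
    | add a b _ _ ha hb =>
      obtain ⟨m, x, hx, hx', hxa⟩ := ha
      obtain ⟨n, y, hy, hy', hyb⟩ := hb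
      obtain ⟨k, w, hw, hw', h1, h2⟩ := exists_entrySpan_ge hx hx' hy hy'
      exact ⟨k, w, hw, hw', Submodule.add_mem _ (h1 hxa) (h2 hyb)⟩
    | smul c a _ ha =>
      obtain ⟨m, x, hx, hx', hxa⟩ := ha
      exact ⟨m, x, hx, hx', Submodule.smul_mem _ _ hxa⟩
  induction s using Finset.induction_on with
  | empty =>
    obtain ⟨k, w, hw, hw', -⟩ := single 0
    exact ⟨k, w, hw, hw', by simp⟩
  | insert a s _ ih =>
    obtain ⟨m, x, hx, hx', hxa⟩ := single a
    obtain ⟨n, y, hy, hy', hyb⟩ := ih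
    obtain ⟨k, w, hw, hw', h1, h2⟩ := exists_entrySpan_ge hx hx' hy hy'
    refine ⟨k, w, hw, hw', fun b hb => ?_⟩
    rcases Finset.mem_insert.1 hb with rfl | hb
    · exact h1 hxa
    · exact h2 (hyb b hb)

end span

/-! ### Comodules unitary for a twisted inner product -/

section compatible

variable {H : Type*} [Ring H] [HopfAlgebra ℂ H] [StarRing H] {ι κ : Type*} [Fintype ι]
  [DecidableEq ι] [Fintype κ] [DecidableEq κ]

/-- A coefficient matrix `b` is compatible with a matrix `R` if `b̄` is unitary and `b` is unitary for
the inner product given by `R`. -/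
structure IsCompatible (R : Matrix ι ι ℂ) (b : Matrix ι ι H) : Prop where
  coef : IsCoefficientMatrix b
  bar_mem_unitary : b.map star ∈ unitary (Matrix ι ι H)
  mul_inv_mul_star : b * R⁻¹.map (algebraMap ℂ H) * star b = R⁻¹.map (algebraMap ℂ H)
  star_mul_mul : star b * R.map (algebraMap ℂ H) * b = R.map (algebraMap ℂ H)

omit [HopfAlgebra ℂ H] [Fintype ι] [DecidableEq ι] in
theorem map_star_map_star (x : Matrix ι ι H) : (x.map star).map star = x := by
  ext i j; simp

theorem IsCoefficientMatrix.map_star [StarModule ℂ H] [IsHopfStarAlgebra H] {x : Matrix ι ι H}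
    (hx : IsCoefficientMatrix x) : IsCoefficientMatrix (x.map star) where
  comul_apply i j := by
    simp [IsHopfStarAlgebra.comul_star, hx.comul_apply, star_sum]
  counit_apply i j := by
    simp [IsHopfStarAlgebra.counit_star, hx.counit_apply, Matrix.one_apply]

/-- The conjugate of a unitary comodule is a comodule with finitely many coefficients. These lie in
the span of the coefficients of one unitary comodule, so the conjugate is unitarizable. -/
theorem exists_isCompatible [StarModule ℂ H] [IsHopfStarAlgebra H]
    (hH : Submodule.span ℂ (unitaryCoefficients H) = ⊤) {x : Matrix ι ι H}
    (hx : IsCoefficientMatrix x) (hx' : x ∈ unitary (Matrix ι ι H)) :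
    ∃ R : Matrix ι ι ℂ, R.PosDef ∧ IsCompatible R (x.map star) := by
  classical
  obtain ⟨k, w, hw, hw', h⟩ := exists_mem_entrySpan hH
    (Finset.univ.image fun p : ι × ι => (x.map star) p.1 p.2)
  obtain ⟨R, hR, h1, h2⟩ := exists_posDef_of_mem_span hx.map_star hw hw' fun i j =>
    h _ (Finset.mem_image_of_mem _ (Finset.mem_univ (i, j)))
  -- The inverse appears because `IsCompatible` puts the inverse matrix between `b` and `b*`, where
  -- unitarization puts the matrix itself.
  refine ⟨R⁻¹, hR.inv, hx.map_star, by rwa [map_star_map_star], ?_, h2⟩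
  rwa [nonsing_inv_nonsing_inv _ ((Matrix.isUnit_iff_isUnit_det _).1 hR.isUnit)]

theorem IsCompatible.submatrix {R : Matrix ι ι ℂ} {b : Matrix ι ι H} (h : IsCompatible R b)
    (e : κ ≃ ι) : IsCompatible (R.submatrix e e) (b.submatrix e e) where
  coef := h.coef.submatrix e
  bar_mem_unitary := submatrix_mem_unitary h.bar_mem_unitary e
  mul_inv_mul_star := by
    rw [inv_submatrix_equiv, ← submatrix_map, star_eq_conjTranspose, conjTranspose_submatrix,
      submatrix_mul_equiv, submatrix_mul_equiv, ← star_eq_conjTranspose, h.mul_inv_mul_star]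
  star_mul_mul := by
    rw [← submatrix_map, star_eq_conjTranspose, conjTranspose_submatrix,
      submatrix_mul_equiv, submatrix_mul_equiv, ← star_eq_conjTranspose, h.star_mul_mul]

/-- Compatibility is insensitive to rescaling `R`. Scaling one of the two copies of `b` lets an
off-diagonal block that commutes with `R` only up to the factor `c` commute with the combined form.
-/
theorem IsCompatible.fromBlocks {R : Matrix ι ι ℂ} {b : Matrix ι ι H} (h : IsCompatible R b)
    (hR : IsUnit R.det) {c : ℂ} (hc : c ≠ 0) :
    IsCompatible (fromBlocks (c • R) 0 0 R) (fromBlocks b 0 0 b) where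
  coef := h.coef.fromBlocks h.coef
  bar_mem_unitary := by
    have e : (Matrix.fromBlocks b 0 0 b).map star =
        Matrix.fromBlocks (b.map star) 0 0 (b.map star) := by
      rw [fromBlocks_map]; simp
    rw [e]
    exact fromBlocks_mem_unitary h.bar_mem_unitary h.bar_mem_unitary
  mul_inv_mul_star := by
    have e : (Matrix.fromBlocks (c • R) 0 0 R)⁻¹ = Matrix.fromBlocks (c⁻¹ • R⁻¹) 0 0 R⁻¹ := by
      apply inv_eq_right_inv
      simp [fromBlocks_multiply, mul_nonsing_inv _ hR, hc]
    have e' : (c⁻¹ • R⁻¹).map (algebraMap ℂ H) = c⁻¹ • R⁻¹.map (algebraMap ℂ H) := by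
      ext i j
      rw [Matrix.map_apply, Matrix.smul_apply, Matrix.smul_apply, Matrix.map_apply, smul_eq_mul,
        map_mul, Algebra.smul_def]
    have h1 := h.mul_inv_mul_star
    rw [star_eq_conjTranspose] at h1 ⊢
    rw [e, fromBlocks_map, fromBlocks_conjTranspose, fromBlocks_multiply, fromBlocks_multiply, e']
    simp [h1]
  star_mul_mul := by
    have e' : (c • R).map (algebraMap ℂ H) = c • R.map (algebraMap ℂ H) := by
      ext i j
      rw [Matrix.map_apply, Matrix.smul_apply, Matrix.smul_apply, Matrix.map_apply, smul_eq_mul,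
        map_mul, Algebra.smul_def]
    have h1 := h.star_mul_mul
    rw [star_eq_conjTranspose] at h1 ⊢
    rw [fromBlocks_map, fromBlocks_conjTranspose, fromBlocks_multiply, fromBlocks_multiply, e']
    simp [h1]

end compatible

/-! ### Commutants -/

section commutant

variable {H : Type*} [Ring H] [Algebra ℂ H] {ι : Type*} [Fintype ι] [DecidableEq ι]

/-- The scalar matrices that commute with a matrix. -/
def commutant (x : Matrix ι ι H) : Subalgebra ℂ (Matrix ι ι ℂ) :=
  (Subalgebra.centralizer ℂ {x}).comap (Algebra.ofId ℂ H).mapMatrix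

theorem mem_commutant {x : Matrix ι ι H} {M : Matrix ι ι ℂ} :
    M ∈ commutant x ↔ M.map (algebraMap ℂ H) * x = x * M.map (algebraMap ℂ H) := by
  rw [commutant, Subalgebra.mem_comap, Subalgebra.mem_centralizer_iff]
  simp only [Set.mem_singleton_iff, forall_eq]
  exact eq_comm

theorem mem_commutant_of_inv {x : Matrix ι ι H} {M : Matrix ι ι ℂ} (hM : IsUnit M.det)
    (h : M⁻¹ ∈ commutant x) : M ∈ commutant x := by
  rw [mem_commutant] at h ⊢
  have e1 : M.map (algebraMap ℂ H) * M⁻¹.map (algebraMap ℂ H) = 1 := by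
    rw [← Matrix.map_mul, mul_nonsing_inv _ hM]; simp
  have e2 : M⁻¹.map (algebraMap ℂ H) * M.map (algebraMap ℂ H) = 1 := by
    rw [← Matrix.map_mul, nonsing_inv_mul _ hM]; simp
  calc _ = M.map (algebraMap ℂ H) * (x * M⁻¹.map (algebraMap ℂ H)) * M.map (algebraMap ℂ H) := by
        rw [mul_assoc _ (x * _), mul_assoc x, e2, mul_one]
    _ = _ := by rw [← h, ← mul_assoc, e1, one_mul]

variable [StarRing H] [StarModule ℂ H]

omit [DecidableEq ι] in
theorem scalar_mul_map_star (M : Matrix ι ι ℂ) (x : Matrix ι ι H) :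
    (M.map (algebraMap ℂ H) * x).map star = (M.map star).map (algebraMap ℂ H) * x.map star := by
  ext i j
  simp [Matrix.mul_apply, star_sum, ← algebraMap_star_comm, Algebra.commutes]

omit [DecidableEq ι] in
theorem mul_scalar_map_star (M : Matrix ι ι ℂ) (x : Matrix ι ι H) :
    (x * M.map (algebraMap ℂ H)).map star = x.map star * (M.map star).map (algebraMap ℂ H) := by
  ext i j
  simp [Matrix.mul_apply, star_sum, ← algebraMap_star_comm, Algebra.commutes]

theorem map_star_mem_commutant {x : Matrix ι ι H} {M : Matrix ι ι ℂ} (h : M ∈ commutant x) :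
    M.map star ∈ commutant (x.map star) := by
  rw [mem_commutant] at h ⊢
  rw [← scalar_mul_map_star, h, mul_scalar_map_star]

omit [Fintype ι] [DecidableEq ι] in
theorem star_scalar (M : Matrix ι ι ℂ) :
    star (M.map (algebraMap ℂ H)) = Mᴴ.map (algebraMap ℂ H) := by
  ext i j
  simp only [Matrix.star_apply, Matrix.map_apply, conjTranspose_apply, algebraMap_star_comm]

theorem conjTranspose_mem_commutant_star {x : Matrix ι ι H} {M : Matrix ι ι ℂ}
    (h : M ∈ commutant x) : Mᴴ ∈ commutant (star x) := by
  rw [mem_commutant] at h ⊢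
  rw [← star_scalar, ← star_mul, ← h, star_mul]

theorem conjTranspose_mem_commutant {x : Matrix ι ι H} (hx : x ∈ unitary (Matrix ι ι H))
    {M : Matrix ι ι ℂ} (h : M ∈ commutant x) : Mᴴ ∈ commutant x := by
  have h' := mem_commutant.1 (conjTranspose_mem_commutant_star h)
  rw [mem_commutant]
  rw [Unitary.mem_iff] at hx
  calc _ = x * (star x * Mᴴ.map (algebraMap ℂ H)) * x := by
        rw [← mul_assoc, hx.2, one_mul]
    _ = _ := by rw [← h', mul_assoc, mul_assoc, hx.1, mul_one]

end commutant

section compatible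

variable {H : Type*} [Ring H] [HopfAlgebra ℂ H] [StarRing H] [StarModule ℂ H] {ι : Type*} [Fintype ι]
  [DecidableEq ι] {R : Matrix ι ι ℂ} {b : Matrix ι ι H}

/-- The conjugate of `b` is unitary, so its commutant is closed under adjoints, and entrywise
conjugation carries this back to `b`. -/
theorem IsCompatible.conjTranspose_mem_commutant (h : IsCompatible R b) {M : Matrix ι ι ℂ}
    (hM : M ∈ commutant b) : Mᴴ ∈ commutant b := by
  have h1 := map_star_mem_commutant
    (QuantumGroup.conjTranspose_mem_commutant h.bar_mem_unitary (map_star_mem_commutant hM))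
  have e : ((M.map star)ᴴ).map star = Mᴴ := by ext i j; simp
  rwa [e, map_star_map_star] at h1

/-- The commutant of a compatible matrix is invariant under conjugation. -/
theorem IsCompatible.conj_mem_commutant (h : IsCompatible R b) (hR : IsUnit R.det)
    (hR' : Rᴴ = R) {M : Matrix ι ι ℂ} (hM : M ∈ commutant b) : R⁻¹ * M * R ∈ commutant b := by
  have e1 : R.map (algebraMap ℂ H) * R⁻¹.map (algebraMap ℂ H) = 1 := by
    rw [← Matrix.map_mul, mul_nonsing_inv _ hR]; simp
  have e2 : R⁻¹.map (algebraMap ℂ H) * R.map (algebraMap ℂ H) = 1 := by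
    rw [← Matrix.map_mul, nonsing_inv_mul _ hR]; simp
  -- Invariance of `R` says that `b*` is the inverse of `b` conjugated by `R`, so conjugation by `R`
  -- moves the commutant of `b` to that of `b*`. Taking adjoints then returns to `b`.
  have key : R * Mᴴ * R⁻¹ ∈ commutant (star b) := by
    have hM' := mem_commutant.1 (h.conjTranspose_mem_commutant hM)
    rw [mem_commutant]
    simp only [Matrix.map_mul]
    have h1 := h.mul_inv_mul_star
    have h2 := h.star_mul_mul
    generalize Mᴴ.map (algebraMap ℂ H) = N at hM' ⊢
    generalize R.map (algebraMap ℂ H) = r at *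
    generalize R⁻¹.map (algebraMap ℂ H) = r' at *
    calc r * N * r' * star b = (star b * r * b) * N * r' * star b := by rw [h2]
      _ = star b * r * (N * (b * r' * star b)) := by
        simp only [mul_assoc]; rw [← mul_assoc b N, ← hM']; simp only [mul_assoc]
      _ = star b * (r * N * r') := by rw [h1]; simp only [mul_assoc]
  have h3 := conjTranspose_mem_commutant_star key
  rwa [star_star, conjTranspose_mul, conjTranspose_mul, conjTranspose_conjTranspose,
    conjTranspose_nonsing_inv, hR', ← mul_assoc] at h3

end compatible

section conjugation

variable {n : ℕ}

/-- Conjugation by a self-adjoint matrix is diagonalizable. -/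
theorem iSup_eigenspace_conj {R : Matrix (Fin n) (Fin n) ℂ} (hR : Rᴴ = R) :
    ⨆ μ, Module.End.eigenspace
      (LinearMap.mulLeft ℂ R⁻¹ ∘ₗ LinearMap.mulRight ℂ R : Module.End ℂ (Matrix (Fin n) (Fin n) ℂ))
      μ = ⊤ := by
  let _ : NormedAddCommGroup (Matrix (Fin n) (Fin n) ℂ) := toMatrixNormedAddCommGroup 1 PosDef.one
  let _ : InnerProductSpace ℂ (Matrix (Fin n) (Fin n) ℂ) := toMatrixInnerProductSpace 1 PosSemidef.one
  -- For the trace inner product, conjugation by a self-adjoint matrix is a symmetric operator, so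
  -- the finite-dimensional spectral theorem applies.
  have hsymm : LinearMap.IsSymmetric (𝕜 := ℂ) (E := Matrix (Fin n) (Fin n) ℂ)
      (LinearMap.mulLeft ℂ R⁻¹ ∘ₗ LinearMap.mulRight ℂ R) := by
    intro x y
    change (y * 1 * (R⁻¹ * (x * R))ᴴ).trace = (R⁻¹ * (y * R) * 1 * xᴴ).trace
    rw [conjTranspose_mul, conjTranspose_mul, conjTranspose_nonsing_inv, hR, mul_one, mul_one,
      ← mul_assoc, ← mul_assoc, trace_mul_comm _ R⁻¹]
    simp only [mul_assoc]
  rw [← Submodule.orthogonal_eq_bot_iff]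
  exact hsymm.orthogonalComplement_iSup_eigenspaces_eq_bot

end conjugation

/-- The double commutant theorem for matrix algebras. -/
theorem mem_of_mem_doubleCommutant {κ : Type*} [Fintype κ] [DecidableEq κ]
    (B : Submodule ℂ (Matrix κ κ ℂ)) (one_mem : 1 ∈ B) (mul_mem : ∀ X ∈ B, ∀ Y ∈ B, X * Y ∈ B)
    (star_mem : ∀ X ∈ B, Xᴴ ∈ B) {T : Matrix κ κ ℂ}
    (hT : ∀ M : Matrix κ κ ℂ, (∀ X ∈ B, M * X = X * M) → M * T = T * M) : T ∈ B := by
  obtain ⟨m, W, hW, hW'⟩ := exists_frame B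
  -- `P` is the orthogonal projection onto `B` for the trace inner product. The aim is that it
  -- commutes with left multiplication by `T`, for then `T = T * P 1 = P T` lies in `B`.
  let P : Matrix κ κ ℂ →ₗ[ℂ] Matrix κ κ ℂ :=
    { toFun := fun X => ∑ α, ((W α)ᴴ * X).trace • W α
      map_add' := fun X Y => by
        simp only [mul_add, trace_add, add_smul, Finset.sum_add_distrib]
      map_smul' := fun c X => by
        simp only [mul_smul_comm, trace_smul, smul_eq_mul, mul_smul, Finset.smul_sum,
          RingHom.id_apply] }
  have hP (X) : P X = ∑ α, ((W α)ᴴ * X).trace • W α := rfl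
  have hPmem (X) : P X ∈ B := by
    rw [hP]
    exact Submodule.sum_mem _ fun α _ => Submodule.smul_mem _ _ (hW α)
  have hPid (X) (hX : X ∈ B) : P X = X := (hW' X hX).symm
  have hsymm (X Y) : (Yᴴ * P X).trace = ((P Y)ᴴ * X).trace := by
    rw [hP, hP, Finset.mul_sum, conjTranspose_sum, Finset.sum_mul, trace_sum, trace_sum]
    refine Finset.sum_congr rfl fun α _ => ?_
    rw [mul_smul_comm, conjTranspose_smul, smul_mul_assoc, trace_smul, trace_smul,
      ← trace_conjTranspose, conjTranspose_mul, conjTranspose_conjTranspose, smul_eq_mul,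
      smul_eq_mul, mul_comm]
  -- Since `B` is closed under products and adjoints, left multiplication by `b` preserves `B` and
  -- its orthogonal complement.
  have hmul (b) (hb : b ∈ B) (X) : P (b * X) = b * P X := by
    have h (Y) (hY : Y ∈ B) : (Yᴴ * (P (b * X) - b * P X)).trace = 0 := by
      have e : P (bᴴ * Y) = bᴴ * P Y := by
        rw [hPid _ hY, hPid _ (mul_mem _ (star_mem _ hb) _ hY)]
      rw [mul_sub, trace_sub, hsymm, sub_eq_zero, ← mul_assoc,
        show (P Y)ᴴ * b = (bᴴ * P Y)ᴴ by rw [conjTranspose_mul, conjTranspose_conjTranspose], ← e,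
        ← hsymm, conjTranspose_mul, conjTranspose_conjTranspose, mul_assoc]
    have h' := h _ (Submodule.sub_mem _ (hPmem (b * X)) (mul_mem _ hb _ (hPmem X)))
    rwa [trace_conjTranspose_mul_self_eq_zero_iff, sub_eq_zero] at h'
  have hcoord (X) (i j) : P X i j = ∑ l, ∑ k, P (Matrix.single k l 1) i j * X k l := by
    conv_lhs => rw [matrix_eq_sum_single X]
    simp only [map_sum, Matrix.sum_apply]
    rw [Finset.sum_comm]
    refine Finset.sum_congr rfl fun l _ => Finset.sum_congr rfl fun k _ => ?_
    rw [show Matrix.single k l (X k l) = X k l • Matrix.single k l (1 : ℂ) by simp, map_smul,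
      Matrix.smul_apply, smul_eq_mul, mul_comm]
  -- This matrix records how `P` carries column `l` of its argument into column `j` of its value. It
  -- commutes with left multiplication by `B` because `P` does, hence with `T` by hypothesis.
  have hcomm (j l : κ) : (Matrix.of fun i k => P (Matrix.single k l 1) i j) * T =
      T * Matrix.of fun i k => P (Matrix.single k l 1) i j := by
    refine hT _ fun b hb => ?_
    ext i k
    have e : b * Matrix.single k l 1 = ∑ p, b p k • Matrix.single p l (1 : ℂ) := by
      ext p q
      simp [Matrix.sum_apply, Matrix.single_apply, Matrix.mul_apply, ite_and]
    have h := congrFun (congrFun (hmul b hb (Matrix.single k l 1)) i) j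
    rw [e, map_sum, Matrix.sum_apply, Matrix.mul_apply] at h
    rw [Matrix.mul_apply, Matrix.mul_apply]
    simp only [Matrix.of_apply]
    rw [← h]
    refine Finset.sum_congr rfl fun p _ => ?_
    rw [map_smul, Matrix.smul_apply, smul_eq_mul, mul_comm]
  have hPT : P T = T * P 1 := by
    ext i j
    have h (l : κ) := congrFun (congrFun (hcomm j l) i) l
    simp only [Matrix.mul_apply, Matrix.of_apply] at h
    rw [hcoord, Matrix.mul_apply]
    simp only [h, hcoord 1]
    rw [Finset.sum_comm]
    simp [Matrix.one_apply, Finset.mul_sum]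
  rw [hPid 1 one_mem, mul_one] at hPT
  rw [← hPT]
  exact hPmem T

end QuantumGroup

/-! ### Compatible matrices as morphisms out of `Au Q` -/

namespace CQG

open scoped TensorProduct ComplexOrder MatrixOrder
open Matrix

variable {A B : CQG.{u}} {n : ℕ}

theorem map_alg_star (f : A ⟶ B) {ι : Type*} (x : Matrix ι ι A) :
    (x.map (alg f)).map star = (x.map star).map (alg f) := by
  ext i j
  simp [alg_star]

theorem map_scalar_map_alg (f : A ⟶ B) {ι : Type*} (M : Matrix ι ι ℂ) :
    (M.map (algebraMap ℂ A)).map (alg f) = M.map (algebraMap ℂ B) := by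
  ext i j
  simp

theorem isCompatible_map (f : A ⟶ B) {ι : Type*} [Fintype ι] [DecidableEq ι] {R : Matrix ι ι ℂ}
    {b : Matrix ι ι A} (h : IsCompatible R b) : IsCompatible R (b.map (alg f)) where
  coef := isCoefficientMatrix_map f h.coef
  bar_mem_unitary := by
    rw [map_alg_star]
    exact map_mem_unitary f h.bar_mem_unitary
  mul_inv_mul_star := by
    rw [star_map, ← map_scalar_map_alg f, ← Matrix.map_mul, ← Matrix.map_mul, h.mul_inv_mul_star]
  star_mul_mul := by
    rw [star_map, ← map_scalar_map_alg f, ← Matrix.map_mul, ← Matrix.map_mul, h.star_mul_mul]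

/-- Compatible matrices define morphisms out of `A_u(Q)`. -/
theorem exists_au_hom (Q : PosMatrix n) {b : Matrix (Fin n) (Fin n) A} (h : IsCompatible Q.1 b) :
    ∃ f : Au.{u} Q ⟶ A, (auMat f).map star = b := by
  have hinv : Q.root⁻¹ * Q.root⁻¹ = Q.1⁻¹ := by
    rw [← Q.root_mul_root, Matrix.mul_inv_rev]
  have ht : (b.map star)ᵀ = star b := rfl
  have ht' : bᵀ = star (b.map star) := by
    ext i j; simp [Matrix.star_apply]
  have hu := Unitary.mem_iff.1 h.bar_mem_unitary
  have hrel : AuRelations Q (b.map star) ((b.map star).map star) := by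
    rw [map_star_map_star]
    apply AuRelations.of_rel
    · rw [ht', hu.2]
    · rw [ht', hu.1]
    · rw [← scalarMat_mul, hinv, ht]
      exact h.mul_inv_mul_star
    · rw [← scalarMat_mul, Q.root_mul_root, ht]
      exact h.star_mul_mul
  have hc : IsCoefficientMatrix (b.map star) := h.coef.map_star
  exact ⟨auDesc _ hrel hc, by rw [auMat_auDesc, map_star_map_star]⟩

theorem isCompatible_auMat {Q : PosMatrix n} (f : Au.{u} Q ⟶ A) :
    IsCompatible Q.1 ((auMat f).map star) := by
  have hinv : Q.root⁻¹ * Q.root⁻¹ = Q.1⁻¹ := by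
    rw [← Q.root_mul_root, Matrix.mul_inv_rev]
  have ht : star ((auMat f).map star) = (auMat f)ᵀ := by
    ext i j; simp [Matrix.star_apply]
  have h := auMat_relations f
  refine ⟨(auMat_isCoefficientMatrix f).map_star, ?_, ?_, ?_⟩
  · rw [map_star_map_star]
    exact auMat_mem_unitary f
  · have h3 := h.rel₃
    rwa [← scalarMat_mul, hinv, ← ht] at h3
  · have h4 := h.rel₄
    rwa [← scalarMat_mul, Q.root_mul_root, ← ht] at h4

/-- Every unitary comodule is given by a morphism from some `A_u(Q)`. -/
theorem exists_auMat_eq {x : Matrix (Fin n) (Fin n) A} (hx : IsCoefficientMatrix x)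
    (hx' : x ∈ unitary (Matrix (Fin n) (Fin n) A)) :
    ∃ (Q : PosMatrix n) (f : Au.{u} Q ⟶ A), auMat f = x := by
  obtain ⟨R, hR, h⟩ := exists_isCompatible A.span_unitaryCoefficients hx hx'
  obtain ⟨f, hf⟩ := exists_au_hom ⟨R, hR⟩ h
  refine ⟨⟨R, hR⟩, f, ?_⟩
  rw [← map_star_map_star (auMat f), hf, map_star_map_star]

/-- Every element is a linear combination of the entries of the matrix of a morphism from some
`A_u(Q)`. -/
theorem exists_sum_auMat_eq (a : A) : ∃ (n : ℕ) (Q : PosMatrix n) (f : Au.{u} Q ⟶ A)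
    (c : Fin n × Fin n → ℂ), ∑ p, c p • auMat f p.1 p.2 = a := by
  obtain ⟨n, w, hw, hw', h⟩ := exists_mem_entrySpan A.span_unitaryCoefficients {a}
  obtain ⟨Q, f, rfl⟩ := exists_auMat_eq hw hw'
  obtain ⟨c, hc⟩ := (Submodule.mem_span_range_iff_exists_fun ℂ).1
    (h a (Finset.mem_singleton_self a))
  exact ⟨n, Q, f, c, hc⟩

/-- Every element is a combination of entries of the image of a standard matrix, so a morphism is
determined by its composites with maps from the `Au Q`. -/
theorem isSeparating_au : (ObjectProperty.ofObj
    (fun Q : (n : ℕ) × PosMatrix n => Au.{u} Q.2)).IsSeparating := by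
  intro A B f g h
  refine hom_ext fun a => ?_
  obtain ⟨n, Q, p, c, rfl⟩ := exists_sum_auMat_eq a
  have e := h (Au Q) (ObjectProperty.ofObj_apply (fun Q : (n : ℕ) × PosMatrix n => Au.{u} Q.2) ⟨n, Q⟩) p
  have e' := congrArg auMat e
  rw [map_sum, map_sum]
  refine Finset.sum_congr rfl fun i _ => ?_
  rw [map_smul, map_smul]
  exact congrArg _ (congrFun (congrFun e' i.1) i.2)

/-! ### Surjective morphisms are coequalizers -/

/-! ### Linear algebra of positive definite matrices -/

section matrix

variable {ι κ : Type*} [Fintype ι] [DecidableEq ι] [Fintype κ] [DecidableEq κ]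

theorem inv_mul_comm {M N : Matrix ι ι ℂ} (hM : IsUnit M.det) (h : M * N = N * M) :
    M⁻¹ * N = N * M⁻¹ := by
  calc M⁻¹ * N = M⁻¹ * (N * M) * M⁻¹ := by rw [mul_assoc, mul_assoc, mul_nonsing_inv _ hM, mul_one]
    _ = N * M⁻¹ := by rw [← h, ← mul_assoc, nonsing_inv_mul _ hM, one_mul]

theorem submatrix_mem_commutant {x : Matrix ι ι A} {M : Matrix ι ι ℂ} (e : κ ≃ ι) :
    M.submatrix e e ∈ commutant (x.submatrix e e) ↔ M ∈ commutant x := by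
  rw [mem_commutant, mem_commutant, ← submatrix_map, submatrix_mul_equiv, submatrix_mul_equiv]
  exact (Matrix.reindex e.symm e.symm).injective.eq_iff
    (a := M.map (algebraMap ℂ A) * x) (b := x * M.map (algebraMap ℂ A))

theorem posDef_fromBlocks {M : Matrix ι ι ℂ} {N : Matrix κ κ ℂ} (hM : M.PosDef) (hN : N.PosDef) :
    (fromBlocks M 0 0 N).PosDef := by
  have := hM.isUnit.invertible
  have h : (fromBlocks M 0 0 N).PosSemidef := by
    simpa using (PosDef.fromBlocks₁₁ (B := (0 : Matrix ι κ ℂ)) N hM).2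
      (by simpa using hN.posSemidef)
  rw [h.posDef_iff_isUnit, Matrix.isUnit_iff_isUnit_det, det_fromBlocks_zero₂₁]
  exact ((Matrix.isUnit_iff_isUnit_det _).1 hM.isUnit).mul
    ((Matrix.isUnit_iff_isUnit_det _).1 hN.isUnit)

omit [DecidableEq ι] in
theorem trace_conjTranspose_mul_self_pos {M : Matrix ι ι ℂ} (hM : M ≠ 0) : 0 < (Mᴴ * M).trace :=
  lt_of_le_of_ne (posSemidef_conjTranspose_mul_self M).trace_nonneg fun h =>
    hM ((trace_conjTranspose_mul_self_eq_zero_iff).1 h.symm)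

theorem pos_of_eq_mul {a c μ : ℂ} (ha : 0 < a) (hc : 0 < c) (h : a = μ * c) : 0 < μ := by
  rw [Complex.pos_iff] at ha hc ⊢
  have h1 := congrArg Complex.re h
  have h2 := congrArg Complex.im h
  rw [Complex.mul_re, ← hc.2, mul_zero, sub_zero] at h1
  rw [Complex.mul_im, ← hc.2, ← ha.2, mul_zero, zero_add, eq_comm, mul_eq_zero] at h2
  refine ⟨pos_of_mul_pos_left (h1 ▸ ha.1) hc.1.le, ?_⟩
  rcases h2 with h2 | h2
  · exact h2.symm
  · exact absurd h2 hc.1.ne'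

/-- Eigenvalues of the conjugation by a positive definite matrix are positive. -/
theorem eigenvalue_pos (Q : PosMatrix n) {T : Matrix (Fin n) (Fin n) ℂ} {μ : ℂ} (hT : T ≠ 0)
    (h : T * Q.1 = μ • (Q.1 * T)) : 0 < μ := by
  have hd := Q.isUnit_det_root
  have h1 : T * Q.root ≠ 0 := fun h0 => hT (by
    rw [← mul_one T, ← Q.root_mul_inv, ← mul_assoc, h0, zero_mul])
  have h2 : Q.root * T ≠ 0 := fun h0 => hT (by
    rw [← one_mul T, ← Q.inv_mul_root, mul_assoc, h0, mul_zero])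
  -- The eigenvalue is the ratio of the squared trace norms of `T Q^{1/2}` and `Q^{1/2} T`, both
  -- nonzero.
  refine pos_of_eq_mul (trace_conjTranspose_mul_self_pos h1) (trace_conjTranspose_mul_self_pos h2) ?_
  rw [conjTranspose_mul, conjTranspose_mul, Q.root_conjTranspose, mul_assoc, trace_mul_comm]
  refine Eq.trans ?_ (trace_smul μ _)
  calc _ = (Tᴴ * (T * (Q.root * Q.root))).trace := by simp only [mul_assoc]
    _ = _ := by
      rw [Q.root_mul_root, h, mul_smul_comm, ← Q.root_mul_root]
      simp only [mul_assoc]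

end matrix

/-! ### From pairs of morphisms out of `Au Q` to the kernel of `π` -/

section coequalizer

variable {X Y S : CQG.{u}} (π : Y ⟶ X) (s : Y ⟶ S)

/-- A morphism that coequalizes all pairs of morphisms from the `A_u(Q)` that are coequalized by
`π`. -/
def CoequalizesAu : Prop :=
  ∀ (n : ℕ) (Q : PosMatrix n) (p q : Au.{u} Q ⟶ Y), p ≫ π = q ≫ π → p ≫ s = q ≫ s

variable {π s} (hs : CoequalizesAu π s)
include hs

/-- Matrices compatible with the same `Q` are morphisms from the same `Au Q`, so the hypothesis on
pairs applies to them. -/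
theorem CoequalizesAu.map_eq (Q : PosMatrix n) {b b' : Matrix (Fin n) (Fin n) Y}
    (h : IsCompatible Q.1 b) (h' : IsCompatible Q.1 b') (e : b.map (alg π) = b'.map (alg π)) :
    b.map (alg s) = b'.map (alg s) := by
  obtain ⟨p, hp⟩ := exists_au_hom Q h
  obtain ⟨q, hq⟩ := exists_au_hom Q h'
  have h1 : p ≫ π = q ≫ π := by
    apply au_hom_ext
    rw [auMat_comp, auMat_comp, ← map_star_map_star (auMat p), ← map_star_map_star (auMat q), hp, hq,
      ← map_alg_star, ← map_alg_star, e]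
  have h2 := congrArg (fun f => (auMat f).map star) (hs n Q p q h1)
  simp only [auMat_comp, map_alg_star, hp, hq] at h2
  exact h2

/-- Conjugating `b` by `U` keeps it compatible with `Q`, since `U` is unitary and commutes with `Q`.
The two matrices have the same image under `π`, hence under `s`. -/
theorem CoequalizesAu.mem_commutant_of_unitary (Q : PosMatrix n) {b : Matrix (Fin n) (Fin n) Y}
    (h : IsCompatible Q.1 b) {U : Matrix (Fin n) (Fin n) ℂ} (hU : U ∈ unitary _)
    (hUQ : U * Q.1 = Q.1 * U) (hc : U ∈ commutant (b.map (alg π))) :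
    U ∈ commutant (b.map (alg s)) := by
  have hu := Unitary.mem_iff.1 hU
  rw [star_eq_conjTranspose] at hu
  have key {Z : CQG.{u}} (z : Matrix (Fin n) (Fin n) Z) :
      U.map (algebraMap ℂ Z) * z * Uᴴ.map (algebraMap ℂ Z) = z ↔ U ∈ commutant z := by
    rw [mem_commutant]
    have e1 : U.map (algebraMap ℂ Z) * Uᴴ.map (algebraMap ℂ Z) = 1 := by
      rw [← Matrix.map_mul, hu.2]; simp
    have e2 : Uᴴ.map (algebraMap ℂ Z) * U.map (algebraMap ℂ Z) = 1 := by
      rw [← Matrix.map_mul, hu.1]; simp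
    constructor
    · intro h
      conv_rhs => rw [← h]
      rw [mul_assoc _ _ (U.map _), e2, mul_one]
    · intro h
      rw [h, mul_assoc, e1, mul_one]
  have hmap {Z : CQG.{u}} (f : Y ⟶ Z) : (U.map (algebraMap ℂ Y) * b *
      Uᴴ.map (algebraMap ℂ Y)).map (alg f) =
      U.map (algebraMap ℂ Z) * b.map (alg f) * Uᴴ.map (algebraMap ℂ Z) := by
    rw [Matrix.map_mul, Matrix.map_mul, map_scalar_map_alg, map_scalar_map_alg]
  have hQinv : U * Q.1⁻¹ = Q.1⁻¹ * U :=
    (inv_mul_comm ((Matrix.isUnit_iff_isUnit_det _).1 Q.2.isUnit) hUQ.symm).symm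
  have hstar : star (U.map (algebraMap ℂ Y) * b * Uᴴ.map (algebraMap ℂ Y)) =
      U.map (algebraMap ℂ Y) * star b * Uᴴ.map (algebraMap ℂ Y) := by
    rw [star_mul, star_mul, star_scalar, star_scalar, conjTranspose_conjTranspose, mul_assoc]
  have e1 : U.map (algebraMap ℂ Y) * Uᴴ.map (algebraMap ℂ Y) = 1 := by
    rw [← Matrix.map_mul, hu.2]; simp
  have e2 : Uᴴ.map (algebraMap ℂ Y) * U.map (algebraMap ℂ Y) = 1 := by
    rw [← Matrix.map_mul, hu.1]; simp
  have hform (x y : Matrix (Fin n) (Fin n) Y) (M : Matrix (Fin n) (Fin n) ℂ) (hM : U * M = M * U)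
      (hxy : x * M.map (algebraMap ℂ Y) * y = M.map (algebraMap ℂ Y)) :
      (U.map (algebraMap ℂ Y) * x * Uᴴ.map (algebraMap ℂ Y)) * M.map (algebraMap ℂ Y) *
        (U.map (algebraMap ℂ Y) * y * Uᴴ.map (algebraMap ℂ Y)) = M.map (algebraMap ℂ Y) := by
    have hM' : U.map (algebraMap ℂ Y) * M.map (algebraMap ℂ Y) =
        M.map (algebraMap ℂ Y) * U.map (algebraMap ℂ Y) := by
      rw [← Matrix.map_mul, hM, Matrix.map_mul]
    generalize U.map (algebraMap ℂ Y) = u at *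
    generalize Uᴴ.map (algebraMap ℂ Y) = u' at *
    generalize M.map (algebraMap ℂ Y) = m at *
    calc _ = u * x * u' * (m * u) * y * u' := by simp only [mul_assoc]
      _ = u * x * (u' * u) * m * y * u' := by rw [← hM']; simp only [mul_assoc]
      _ = u * (x * m * y) * u' := by rw [e2]; simp only [mul_assoc, one_mul]
      _ = m := by rw [hxy, hM', mul_assoc, e1, mul_one]
  have h' : IsCompatible Q.1 (U.map (algebraMap ℂ Y) * b * Uᴴ.map (algebraMap ℂ Y)) := by
    refine ⟨h.coef.conj hu.2, ?_, ?_, ?_⟩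
    · rw [mul_scalar_map_star, scalar_mul_map_star]
      -- The entrywise conjugate of a unitary scalar matrix is unitary, so the conjugate of the new
      -- matrix is a product of three unitaries.
      have hm {V : Matrix (Fin n) (Fin n) ℂ} (h1 : V * Vᴴ = 1) (h2 : Vᴴ * V = 1) :
          (V.map star).map (algebraMap ℂ Y) ∈ unitary (Matrix (Fin n) (Fin n) Y) := by
        have ht : (V.map star)ᴴ = (Vᴴ).map star := by ext i j; simp
        have hs (M N : Matrix (Fin n) (Fin n) ℂ) :
            M.map star * N.map star = (M * N).map star := by
          ext i j; simp [Matrix.mul_apply]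
        have h1' : (1 : Matrix (Fin n) (Fin n) ℂ).map star = 1 := by simp
        rw [Unitary.mem_iff, star_scalar, ht, ← Matrix.map_mul, ← Matrix.map_mul, hs, hs, h1, h2, h1']
        simp
      exact mul_mem (mul_mem (hm hu.2 hu.1) h.bar_mem_unitary)
        (hm (by rw [conjTranspose_conjTranspose, hu.1]) (by rw [conjTranspose_conjTranspose, hu.2]))
    · rw [hstar]
      exact hform _ _ _ hQinv h.mul_inv_mul_star
    · rw [hstar]
      exact hform _ _ _ hUQ h.star_mul_mul
  have e := hs.map_eq Q h' h (by rw [hmap, key]; exact hc)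
  rwa [hmap, key] at e

/-- The Cayley transform `(T - i)(T + i)⁻¹` is unitary, commutes with whatever `T` commutes with,
and determines `T` by algebraic operations that preserve commutants. -/
theorem CoequalizesAu.mem_commutant_of_isHermitian (Q : PosMatrix n)
    {b : Matrix (Fin n) (Fin n) Y} (h : IsCompatible Q.1 b) {T : Matrix (Fin n) (Fin n) ℂ}
    (hT : Tᴴ = T) (hTQ : T * Q.1 = Q.1 * T) (hc : T ∈ commutant (b.map (alg π))) :
    T ∈ commutant (b.map (alg s)) := by
  obtain ⟨N, hN⟩ : ∃ N, N = T + Complex.I • (1 : Matrix (Fin n) (Fin n) ℂ) := ⟨_, rfl⟩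
  have hN' : Nᴴ = N - (2 * Complex.I) • (1 : Matrix (Fin n) (Fin n) ℂ) := by
    rw [hN, conjTranspose_add, hT, conjTranspose_smul, conjTranspose_one, add_sub_assoc, ← sub_smul]
    congr 2
    simp only [RCLike.star_def, Complex.conj_I]
    ring
  have hNN : Nᴴ * N = N * Nᴴ := by
    rw [hN', sub_mul, mul_sub, smul_mul_assoc, mul_smul_comm, one_mul, mul_one]
  have hd : IsUnit N.det := by
    -- With `T` Hermitian, the product is the positive definite `T² + 1`, so `N` is invertible.
    have e : N * Nᴴ = Tᴴ * T + 1 := by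
      rw [hN', hN, hT, mul_sub, add_mul, mul_add]
      simp only [smul_mul_assoc, mul_smul_comm, one_mul, mul_one, smul_add, smul_smul]
      rw [mul_assoc, Complex.I_mul_I, two_mul, add_smul]
      module
    have hp : (N * Nᴴ).PosDef := by
      rw [e]
      exact PosDef.one.posSemidef_add (posSemidef_conjTranspose_mul_self T)
    have := (Matrix.isUnit_iff_isUnit_det _).1 hp.isUnit
    rw [det_mul] at this
    exact isUnit_of_mul_isUnit_left this
  have hd' : IsUnit Nᴴ.det := by
    rw [det_conjTranspose]; exact hd.star
  have hNQ : N * Q.1 = Q.1 * N := by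
    rw [hN, add_mul, mul_add, hTQ, smul_mul_assoc, mul_smul_comm, one_mul, mul_one]
  have hNQ' : Nᴴ * Q.1 = Q.1 * Nᴴ := by
    rw [hN', sub_mul, mul_sub, hNQ, smul_mul_assoc, mul_smul_comm, one_mul, mul_one]
  have hNc : N ∈ commutant (b.map (alg π)) := by
    rw [hN]
    exact add_mem hc (Subalgebra.smul_mem _ (one_mem _) _)
  have hNc' : Nᴴ ∈ commutant (b.map (alg π)) := by
    rw [hN']
    exact sub_mem hNc (Subalgebra.smul_mem _ (one_mem _) _)
  have hNi : N⁻¹ ∈ commutant (b.map (alg π)) :=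
    mem_commutant_of_inv (isUnit_nonsing_inv_det _ hd) (by rwa [nonsing_inv_nonsing_inv _ hd])
  have hU : Nᴴ * N⁻¹ ∈ unitary (Matrix (Fin n) (Fin n) ℂ) := by
    have e : star (Nᴴ * N⁻¹) * (Nᴴ * N⁻¹) = 1 := by
      rw [star_eq_conjTranspose, conjTranspose_mul, conjTranspose_conjTranspose,
        conjTranspose_nonsing_inv]
      calc _ = Nᴴ⁻¹ * (N * Nᴴ) * N⁻¹ := by simp only [mul_assoc]
        _ = 1 := by
          rw [← hNN, ← mul_assoc, nonsing_inv_mul _ hd', one_mul, mul_nonsing_inv _ hd]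
    exact Unitary.mem_iff.2 ⟨e, mul_eq_one_comm.1 e⟩
  have hres := hs.mem_commutant_of_unitary Q h hU
    (by rw [mul_assoc, inv_mul_comm hd hNQ, ← mul_assoc, hNQ', mul_assoc]) (mul_mem hNc' hNi)
  -- Since `Nᴴ = N - 2i`, the Cayley transform equals `1 - 2i N⁻¹`, which is solved for `N⁻¹`.
  have hN2 : N⁻¹ = (2 * Complex.I)⁻¹ • (1 - Nᴴ * N⁻¹) := by
    rw [hN', sub_mul, mul_nonsing_inv _ hd, smul_mul_assoc, one_mul, sub_sub_cancel, smul_smul,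
      inv_mul_cancel₀ (by simp), one_smul]
  have hNs : N ∈ commutant (b.map (alg s)) := by
    apply mem_commutant_of_inv hd
    rw [hN2]
    exact Subalgebra.smul_mem _ (sub_mem (one_mem _) hres) _
  rw [show T = N - Complex.I • (1 : Matrix (Fin n) (Fin n) ℂ) by rw [hN, add_sub_cancel_right]]
  exact sub_mem hNs (Subalgebra.smul_mem _ (one_mem _) _)

/-- The algebras `Au Q` are indexed by `Fin n`. Relabelling makes the Hermitian case available for
block matrices. -/
theorem CoequalizesAu.mem_commutant_of_isHermitian' {ι : Type*} [Fintype ι] [DecidableEq ι]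
    {R : Matrix ι ι ℂ} (hR : R.PosDef) {b : Matrix ι ι Y} (h : IsCompatible R b) {T : Matrix ι ι ℂ}
    (hT : Tᴴ = T) (hTR : T * R = R * T) (hc : T ∈ commutant (b.map (alg π))) :
    T ∈ commutant (b.map (alg s)) := by
  let e := (Fintype.equivFin ι).symm
  rw [← submatrix_mem_commutant e, submatrix_map] at hc ⊢
  exact hs.mem_commutant_of_isHermitian ⟨R.submatrix e e, hR.submatrix e.injective⟩ (h.submatrix e)
    (by rw [conjTranspose_submatrix, hT]) (by simp only [submatrix_mul_equiv, hTR]) hc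

/-- Place `T` and `Tᴴ` off the diagonal of a two-by-two block matrix acting on `b ⊕ b`. It is
Hermitian, and the eigenvector equation with its adjoint says that it commutes with the positive
definite `μQ ⊕ Q`; the Hermitian case applies and its upper right block gives `T`. -/
theorem CoequalizesAu.mem_commutant_of_eigenvector (Q : PosMatrix n)
    {b : Matrix (Fin n) (Fin n) Y} (h : IsCompatible Q.1 b) {T : Matrix (Fin n) (Fin n) ℂ} {μ : ℂ}
    (hμ : 0 < μ) (hTQ : T * Q.1 = μ • (Q.1 * T)) (hc : T ∈ commutant (b.map (alg π))) :
    T ∈ commutant (b.map (alg s)) := by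
  have hd : IsUnit Q.1.det := (Matrix.isUnit_iff_isUnit_det _).1 Q.2.isUnit
  have hc' := (isCompatible_map π h).conjTranspose_mem_commutant hc
  have hQT : Q.1 * Tᴴ = μ • (Tᴴ * Q.1) := by
    have h1 := congrArg conjTranspose hTQ
    rwa [conjTranspose_mul, conjTranspose_smul, conjTranspose_mul, Q.2.isHermitian.eq,
      (IsSelfAdjoint.of_nonneg hμ.le).star_eq] at h1
  have hmap {Z : CQG.{u}} (f : Y ⟶ Z) : (fromBlocks b 0 0 b).map (alg f) =
      fromBlocks (b.map (alg f)) 0 0 (b.map (alg f)) := by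
    rw [fromBlocks_map]; simp
  have hmap' {Z : CQG.{u}} : (fromBlocks 0 T Tᴴ 0).map (algebraMap ℂ Z) =
      fromBlocks 0 (T.map (algebraMap ℂ Z)) (Tᴴ.map (algebraMap ℂ Z)) 0 := by
    rw [fromBlocks_map]; simp
  have key := hs.mem_commutant_of_isHermitian' (posDef_fromBlocks (Q.2.smul hμ) Q.2)
    (h.fromBlocks hd hμ.ne') (T := fromBlocks 0 T Tᴴ 0)
    (by simp [fromBlocks_conjTranspose]) (by simp [fromBlocks_multiply, hTQ, hQT])
    (by
      rw [mem_commutant] at hc hc' ⊢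
      rw [hmap, hmap', fromBlocks_multiply, fromBlocks_multiply]
      simp [hc, hc'])
  rw [mem_commutant, hmap, hmap', fromBlocks_multiply, fromBlocks_multiply, fromBlocks_inj] at key
  rw [mem_commutant]
  simpa using key.2.1

/-- Conjugation by `Q` is diagonalizable and preserves the commutant under `π`, which is therefore
spanned by eigenvectors. Their eigenvalues are positive, so the eigenvector case covers them all. -/
theorem CoequalizesAu.commutant_le (Q : PosMatrix n)
    {b : Matrix (Fin n) (Fin n) Y} (h : IsCompatible Q.1 b) :
    commutant (b.map (alg π)) ≤ commutant (b.map (alg s)) := by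
  have hd : IsUnit Q.1.det := (Matrix.isUnit_iff_isUnit_det _).1 Q.2.isUnit
  have hQ : Q.1ᴴ = Q.1 := Q.2.isHermitian.eq
  have e := Submodule.eq_iSup_inf_genEigenspace (p := Subalgebra.toSubmodule (commutant (b.map (alg π))))
    (f := LinearMap.mulLeft ℂ Q.1⁻¹ ∘ₗ LinearMap.mulRight ℂ Q.1) 1
    (fun T hT => by
      have := (isCompatible_map π h).conj_mem_commutant hd hQ hT
      rwa [mul_assoc] at this)
    (iSup_eigenspace_conj hQ)
  suffices Subalgebra.toSubmodule (commutant (b.map (alg π))) ≤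
      Subalgebra.toSubmodule (commutant (b.map (alg s))) from this
  rw [e]
  refine iSup_le fun μ T hT => ?_
  obtain ⟨hT, hT'⟩ := hT
  have hT2 : Q.1⁻¹ * (T * Q.1) = μ • T := Module.End.mem_eigenspace_iff.1 hT'
  have hT3 : T * Q.1 = μ • (Q.1 * T) := by
    rw [← mul_smul_comm, ← hT2, ← mul_assoc, mul_nonsing_inv _ hd, one_mul]
  by_cases h0 : T = 0
  · rw [h0]; exact Submodule.zero_mem _
  · exact hs.mem_commutant_of_eigenvector Q h (eigenvalue_pos Q h0 hT3) hT3 hT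

omit hs in
theorem map_functional_comm {x : Matrix (Fin n) (Fin n) A} {M : Matrix (Fin n) (Fin n) ℂ} :
    M ∈ commutant x ↔ ∀ φ : A →ₗ[ℂ] ℂ, M * x.map φ = x.map φ * M := by
  rw [mem_commutant]
  constructor
  · intro h φ
    rw [← map_scalar_mul, h, map_mul_scalar]
  · intro h
    apply matrix_ext_functional
    intro φ
    rw [map_scalar_mul, h, map_mul_scalar]

/-- The evaluations under `π` form a unital matrix `*`-algebra, so by the double commutant theorem
an inclusion of commutants suffices. The resulting inclusion means that linear relations between the
coefficients under `π` persist under `s`. -/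
theorem CoequalizesAu.functionalRange_le {Q : PosMatrix n} (f : Au.{u} Q ⟶ Y) :
    functionalRange ((auMat f).map (alg s)) ≤ functionalRange ((auMat f).map (alg π)) := by
  have hcoef : IsCoefficientMatrix ((auMat f).map (alg π)) := auMat_isCoefficientMatrix (f ≫ π)
  have hunit : (auMat f).map (alg π) ∈ unitary (Matrix (Fin n) (Fin n) X) :=
    auMat_mem_unitary (f ≫ π)
  intro T hT
  obtain ⟨ψ, rfl⟩ := mem_functionalRange.1 hT
  refine mem_of_mem_doubleCommutant _ ?_ ?_ ?_ fun M hM => ?_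
  · refine mem_functionalRange.2 ⟨Coalgebra.counit, ?_⟩
    ext i j
    exact hcoef.counit_apply i j
  · rintro _ ⟨φ, rfl⟩ _ ⟨χ, rfl⟩
    exact mem_functionalRange.2 ⟨conv φ χ, hcoef.map_conv φ χ⟩
  · rintro _ ⟨φ, rfl⟩
    exact mem_functionalRange.2 ⟨functionalStar φ, map_functionalStar hcoef hunit φ⟩
  · have h1 : M ∈ commutant ((auMat f).map (alg π)) :=
      map_functional_comm.2 fun φ => hM _ (mem_functionalRange.2 ⟨φ, rfl⟩)
    -- `commutant_le` concerns the compatible matrix, which is the conjugate of `auMat f`; hence the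
    -- conjugation before and after it.
    have h2 := map_star_mem_commutant h1
    rw [map_alg_star] at h2
    have h3 := map_star_mem_commutant (hs.commutant_le Q (isCompatible_auMat f) h2)
    rw [map_star_map_star, ← map_alg_star, map_star_map_star] at h3
    exact map_functional_comm.1 h3 ψ

/-- Write `y` as a combination of the entries of one `auMat f`. Any functional `ψ` on `S` matches on
these entries some functional `φ` on `X`, so `ψ(s(y)) = φ(π(y)) = 0`, and functionals separate
points. -/
theorem CoequalizesAu.alg_eq_zero {y : Y} (hy : alg π y = 0) : alg s y = 0 := by
  obtain ⟨n, Q, f, c, rfl⟩ := exists_sum_auMat_eq y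
  rw [← Module.forall_dual_apply_eq_zero_iff ℂ]
  intro ψ
  obtain ⟨φ, hφ⟩ := mem_functionalRange.1
    (hs.functionalRange_le f (mem_functionalRange.2 ⟨ψ, rfl⟩))
  have h (p : Fin n × Fin n) : ψ (alg s (auMat f p.1 p.2)) = φ (alg π (auMat f p.1 p.2)) :=
    (congrFun (congrFun hφ p.1) p.2).symm
  have h0 := congrArg φ hy
  simp only [map_sum, map_smul, map_zero] at h0 ⊢
  simp only [h, h0]

end coequalizer

end CQG

namespace CQG

open scoped TensorProduct

/-! ### Descent along surjective morphisms -/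

section descend

variable {X Y S : CQG.{u}} {π : Y ⟶ X} {s : Y ⟶ S}

/-- The factorization of a morphism through a surjective morphism with smaller kernel, as a
homomorphism of algebras. -/
noncomputable def descAlg (hπ : Function.Surjective (alg π)) (h : ∀ y, alg π y = 0 → alg s y = 0) :
    X →ₐ[ℂ] S :=
  (Ideal.Quotient.liftₐ (RingHom.ker (alg π)) (alg s) fun y hy => h y hy).comp
    (Ideal.quotientKerAlgEquivOfSurjective hπ).symm.toAlgHom

theorem descAlg_alg (hπ : Function.Surjective (alg π)) (h : ∀ y, alg π y = 0 → alg s y = 0) (y : Y) :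
    descAlg hπ h (alg π y) = alg s y := by
  have e : (Ideal.quotientKerAlgEquivOfSurjective hπ).symm (alg π y) =
      Ideal.Quotient.mk (RingHom.ker (alg π)) y := by
    rw [AlgEquiv.symm_apply_eq]
    rfl
  exact (congrArg (Ideal.Quotient.liftₐ (RingHom.ker (alg π)) (alg s) fun y hy => h y hy) e).trans
    rfl

/-- The factorization of a morphism through a surjective morphism with smaller kernel. -/
noncomputable def descHom (hπ : Function.Surjective (alg π)) (h : ∀ y, alg π y = 0 → alg s y = 0) :
    X ⟶ S :=
  homMk (descAlg hπ h)
    (fun x => by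
      obtain ⟨y, rfl⟩ := hπ x
      rw [← alg_star, descAlg_alg, descAlg_alg, alg_star])
    (fun x => by
      obtain ⟨y, rfl⟩ := hπ x
      rw [descAlg_alg, comul_alg, comul_alg]
      generalize Coalgebra.comul (R := ℂ) y = t
      induction t with
      | zero => simp
      | tmul a b => simp [descAlg_alg]
      | add a b ha hb => simp only [map_add, ha, hb])
    (fun x => by
      obtain ⟨y, rfl⟩ := hπ x
      rw [descAlg_alg, counit_alg, counit_alg])

@[simp]
theorem comp_descHom (hπ : Function.Surjective (alg π)) (h : ∀ y, alg π y = 0 → alg s y = 0) :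
    π ≫ descHom hπ h = s :=
  hom_ext fun y => descAlg_alg hπ h y

theorem hom_ext_of_surjective (hπ : Function.Surjective (alg π)) {f g : X ⟶ S}
    (h : π ≫ f = π ≫ g) : f = g := by
  refine hom_ext fun x => ?_
  obtain ⟨y, rfl⟩ := hπ x
  exact congrArg (fun k => alg k y) h

end descend

/-! ### The canonical presentation and the generator theorems -/

/-- A morphism through which all morphisms from the `A_u(Q)` factor is surjective. -/
theorem surjective_of_factors {X Z : CQG.{u}} {π : Z ⟶ X}
    (h : ∀ (n : ℕ) (Q : PosMatrix n) (f : Au.{u} Q ⟶ X), ∃ g : Au.{u} Q ⟶ Z, g ≫ π = f) :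
    Function.Surjective (alg π) := by
  intro x
  obtain ⟨n, Q, f, c, rfl⟩ := exists_sum_auMat_eq x
  obtain ⟨g, rfl⟩ := h n Q f
  exact ⟨∑ p, c p • auMat g p.1 p.2, by
    rw [map_sum]
    exact Finset.sum_congr rfl fun p _ => map_smul _ _ _⟩

/-- The objects `A_u(Q)`. -/
noncomputable abbrev auFamily (Q : (n : ℕ) × PosMatrix n) : CQG.{u} := Au.{u} Q.2

theorem isRegularGenerator_au : IsRegularGenerator (ObjectProperty.ofObj auFamily.{u}) := by
  refine ⟨isSeparating_au, fun X => ?_⟩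
  have := hasColimits.{u}
  -- One summand for every morphism into `X` makes `π` surjective.
  let t : (Σ Q : (n : ℕ) × PosMatrix n, auFamily.{u} Q ⟶ X) → CQG.{u} := fun j => auFamily j.1
  let π : ∐ t ⟶ X := Sigma.desc fun j => j.2
  -- One summand for every pair coequalized by `π`: a morphism coequalizing `f` and `g` then
  -- satisfies `CoequalizesAu`, so it kills the kernel of `π` and descends to `X`.
  let s : (Σ Q : (n : ℕ) × PosMatrix n, { p : (auFamily.{u} Q ⟶ ∐ t) × (auFamily.{u} Q ⟶ ∐ t) //
      p.1 ≫ π = p.2 ≫ π }) → CQG.{u} := fun i => auFamily i.1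
  let f : ∐ s ⟶ ∐ t := Sigma.desc fun i => i.2.1.1
  let g : ∐ s ⟶ ∐ t := Sigma.desc fun i => i.2.1.2
  have w : f ≫ π = g ≫ π := Sigma.hom_ext _ _ fun i => by
    simpa [f, g] using i.2.2
  have hπ : Function.Surjective (alg π) := surjective_of_factors fun n Q k =>
    ⟨Sigma.ι t ⟨⟨n, Q⟩, k⟩, Sigma.ι_desc _ _⟩
  have hker {S : CQG.{u}} (k : ∐ t ⟶ S) (hk : f ≫ k = g ≫ k) (y : (∐ t : CQG.{u}))
      (hy : alg π y = 0) : alg k y = 0 := by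
    refine CoequalizesAu.alg_eq_zero (fun n Q p q hpq => ?_) hy
    have e := congrArg (Sigma.ι s ⟨⟨n, Q⟩, (p, q), hpq⟩ ≫ ·) hk
    simpa [f, g] using e
  refine ⟨_, _, s, t, Cofan.mk (∐ s) (Sigma.ι s), Cofan.mk (∐ t) (Sigma.ι t), f, g, π, w,
    fun i => ObjectProperty.ofObj_apply _ _, fun j => ObjectProperty.ofObj_apply _ _,
    ⟨coproductIsCoproduct s⟩, ⟨coproductIsCoproduct t⟩, ⟨Cofork.IsColimit.mk _
      (fun c => descHom hπ (hker c.π c.condition)) (fun c => comp_descHom hπ _)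
      (fun c m hm => hom_ext_of_surjective hπ (hm.trans (comp_descHom hπ _).symm))⟩⟩

/-- The presentation of each object is a regular, hence extremal, epimorphism from a coproduct of
finitely presentable `Au Q`. These form a strong generator, and with cocompleteness this
characterizes local finite presentability. -/
theorem isLocallyFinitelyPresentable : IsLocallyFinitelyPresentable.{u} CQG.{u} := by
  have := hasColimits.{u}
  have := Cardinal.fact_isRegular_aleph0.{u}
  rw [IsLocallyFinitelyPresentable, IsCardinalLocallyPresentable.iff_exists_isStrongGenerator]
  refine ⟨ObjectProperty.ofObj auFamily.{u}, inferInstance,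
    ObjectProperty.IsStrongGenerator.mk_of_exists_extremalEpi.{u} fun X => ?_, ?_⟩
  · obtain ⟨I, J, s, t, Y, Z, f, g, π, w, -, ht, -, ⟨hZ⟩, ⟨hπ⟩⟩ := isRegularGenerator_au.{u}.2 X
    have : IsRegularEpi π := ⟨⟨⟨_, f, g, w, hπ⟩⟩⟩
    exact ⟨J, t, ht, Z, hZ, π, inferInstance⟩
  · rintro _ ⟨Q⟩
    exact isFinitelyPresentable_au Q.2

end CQG

/-- The category `CQG` of CQG algebras is cocomplete, every `A_u(Q)` is finitely presentable in it,
the set of all `A_u(Q)` is a regular generator, and `CQG` is locally finitely presentable. -/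
theorem mainTheorem1 :
    HasColimits CQG.{u} ∧
    (∀ (n : ℕ) (Q : QuantumGroup.PosMatrix n),
      IsFinitelyPresentable.{u} (QuantumGroup.Au.{u} Q)) ∧
    IsRegularGenerator (ObjectProperty.ofObj
      (fun Q : (n : ℕ) × QuantumGroup.PosMatrix n => QuantumGroup.Au.{u} Q.2)) ∧
    IsLocallyFinitelyPresentable.{u} CQG.{u} :=
  ⟨CQG.hasColimits, fun _ Q => CQG.isFinitelyPresentable_au Q, CQG.isRegularGenerator_au,
    CQG.isLocallyFinitelyPresentable⟩
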